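/- Let $n\ge 4$ and let $W(D_n)$ be the Coxeter group of type $D_n$ with generators $s_{\overline 1},s_1,\dots,s_{n-1}$, where $m(s_i,s_{i+1})=3$ for $1\le i\le n-2$, $m(s_{\overline 1},s_2)=3$, and all other pairs of distinct generators commute. An element $w$ is fully commutative if any two of its reduced expressions are related by a sequence of commutation moves $st\mapsto ts$ with $m(s,t)=2$. The heap of a fully commutative $w$ is of type I if some reduced expression of $w$ contains $s_{\overline 1}s_1$ as a consecutive subword, and of type II otherwise. An L-decorated $n$-diagram is, up to isotopy, a finite family of disjoint curves in a rectangle with nodes $1,\dots,n$ on its north face and $1',\dots,n'$ on its south face: edges joining the $2n$ nodes in pairs, and finitely many loops. Each curve carries finitely many decorations; every decorated curve can be deformed to the left wall without crossing another curve; and a diagram in which all edges join the north face to the south face is undecorated. Diagrams are multiplied by stacking, the first factor on top. Let $\widehat{\mathcal P}_n$ be the $\mathbb Z[\delta]$-algebra spanned by these diagrams modulo the following relations: an undecorated loop equals $\delta$; two adjacent decorations on a curve cancel; in the presence of a loop with one decoration, any other curve loses a decoration. A diagram is irreducible if none of these relations can be applied to it. An irreducible diagram is $D$-admissible of type I if it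 has exactly one loop, which is decorated, and no other decorations; it is $D$-admissible of type II if it has no loops and the total number of decorations is even. For $1\le i\le n-1$, let $d_i$ be the undecorated diagram with edges $\{i,i+1\}$ and $\{i',(i+1)'\}$ and all other edges vertical, and let $d_{\overline 1}$ be $d_1$ with one decoration on each of the edges $\{1,2\}$ and $\{1',2'\}$. Theorem. For every fully commutative $w\in W(D_n)$ with reduced expression $s_{x_1}\cdots s_{x_m}$, the product $d_w=d_{x_1}\cdots d_{x_m}$ in $\widehat{\mathcal P}_n$ is a $D$-admissible diagram, which does not depend on the reduced expression chosen. It is of type I if and only if the heap of $w$ is of type I, and of type II if and only if the heap of $w$ is of type II. Moreover the type I and type II diagrams are indexed by the type I and type II heaps, respectively: $w\mapsto d_w$ is a bijection from the fully commutative elements with heap of type I onto the $D$-admissible diagrams of type I, and a bijection from those with heap of type II onto the $D$-admissible diagrams of type II. -/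

import Mathlib

open Polynomial

namespace TLD

/-! ## The Coxeter system of type `D_n` and fully commutative elements

The generators are indexed by `Fin n`: index `0` is `s_{1̄}` and index `i ≥ 1` is `s_i`. -/

/-- `s_i` and `s_j` are joined in the Coxeter graph of type `D_n`: either `1 ≤ i` and `j = i + 1`,
or `{i, j}` is the pair `1̄`, `2` (indices `0` and `2`). -/
def Linked {n : ℕ} (i j : Fin n) : Prop :=
  (1 ≤ (i : ℕ) ∧ (j : ℕ) = i + 1) ∨ (1 ≤ (j : ℕ) ∧ (i : ℕ) = j + 1) ∨
    ((i : ℕ) = 0 ∧ (j : ℕ) = 2) ∨ ((j : ℕ) = 0 ∧ (i : ℕ) = 2)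

instance {n : ℕ} (i j : Fin n) : Decidable (Linked i j) := by
  unfold Linked; infer_instance

/-- The Coxeter matrix of type `D_n`, with `s_{1̄}` and `s_1` the two ends of the fork. -/
def coxeterMatrix (n : ℕ) : CoxeterMatrix (Fin n) where
  M := Matrix.of fun i j => if i = j then 1 else if Linked i j then 3 else 2
  isSymm := by
    ext i j
    have h : Linked i j ↔ Linked j i := by unfold Linked; tauto
    simp [Matrix.transpose_apply, eq_comm, h]
  diagonal := by simp
  off_diagonal := by
    intro i j h
    simp only [Matrix.of_apply, if_neg h]
    split <;> decide

/-- The Coxeter group `W(D_n)`. -/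
abbrev W (n : ℕ) : Type := (coxeterMatrix n).Group

/-- The word `ω` is a reduced expression for `w`. -/
def IsReducedExpr {n : ℕ} (ω : List (Fin n)) (w : W n) : Prop :=
  (coxeterMatrix n).toCoxeterSystem.IsReduced ω ∧
    (coxeterMatrix n).toCoxeterSystem.wordProd ω = w

/-- A single commutation move `st ↦ ts` with `m(s,t) = 2`. -/
inductive CommMove {n : ℕ} : List (Fin n) → List (Fin n) → Prop
  | swap (l r : List (Fin n)) (s t : Fin n) (h : coxeterMatrix n s t = 2) :
      CommMove (l ++ s :: t :: r) (l ++ t :: s :: r)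

/-- `w` is fully commutative: its reduced expressions form a single commutation class. -/
def IsFullyCommutative {n : ℕ} (w : W n) : Prop :=
  ∀ ω ω' : List (Fin n), IsReducedExpr ω w → IsReducedExpr ω' w →
    Relation.ReflTransGen CommMove ω ω'

/-- The fully commutative elements of `W(D_n)`. -/
abbrev FC (n : ℕ) : Type := {w : W n // IsFullyCommutative w}

/-- The heap of `w` is of type I: `s_{1̄} s_1` is a (consecutive) subword of some reduced
expression for `w`. -/
def HeapTypeI {n : ℕ} (w : W n) : Prop :=
  ∃ ω : List (Fin n), IsReducedExpr ω w ∧ [0, 1] <:+: ω.map Fin.val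

/-- The heap of `w` is of type II if it is not of type I. -/
def HeapTypeII {n : ℕ} (w : W n) : Prop := ¬ HeapTypeI w

/-! ## Decorated diagrams -/

/-- The nodes of the standard `k`-box: `inl i` is the node `i + 1` of the north face,
`inr i` the node `(i + 1)'` of the south face. -/
abbrev Node (k : ℕ) : Type := Fin k ⊕ Fin k

/-- The combinatorial data of a decorated pseudo `k`-diagram, not yet assumed planar: which nodes
are joined by an edge, how many decorations the edge at each node carries, and the list, without
order, of the numbers of decorations on the loops. -/
@[ext]
structure Diagram (k : ℕ) where
  /-- the other end of the edge at a node -/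
  partner : Node k → Node k
  partner_invol : Function.Involutive partner
  partner_ne : ∀ u, partner u ≠ u
  /-- the number of decorations on the edge at a node -/
  deco : Node k → ℕ
  deco_partner : ∀ u, deco (partner u) = deco u
  /-- the numbers of decorations on the loops -/
  loops : Multiset ℕ

/-- Position of a node on the boundary of the box, read clockwise from the left wall:
`1, 2, …, k, k', …, 2', 1'`. -/
def Node.pos {k : ℕ} : Node k → ℕ
  | Sum.inl i => i
  | Sum.inr i => 2 * k - 1 - i

namespace Diagram

variable {k : ℕ}

/-- The edges can be drawn in the box without crossings. -/
def IsPlanar (D : Diagram k) : Prop :=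
  ∀ u v : Node k, ¬ (u.pos < v.pos ∧ v.pos < (D.partner u).pos ∧
    (D.partner u).pos < (D.partner v).pos)

/-- No edge separates the edge at `u` from the left wall of the box. -/
def IsLeftExposed (D : Diagram k) (u : Node k) : Prop :=
  ∀ v : Node k, ¬ (v.pos < u.pos ∧ v.pos < (D.partner u).pos ∧
    u.pos < (D.partner v).pos ∧ (D.partner u).pos < (D.partner v).pos)

/-- L-decorated pseudo `k`-diagrams: planar; a diagram all of whose edges propagate (and so its
`a`-value is `0`) is undecorated; and every decorated edge can be deformed to touch the left wall.
(A decorated loop likewise has to lie in the region next to the left wall, which determines its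
place; the place of an undecorated loop is irrelevant, since such loops are scalars below.) -/
structure IsLDecorated (D : Diagram k) : Prop where
  planar : D.IsPlanar
  undecorated : (∀ i : Fin k, ∃ j : Fin k, D.partner (Sum.inl i) = Sum.inr j) →
    (∀ u, D.deco u = 0) ∧ ∀ m ∈ D.loops, m = 0
  exposed : ∀ u, D.deco u ≠ 0 → D.IsLeftExposed u

/-! ### Concatenation

To multiply `D * E`, the box of `D` is put on top of that of `E`. A node of `D` is tagged `inl`,
one of `E` is tagged `inr`. The south node `i'` of `D` is glued to the north node `i` of `E`. -/

/-- The nodes of two stacked boxes (before gluing). -/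
abbrev Stacked (k : ℕ) : Type := Node k ⊕ Node k

/-- The gluing of the south face of the upper box to the north face of the lower box; the other
nodes are left fixed. -/
def glue : Stacked k → Stacked k
  | Sum.inl (Sum.inl i) => Sum.inl (Sum.inl i)
  | Sum.inl (Sum.inr i) => Sum.inr (Sum.inl i)
  | Sum.inr (Sum.inl i) => Sum.inl (Sum.inr i)
  | Sum.inr (Sum.inr i) => Sum.inr (Sum.inr i)

/-- The node of the large box, if any, at a node of the two stacked boxes. -/
def boundary : Stacked k → Option (Node k)
  | Sum.inl (Sum.inl i) => some (Sum.inl i)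
  | Sum.inl (Sum.inr _) => none
  | Sum.inr (Sum.inl _) => none
  | Sum.inr (Sum.inr i) => some (Sum.inr i)

/-- The nodes of the large box among the nodes of the two stacked boxes. -/
def outer : Node k → Stacked k
  | Sum.inl i => Sum.inl (Sum.inl i)
  | Sum.inr i => Sum.inr (Sum.inr i)

theorem glue_invol : Function.Involutive (glue (k := k)) := by
  rintro ((i | i) | (i | i)) <;> rfl

theorem boundary_glue (x : Stacked k) : boundary (glue x) = boundary x := by
  rcases x with ((i | i) | (i | i)) <;> rfl

theorem boundary_outer (u : Node k) : boundary (outer u) = some u := by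
  rcases u with (i | i) <;> rfl

theorem glue_outer (u : Node k) : glue (outer u) = outer u := by
  rcases u with (i | i) <;> rfl

theorem outer_of_boundary {x : Stacked k} {u : Node k} (h : boundary x = some u) :
    x = outer u := by
  rcases x with ((i | i) | (i | i)) <;> simp_all [boundary] <;> subst h <;> rfl

theorem boundary_of_glue_eq {x : Stacked k} (h : glue x = x) : (boundary x).isSome := by
  rcases x with ((i | i) | (i | i)) <;> simp_all [boundary, glue]

/-- Go to the other end of the edge at a node of the two stacked boxes. -/
def cross (D E : Diagram k) : Stacked k → Stacked k := Sum.map D.partner E.partner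

theorem cross_invol (D E : Diagram k) : Function.Involutive (cross D E) := by
  rintro (u | u) <;> simp [cross, D.partner_invol u, E.partner_invol u]

theorem cross_ne (D E : Diagram k) (x : Stacked k) : cross D E x ≠ x := by
  rcases x with (u | u) <;> simp [cross, D.partner_ne u, E.partner_ne u]

/-- One step of the walk along a glued edge: pass through the gluing, then follow an edge. -/
def step (D E : Diagram k) : Equiv.Perm (Stacked k) :=
  glue_invol.toPerm.trans (cross_invol D E).toPerm

theorem step_apply (D E : Diagram k) (x : Stacked k) : step D E x = cross D E (glue x) := rfl

theorem step_glue_step (D E : Diagram k) (x : Stacked k) :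
    step D E (glue (step D E x)) = glue x := by
  simp only [step_apply, glue_invol _, cross_invol D E _]

theorem step_pow_reverse (D E : Diagram k) (x y : Stacked k) (j i : ℕ)
    (h : (step D E)^[j + i] x = glue y) :
    (step D E)^[j] y = glue ((step D E)^[i] x) := by
  induction j generalizing i with
  | zero => simpa [glue_invol y] using (congrArg glue h).symm
  | succ j ih =>
    have h2 := ih (i + 1) (by rw [← h]; congr 1; omega)
    rw [Function.iterate_succ_apply', h2, Function.iterate_succ_apply', step_glue_step]

theorem exists_return (D E : Diagram k) (u : Node k) :
    ∃ m, (boundary ((step D E)^[m + 1] (outer u))).isSome := by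
  obtain ⟨m, hm, h⟩ := (isOfFinOrder_of_finite (step D E)).exists_pow_eq_one
  refine ⟨m - 1, ?_⟩
  rw [Nat.sub_add_cancel hm, ← Equiv.Perm.coe_pow, h]
  simp [boundary_outer]

/-- The walk that starts at the node `u` of the large box meets the boundary of the large box
again for the first time after `walkLength D E u + 1` steps. -/
def walkLength (D E : Diagram k) (u : Node k) : ℕ := Nat.find (exists_return D E u)

/-- The end of the walk that starts at the node `u` of the large box. -/
def walkEnd (D E : Diagram k) (u : Node k) : Node k :=
  (boundary ((step D E)^[walkLength D E u + 1] (outer u))).get (Nat.find_spec (exists_return D E u))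

theorem iterate_walkLength (D E : Diagram k) (u : Node k) :
    (step D E)^[walkLength D E u + 1] (outer u) = outer (walkEnd D E u) :=
  outer_of_boundary (by simp [walkEnd])

theorem not_boundary_of_lt (D E : Diagram k) (u : Node k) {j : ℕ} (h0 : 0 < j)
    (hj : j < walkLength D E u + 1) : ¬ (boundary ((step D E)^[j] (outer u))).isSome := by
  obtain ⟨j, rfl⟩ := Nat.exists_eq_succ_of_ne_zero h0.ne'
  exact Nat.find_min (exists_return D E u) (by unfold walkLength at hj; omega)

theorem iterate_reverse (D E : Diagram k) (u : Node k) {j i : ℕ}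
    (h : j + i = walkLength D E u + 1) :
    (step D E)^[j] (outer (walkEnd D E u)) = glue ((step D E)^[i] (outer u)) :=
  step_pow_reverse D E _ _ j i (by rw [h, iterate_walkLength, glue_outer])

theorem walkEnd_invol (D E : Diagram k) : Function.Involutive (walkEnd D E) := by
  intro u
  have hl : walkLength D E (walkEnd D E u) = walkLength D E u := by
    rw [walkLength, Nat.find_eq_iff]
    constructor
    · rw [iterate_reverse D E u (i := 0) (by omega)]
      simp [glue_outer, boundary_outer]
    · intro j hj
      rw [iterate_reverse D E u (i := walkLength D E u - j) (by omega), boundary_glue]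
      exact not_boundary_of_lt D E u (by omega) (by omega)
  have h := iterate_walkLength D E (walkEnd D E u)
  rw [hl, iterate_reverse D E u (i := 0) (by omega)] at h
  have h2 := congrArg boundary h
  simpa [glue_outer, boundary_outer, eq_comm] using h2

theorem walkEnd_ne (D E : Diagram k) (u : Node k) : walkEnd D E u ≠ u := by
  intro hu
  rcases Nat.even_or_odd' (walkLength D E u + 1) with ⟨j, hj | hj⟩
  · have h := iterate_reverse D E u (j := j) (i := j) (by omega)
    rw [hu] at h
    exact not_boundary_of_lt D E u (j := j) (by omega) (by omega) (boundary_of_glue_eq h.symm)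
  · have h := iterate_reverse D E u (j := j + 1) (i := j) (by omega)
    rw [hu, Function.iterate_succ_apply', step_apply] at h
    exact cross_ne D E _ h

/-- The nodes of the stacked boxes that lie on the same glued edge or loop as `x`: those that the
walk from `x` meets, before or after passing through the gluing. -/
def component (D E : Diagram k) (x : Stacked k) : Finset (Stacked k) :=
  Finset.univ.filter fun y => (step D E).SameCycle x y ∨ (step D E).SameCycle x (glue y)

/-- The number of decorations on a union `C` of edges of the two stacked diagrams, given through
its nodes: every edge is counted at both of its ends, hence the factor `1/2`. -/
def decoOn (D E : Diagram k) (C : Finset (Stacked k)) : ℕ :=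
  (∑ x ∈ C, Sum.elim D.deco E.deco x) / 2

/-- The loops that arise by gluing, as sets of nodes. -/
def newLoops (D E : Diagram k) : Finset (Finset (Stacked k)) :=
  (Finset.univ.image (component D E)).filter fun C => ∀ x ∈ C, boundary x = none

theorem component_walkEnd (D E : Diagram k) (u : Node k) :
    component D E (outer (walkEnd D E u)) = component D E (outer u) := by
  have h : (step D E).SameCycle (outer u) (outer (walkEnd D E u)) :=
    ⟨(walkLength D E u + 1 : ℕ), by
      rw [zpow_natCast, Equiv.Perm.coe_pow, iterate_walkLength]⟩
  ext y
  simp only [component, Finset.mem_filter, Finset.mem_univ, true_and]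
  exact or_congr ⟨h.trans, h.symm.trans⟩ ⟨h.trans, h.symm.trans⟩

/-- Concatenation: `D * E` is `D` on top of `E`. The edges of `D * E` are the walks between nodes
of the large box; all decorations on the pieces of a glued edge or loop are kept. -/
instance : Mul (Diagram k) where
  mul D E :=
    { partner := walkEnd D E
      partner_invol := walkEnd_invol D E
      partner_ne := walkEnd_ne D E
      deco := fun u => decoOn D E (component D E (outer u))
      deco_partner := fun u => by rw [component_walkEnd]
      loops := D.loops + E.loops + (newLoops D E).val.map (decoOn D E) }

/-- The diagram `d_e`: all edges are vertical, no decorations, no loops. -/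
instance : One (Diagram k) where
  one :=
    { partner := Sum.swap
      partner_invol := Sum.swap_swap
      partner_ne := by rintro (i | i) <;> simp
      deco := fun _ => 0
      deco_partner := fun _ => rfl
      loops := 0 }

/-! ### Reduction of diagrams -/

/-- `Reduces D c E`: one of the defining relations rewrites `D` as `c • E`.

* an undecorated loop is replaced by the scalar `δ = X`;
* two decorations on one edge, or on one loop, cancel;
* in the presence of a loop with one decoration, any edge and any other loop loses a decoration. -/
inductive Reduces : Diagram k → ℤ[X] → Diagram k → Prop
  | loop (D E : Diagram k) (hp : D.partner = E.partner) (hd : D.deco = E.deco)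
      (hl : D.loops = 0 ::ₘ E.loops) : Reduces D X E
  | cancelEdge (D E : Diagram k) (u : Node k) (hp : D.partner = E.partner)
      (hu : D.deco u = E.deco u + 2)
      (hd : ∀ v, v ≠ u → v ≠ D.partner u → D.deco v = E.deco v)
      (hl : D.loops = E.loops) : Reduces D 1 E
  | cancelLoop (D E : Diagram k) (m : ℕ) (L : Multiset ℕ) (hp : D.partner = E.partner)
      (hd : D.deco = E.deco) (hD : D.loops = (m + 2) ::ₘ L) (hE : E.loops = m ::ₘ L) :
      Reduces D 1 E
  | absorbEdge (D E : Diagram k) (u : Node k) (hp : D.partner = E.partner)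
      (hu : D.deco u = E.deco u + 1)
      (hd : ∀ v, v ≠ u → v ≠ D.partner u → D.deco v = E.deco v)
      (hl : D.loops = E.loops) (hmem : 1 ∈ D.loops) : Reduces D 1 E
  | absorbLoop (D E : Diagram k) (m : ℕ) (L : Multiset ℕ) (hp : D.partner = E.partner)
      (hd : D.deco = E.deco) (hD : D.loops = 1 ::ₘ (m + 1) ::ₘ L)
      (hE : E.loops = 1 ::ₘ m ::ₘ L) : Reduces D 1 E

/-- No relation can be applied to `D`. -/
def IsIrreducible (D : Diagram k) : Prop := ∀ (c : ℤ[X]) (E : Diagram k), ¬ Reduces D c E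

end Diagram

/-- The L-decorated pseudo `k`-diagrams. -/
abbrev LDiagram (k : ℕ) : Type := {D : Diagram k // D.IsLDecorated}

/-- The span of the defining relations in the free `ℤ[δ]`-module on the L-decorated diagrams. Since
the relations are imposed on all diagrams, on edges as well as on loops, this span is stable under
concatenation with diagrams: it is the ideal generated by the relations. -/
noncomputable def relations (k : ℕ) : Submodule ℤ[X] (LDiagram k →₀ ℤ[X]) :=
  Submodule.span ℤ[X]
    {x | ∃ (D E : LDiagram k) (c : ℤ[X]), D.1.Reduces c E.1 ∧
      x = Finsupp.single D 1 - Finsupp.single E c}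

/-- The algebra of L-decorated diagrams modulo the defining relations (as a `ℤ[δ]`-module); the
product of the classes of two diagrams is the class of their concatenation. -/
abbrev DiagramAlgebra (k : ℕ) : Type := (LDiagram k →₀ ℤ[X]) ⧸ relations k

namespace LDiagram

variable {k : ℕ}

/-- The element of the diagram algebra given by a diagram. -/
noncomputable def toAlgebra (D : LDiagram k) : DiagramAlgebra k :=
  (relations k).mkQ (Finsupp.single D 1)

/-- The total number of decorations on the edges (each edge has two ends) and loops. -/
def numDecorations (D : LDiagram k) : ℕ := (∑ u, D.1.deco u) / 2 + D.1.loops.sum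

/-- `D`-admissible of type I: irreducible, with exactly one loop, which is decorated, and no other
decorations. -/
def IsTypeI (D : LDiagram k) : Prop :=
  D.1.IsIrreducible ∧ (∃ m, m ≠ 0 ∧ D.1.loops = {m}) ∧ ∀ u, D.1.deco u = 0

/-- `D`-admissible of type II: irreducible, without loops, and with an even total number of
decorations. -/
def IsTypeII (D : LDiagram k) : Prop :=
  D.1.IsIrreducible ∧ D.1.loops = 0 ∧ Even (numDecorations D)

end LDiagram

/-! ### Simple diagrams -/

/-- The left one of the two adjacent nodes joined in the simple diagram of index `j`: the nodes
`1, 2` for `d_{1̄}` (index `0`), and the nodes `i, i + 1` for `d_i` (index `i ≥ 1`); nodes are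
counted from `0` here. -/
def leftNode {n : ℕ} (j : Fin n) : Fin n := ⟨(j : ℕ) - 1, by omega⟩

/-- The right one of the two adjacent nodes joined in the simple diagram of index `j`. -/
def rightNode {n : ℕ} (hn : 4 ≤ n) (j : Fin n) : Fin n := ⟨(j : ℕ) - 1 + 1, by omega⟩

theorem leftNode_ne_rightNode {n : ℕ} (hn : 4 ≤ n) (j : Fin n) :
    leftNode j ≠ rightNode hn j := by
  simp [leftNode, rightNode, Fin.ext_iff]

/-- The edges of the simple diagram of index `j`: the two adjacent nodes are joined in the north
face and in the south face, and all other edges are vertical. -/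
def simplePartner {n : ℕ} (hn : 4 ≤ n) (j : Fin n) (u : Node n) : Node n :=
  if u = Sum.inl (leftNode j) then Sum.inl (rightNode hn j)
  else if u = Sum.inl (rightNode hn j) then Sum.inl (leftNode j)
  else if u = Sum.inr (leftNode j) then Sum.inr (rightNode hn j)
  else if u = Sum.inr (rightNode hn j) then Sum.inr (leftNode j)
  else u.swap

/-- The simple diagrams `d_{1̄}` (index `0`) and `d_i` (index `i ≥ 1`) in the standard `n`-box. In
`d_{1̄}` each of the two non-propagating edges carries one decoration; the others are
undecorated. -/
def simpleDiagram {n : ℕ} (hn : 4 ≤ n) (j : Fin n) : Diagram n where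
  partner := simplePartner hn j
  partner_invol := by
    have h := leftNode_ne_rightNode hn j
    rintro (i | i) <;> by_cases h1 : i = leftNode j <;> by_cases h2 : i = rightNode hn j <;>
      simp_all [simplePartner, eq_comm]
  partner_ne := by
    have h := leftNode_ne_rightNode hn j
    rintro (i | i) <;> by_cases h1 : i = leftNode j <;> by_cases h2 : i = rightNode hn j <;>
      simp_all [simplePartner, eq_comm]
  deco := fun u =>
    if (j : ℕ) = 0 ∧ (u.elim id id = leftNode j ∨ u.elim id id = rightNode hn j) then 1 else 0
  deco_partner := by
    have h := leftNode_ne_rightNode hn j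
    rintro (i | i) <;> by_cases h1 : i = leftNode j <;> by_cases h2 : i = rightNode hn j <;>
      simp_all [simplePartner, eq_comm]
  loops := 0

/-- The concatenation `d_{x₁} d_{x₂} ⋯ d_{xₘ}` of simple diagrams along a word. -/
def wordDiagram {n : ℕ} (hn : 4 ≤ n) (ω : List (Fin n)) : Diagram n :=
  (ω.map (simpleDiagram hn)).prod

end TLD

/-!
Modulo the relations, and up to a power of `δ`, a diagram is a matching of its nodes in which each
edge carries a parity, and which forgets all parities once a loop with an odd number of decorations
is present. On these matchings the generators act by joining two adjacent nodes, and this action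
satisfies the Temperley-Lieb relations.

A word is fully commutative if no sequence of commutations turns it into one that contains `ss` or
`sts` with linked `s` and `t`. By induction on the largest letter `g`, such a word factors as a
representative of a coset of the parabolic subgroup of the smaller letters, followed by a word in
these letters. As the node `g` is joined vertically in the smaller word, the representative can be
read off the matching of the whole word: fully commutative words with the same matching are related
by commutations, no loops arise except for decorated ones, and these come from a factor `s_1̄ s_1`.

The action at `δ = 2` sends `s` to `1 - e_s` in a representation of the Coxeter group. Its leading
terms show that the fully commutative words are exactly the reduced expressions of the fully
commutative elements.

Conversely, the diagrams of both types come from words: a planar matching with an edge on the north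
face has an edge that joins two adjacent nodes and equals a simple diagram there. Its letter can be
moved to the right end of the diagram, where it is split off together with a node.
-/

namespace TLD

/-! ## Decorated matchings -/

/-- A decorated diagram modulo the relations and up to powers of `δ`: a perfect matching of the
nodes `V`, with the number of decorations on the edge at each node counted modulo two. The
proposition `hasLoop` records the presence of a loop with one decoration, which absorbs all other
decorations; undecorated loops are not recorded. -/
@[ext]
structure Matching (V : Type*) where
  partner : V → V
  parity : V → ZMod 2
  hasLoop : Prop
  involutive : Function.Involutive partner
  partner_ne : ∀ v, partner v ≠ v
  parity_partner : ∀ v, parity (partner v) = parity v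
  parity_of_hasLoop : hasLoop → ∀ v, parity v = 0

namespace Matching

variable {V : Type*}

theorem ext_of_parity {x y : Matching V} (hp : x.partner = y.partner)
    (hl : x.hasLoop ↔ y.hasLoop)
    (hg : ¬ x.hasLoop → ¬ y.hasLoop → ∀ v, x.parity v = y.parity v) : x = y := by
  refine Matching.ext hp (funext fun v => ?_) (propext hl)
  by_cases hx : x.hasLoop
  · rw [x.parity_of_hasLoop hx, y.parity_of_hasLoop (hl.1 hx)]
  · exact hg hx (mt hl.2 hx) v

theorem ext_of_hasLoop {x y : Matching V} (hx : x.hasLoop) (hy : y.hasLoop)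
    (hp : x.partner = y.partner) : x = y :=
  ext_of_parity hp (iff_of_true hx hy) fun h => absurd hx h

theorem partner_eq_comm (x : Matching V) {u v : V} : x.partner u = v ↔ x.partner v = u :=
  x.involutive.eq_iff.trans eq_comm

variable [DecidableEq V]

/-- The matching obtained from `f` by joining `a` to `b`, and the former partners of `a` and `b`
to each other. -/
def joinPartner (a b : V) (f : V → V) (v : V) : V :=
  if v = a then b else if v = b then a else if v = f a then f b else if v = f b then f a else f v

/-- The parities of the edges after joining `a` and `b` by an edge of parity `e`. The new edge
between the former partners of `a` and `b` is composed of their old edges and another edge of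
parity `e`, as in the product with a simple diagram. -/
def joinParity (a b : V) (e : ZMod 2) (f : V → V) (g : V → ZMod 2) (v : V) : ZMod 2 :=
  if v = a ∨ v = b then e else if v = f a ∨ v = f b then g a + g b + e else g v

theorem joinPartner_involutive {a b : V} {f : V → V} (hf : Function.Involutive f)
    (hn : ∀ v, f v ≠ v) : Function.Involutive (joinPartner a b f) := by
  intro v
  grind [joinPartner, Function.Involutive]

theorem joinPartner_left {a b : V} {f : V → V} : joinPartner a b f a = b :=
  if_pos rfl

theorem joinPartner_right {a b : V} {f : V → V} (hab : a ≠ b) : joinPartner a b f b = a := by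
  simp only [joinPartner, hab.symm, if_false, if_true]

theorem joinPartner_of_ne {a b v : V} {f : V → V} (hva : v ≠ a) (hvb : v ≠ b)
    (hva' : v ≠ f a) (hvb' : v ≠ f b) : joinPartner a b f v = f v := by
  simp only [joinPartner, hva, hvb, hva', hvb', if_false]

theorem joinPartner_partner_left {a b : V} {f : V → V} (hn : ∀ v, f v ≠ v) (h : f a ≠ b) :
    joinPartner a b f (f a) = f b := by
  simp only [joinPartner, hn, h, if_false, if_true]

theorem joinPartner_partner_right {a b : V} {f : V → V} (hf : Function.Involutive f)
    (hn : ∀ v, f v ≠ v) (h : f a ≠ b) : joinPartner a b f (f b) = f a := by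
  rw [← joinPartner_partner_left hn h, joinPartner_involutive hf hn]

open Classical in
/-- The product with a simple diagram that joins the nodes `a` and `b` on both of its faces by
edges of parity `e`. If `a` and `b` are already joined, a loop is closed. -/
noncomputable def join (a b : V) (e : ZMod 2) (hab : a ≠ b) (x : Matching V) : Matching V where
  partner := joinPartner a b x.partner
  parity v := if x.hasLoop ∨ (x.partner a = b ∧ x.parity a ≠ e) then 0
    else joinParity a b e x.partner x.parity v
  hasLoop := x.hasLoop ∨ (x.partner a = b ∧ x.parity a ≠ e)
  involutive := joinPartner_involutive x.involutive x.partner_ne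
  partner_ne v := by
    have := x.involutive; have := x.partner_ne
    grind [joinPartner, Function.Involutive]
  parity_partner v := by
    have := x.involutive; have := x.partner_ne; have := x.parity_partner
    grind [joinPartner, joinParity, Function.Involutive]
  parity_of_hasLoop h v := if_pos h

open Classical in
/-- The number of undecorated loops closed by joining `a` and `b`, that is, the exponent of `δ` in
the product with the simple diagram. A closed loop without decorations modulo two counts, and so
does any closed loop in the presence of another, decorated one. -/
noncomputable def loopCount (a b : V) (e : ZMod 2) (x : Matching V) : ℕ :=
  if x.partner a = b ∧ (x.hasLoop ∨ x.parity a = e) then 1 else 0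

section Join

variable {a b c d : V} {e e' : ZMod 2}

theorem hasLoop_join (hab : a ≠ b) {x : Matching V} :
    (x.join a b e hab).hasLoop ↔ x.hasLoop ∨ (x.partner a = b ∧ x.parity a ≠ e) :=
  Iff.rfl

theorem parity_join (hab : a ≠ b) {x : Matching V} (h : ¬ (x.join a b e hab).hasLoop) :
    (x.join a b e hab).parity = joinParity a b e x.partner x.parity :=
  funext fun _ => if_neg h

theorem partner_join_left (hab : a ≠ b) (x : Matching V) :
    (x.join a b e hab).partner a = b :=
  if_pos rfl

theorem parity_join_left (hab : a ≠ b) {x : Matching V} (h : ¬ (x.join a b e hab).hasLoop) :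
    (x.join a b e hab).parity a = e := by
  rw [parity_join hab h, joinParity, if_pos (Or.inl rfl)]

theorem join_symm (hab : a ≠ b) (x : Matching V) :
    x.join a b e hab = x.join b a e hab.symm := by
  have hp := x.partner_eq_comm (u := a) (v := b)
  have hg := x.parity_partner a
  refine ext_of_parity ?_ ?_ fun h h' v => ?_
  · ext v; simp only [join]; grind [joinPartner]
  · simp only [hasLoop_join]; grind
  · rw [parity_join _ h, parity_join _ h']; grind [joinParity]

theorem join_eq_self_iff (hab : a ≠ b) {x : Matching V} :
    x.join a b e hab = x ↔ x.partner a = b ∧ (x.hasLoop ∨ x.parity a = e) := by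
  constructor
  · intro h
    refine ⟨by rw [← h, partner_join_left], or_iff_not_imp_left.2 fun hl => ?_⟩
    rw [← h] at hl ⊢
    exact parity_join_left hab hl
  · rintro ⟨hab', he⟩
    have hba := x.partner_eq_comm.1 hab'
    have hg := x.parity_partner
    refine ext_of_parity ?_ ?_ fun h h' v => ?_
    · ext v; simp only [join]; grind [joinPartner]
    · simp only [hasLoop_join]; grind
    · rw [parity_join _ h]; grind [joinParity]

theorem join_idem (hab : a ≠ b) (x : Matching V) :
    (x.join a b e hab).join a b e hab = x.join a b e hab :=
  (join_eq_self_iff hab).2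
    ⟨partner_join_left hab x, or_iff_not_imp_left.2 fun h => parity_join_left hab h⟩

theorem loopCount_of_join_eq_self {hab : a ≠ b} {x : Matching V}
    (h : x.join a b e hab = x) : x.loopCount a b e = 1 :=
  if_pos ((join_eq_self_iff hab).1 h)

theorem loopCount_of_partner_ne {x : Matching V} (h : x.partner a ≠ b) :
    x.loopCount a b e = 0 :=
  if_neg fun h' => h h'.1

/-! ### Disjoint pairs of nodes -/

theorem joinPartner_comm (x : Matching V) (hab : a ≠ b) (hcd : c ≠ d) (hac : a ≠ c) (had : a ≠ d)
    (hbc : b ≠ c) (hbd : b ≠ d) :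
    joinPartner a b (joinPartner c d x.partner) = joinPartner c d (joinPartner a b x.partner) := by
  have := x.involutive; have := x.partner_ne
  ext v
  grind (splits := 20) [joinPartner, Function.Involutive]

theorem joinParity_comm (x : Matching V) (hab : a ≠ b) (hcd : c ≠ d) (hac : a ≠ c) (had : a ≠ d)
    (hbc : b ≠ c) (hbd : b ≠ d) :
    joinParity a b e (joinPartner c d x.partner) (joinParity c d e' x.partner x.parity) =
      joinParity c d e' (joinPartner a b x.partner) (joinParity a b e x.partner x.parity) := by
  have := x.involutive; have := x.partner_ne; have := x.parity_partner
  ext v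
  grind (splits := 20) [joinPartner, joinParity, Function.Involutive]

theorem joinLoop_comm (x : Matching V) (hab : a ≠ b) (hcd : c ≠ d) (hac : a ≠ c) (had : a ≠ d)
    (hbc : b ≠ c) (hbd : b ≠ d) :
    (x.partner c = d ∧ x.parity c ≠ e' ∨ joinPartner c d x.partner a = b ∧
        joinParity c d e' x.partner x.parity a ≠ e) ↔
      (x.partner a = b ∧ x.parity a ≠ e ∨ joinPartner a b x.partner c = d ∧
        joinParity a b e x.partner x.parity c ≠ e') := by
  have h := fun u v => x.partner_eq_comm (u := u) (v := v)
  have hg := x.parity_partner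
  by_cases k1 : x.partner a = b <;> by_cases k2 : x.partner c = d <;>
    by_cases k3 : x.partner a = c <;> by_cases k4 : x.partner b = d <;>
    by_cases k5 : x.partner a = d <;> by_cases k6 : x.partner b = c <;>
    grind [joinPartner, joinParity]

theorem join_comm (x : Matching V) (hab : a ≠ b) (hcd : c ≠ d) (hac : a ≠ c) (had : a ≠ d)
    (hbc : b ≠ c) (hbd : b ≠ d) :
    (x.join c d e' hcd).join a b e hab = (x.join a b e hab).join c d e' hcd := by
  have hp := x.joinPartner_comm hab hcd hac had hbc hbd
  by_cases hx : x.hasLoop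
  · exact ext_of_hasLoop (Or.inl (Or.inl hx)) (Or.inl (Or.inl hx)) hp
  refine ext_of_parity hp ?_ fun h h' v => ?_
  · have := x.joinLoop_comm (e := e) (e' := e') hab hcd hac had hbc hbd
    simp only [join, hx, false_or]
    grind
  · rw [parity_join _ h, parity_join _ h', parity_join _ (mt Or.inl h),
      parity_join _ (mt Or.inl h')]
    exact congrFun (x.joinParity_comm hab hcd hac had hbc hbd) v

theorem loopCount_join_comm (x : Matching V) (hab : a ≠ b) (hcd : c ≠ d) (hac : a ≠ c)
    (had : a ≠ d) (hbc : b ≠ c) (hbd : b ≠ d) :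
    (x.join c d e' hcd).loopCount a b e + x.loopCount c d e' =
      (x.join a b e hab).loopCount c d e' + x.loopCount a b e := by
  have h := fun u v => x.partner_eq_comm (u := u) (v := v)
  have hg := x.parity_partner
  simp only [join, loopCount]
  by_cases k1 : x.partner a = b <;> by_cases k2 : x.partner c = d <;>
    by_cases k3 : x.partner a = c <;> by_cases k4 : x.partner b = d <;>
    by_cases k5 : x.partner a = d <;> by_cases k6 : x.partner b = c <;>
    by_cases hl : x.hasLoop <;> grind [joinPartner, joinParity]

/-! ### Pairs of nodes with one node in common -/

theorem partner_join_ne (hbc : b ≠ c) (hac : a ≠ c) (x : Matching V) :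
    (x.join b c e hbc).partner a ≠ b := fun h =>
  hac (((x.join b c e hbc).partner_eq_comm.1 h).symm.trans (partner_join_left hbc x))

/-- The relation `e_s e_t e_s = e_s` of the Temperley–Lieb algebra, in the form that `e_s e_t`
acts as the identity on the image of `e_s`. -/
theorem join_join_of_join_eq_self {x : Matching V} (hab : a ≠ b) (hbc : b ≠ c) (hac : a ≠ c)
    (hx : x.join a b e hab = x) : (x.join b c e' hbc).join a b e hab = x := by
  obtain ⟨hp, he⟩ := (join_eq_self_iff hab).1 hx
  have hb := x.partner_eq_comm.1 hp
  have hl : (x.join b c e' hbc).hasLoop ↔ x.hasLoop := by grind [hasLoop_join]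
  have hl' : ((x.join b c e' hbc).join a b e hab).hasLoop ↔ x.hasLoop := by
    rw [hasLoop_join, hl, or_iff_left fun h => partner_join_ne hbc hac x h.1]
  have hg := x.parity_partner
  refine ext_of_parity ?_ hl' fun h h' v => ?_
  · ext v
    have := x.partner_eq_comm (u := v) (v := c)
    simp only [join]
    grind (splits := 20) [joinPartner]
  · have := x.partner_eq_comm (u := v) (v := c)
    rw [parity_join _ h, parity_join _ (mt hl.1 h')]
    simp only [join]
    grind (splits := 20) [joinPartner, joinParity]

/-! ### The same pair of nodes with two parities -/

theorem hasLoop_join_join (he : e ≠ e') (hab : a ≠ b) (x : Matching V) :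
    ((x.join a b e' hab).join a b e hab).hasLoop :=
  or_iff_not_imp_left.2 fun h =>
    ⟨partner_join_left hab x, by rw [parity_join_left hab h]; exact he.symm⟩

theorem join_comm_same (hab : a ≠ b) (x : Matching V) :
    (x.join a b e' hab).join a b e hab = (x.join a b e hab).join a b e' hab := by
  obtain rfl | he := eq_or_ne e e'
  · rfl
  · exact ext_of_hasLoop (hasLoop_join_join he hab x) (hasLoop_join_join he.symm hab x) rfl

theorem loopCount_join_comm_same (hab : a ≠ b) (x : Matching V) :
    (x.join a b e' hab).loopCount a b e + x.loopCount a b e' =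
      (x.join a b e hab).loopCount a b e' + x.loopCount a b e := by
  obtain rfl | he := eq_or_ne e e'
  · rfl
  have hex : x.parity a = e ∨ x.parity a = e' := by
    generalize x.parity a = z
    revert e e' z; decide
  have hp := fun e => partner_join_left (e := e) hab x
  have hg := fun e => parity_join_left (e := e) hab (x := x)
  have hl := fun e => hasLoop_join (e := e) hab (x := x)
  simp only [loopCount]
  grind

end Join

end Matching

/-! ## Words over a simply laced Coxeter graph -/

section Words

variable {α β : Type*} {G : SimpleGraph α} {s t : α} {u v w p q r : List α}

/-- Two adjacent commuting letters, that is, distinct letters not joined in the Coxeter graph `G`,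
are exchanged. -/
inductive CommSwap (G : SimpleGraph α) : List α → List α → Prop
  | mk (l r : List α) (s t : α) (h : Gᶜ.Adj s t) : CommSwap G (l ++ s :: t :: r) (l ++ t :: s :: r)

/-- Equality of words up to commutations. -/
abbrev CommEquiv (G : SimpleGraph α) : List α → List α → Prop := Relation.ReflTransGen (CommSwap G)

/-- The rewriting steps `s s ↦ s`, and `s t s ↦ s` for letters joined in `G`, which come from the
relations of the Temperley–Lieb algebra. -/
inductive Contract (G : SimpleGraph α) : List α → List α → Prop
  | sq (l r : List α) (s : α) : Contract G (l ++ s :: s :: r) (l ++ s :: r)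
  | braid (l r : List α) (s t : α) (h : G.Adj s t) :
    Contract G (l ++ s :: t :: s :: r) (l ++ s :: r)

/-- No word in the commutation class can be contracted. By a theorem of Stembridge these are the
reduced words of the fully commutative elements. -/
def FCWord (G : SimpleGraph α) (w : List α) : Prop := ∀ v, CommEquiv G w v → ∀ u, ¬ Contract G v u

/-- Rewriting by commutations and contractions. -/
abbrev Rewrites (G : SimpleGraph α) : List α → List α → Prop :=
  Relation.ReflTransGen fun v w => CommSwap G v w ∨ Contract G v w

/-- The letter `s` comes first in some word of the commutation class of `w`. -/
def IsInitial (G : SimpleGraph α) (s : α) (w : List α) : Prop := ∃ v, CommEquiv G w (s :: v)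

namespace CommSwap

theorem symm : CommSwap G v w → CommSwap G w v
  | ⟨l, r, s, t, h⟩ => ⟨l, r, t, s, h.symm⟩

theorem perm : CommSwap G v w → v.Perm w
  | ⟨l, r, s, t, _⟩ => (List.Perm.swap t s r).append_left l

theorem append (p q : List α) : CommSwap G v w → CommSwap G (p ++ v ++ q) (p ++ w ++ q)
  | ⟨l, r, s, t, h⟩ => by simpa using mk (p ++ l) (r ++ q) s t h

end CommSwap

namespace CommEquiv

theorem symm (h : CommEquiv G v w) : CommEquiv G w v := by
  induction h with
  | refl => exact .refl
  | tail _ h ih => exact ih.head h.symm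

theorem perm (h : CommEquiv G v w) : v.Perm w := by
  induction h with
  | refl => exact .refl _
  | tail _ h ih => exact ih.trans h.perm

theorem length_eq (h : CommEquiv G v w) : v.length = w.length := h.perm.length_eq

theorem append (p q : List α) (h : CommEquiv G v w) : CommEquiv G (p ++ v ++ q) (p ++ w ++ q) :=
  Relation.ReflTransGen.lift (fun z => p ++ z ++ q) (fun _ _ => CommSwap.append p q) _ _ h

theorem append_left (p : List α) (h : CommEquiv G v w) : CommEquiv G (p ++ v) (p ++ w) := by
  simpa using h.append p []

theorem cons (s : α) (h : CommEquiv G v w) : CommEquiv G (s :: v) (s :: w) :=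
  h.append_left [s]

theorem cons_append (r : List α) (h : ∀ x ∈ p, Gᶜ.Adj s x) :
    CommEquiv G (s :: (p ++ r)) (p ++ s :: r) := by
  induction p with
  | nil => exact .refl
  | cons x p ih =>
    have hx : CommSwap G (s :: x :: (p ++ r)) (x :: s :: (p ++ r)) :=
      CommSwap.mk [] _ _ _ (h x List.mem_cons_self)
    exact .head hx ((ih fun y hy => h y (List.mem_cons_of_mem x hy)).cons x)

end CommEquiv

namespace Contract

theorem append (p q : List α) : Contract G v w → Contract G (p ++ v ++ q) (p ++ w ++ q)
  | .sq l r s => by simpa using sq (p ++ l) (r ++ q) s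
  | .braid l r s t h => by simpa using braid (p ++ l) (r ++ q) s t h

theorem length_lt : Contract G v w → w.length < v.length
  | .sq l r s => by simp
  | .braid l r s t _ => by simp

theorem subset : Contract G v w → w ⊆ v
  | .sq l r s => by simp
  | .braid l r s t _ => by intro x; simp; tauto

end Contract

namespace FCWord

theorem commEquiv (h : FCWord G v) (hvw : CommEquiv G v w) : FCWord G w :=
  fun u hu => h u (hvw.trans hu)

theorem of_append (h : FCWord G (p ++ v)) : FCWord G v := fun w hw u hu =>
  h _ (hw.append_left p) (p ++ u) (by simpa using hu.append p [])

theorem tail (h : FCWord G (s :: v)) : FCWord G v := of_append (p := [s]) h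

theorem not_sq (h : FCWord G (u ++ s :: (p ++ s :: r))) (hp : ∀ x ∈ p, Gᶜ.Adj s x) : False :=
  h _ ((CommEquiv.cons_append _ hp).append_left u) _ (by simpa using Contract.sq (u ++ p) r s)

theorem not_braid (h : FCWord G (u ++ s :: (p ++ t :: (q ++ s :: r)))) (hst : G.Adj s t)
    (hp : ∀ x ∈ p, Gᶜ.Adj s x) (hq : ∀ x ∈ q, Gᶜ.Adj s x) : False := by
  refine h (u ++ (p ++ s :: t :: (s :: (q ++ r)))) (CommEquiv.append_left u ?_) _
    (by simpa using Contract.braid (u ++ p) (q ++ r) s t hst)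
  exact (CommEquiv.cons_append _ hp).trans
    (((CommEquiv.cons_append r hq).symm.cons t).cons s |>.append_left p)

theorem exists_contract (h : ¬ FCWord G w) : ∃ v u, CommEquiv G w v ∧ Contract G v u := by
  simpa [FCWord] using h

end FCWord

namespace Rewrites

theorem of_commEquiv (h : CommEquiv G v w) : Rewrites G v w :=
  Relation.ReflTransGen.mono (fun _ _ => Or.inl) _ _ h

theorem length_le (h : Rewrites G v w) : w.length ≤ v.length := by
  induction h with
  | refl => rfl
  | tail _ h ih => exact (h.elim (fun h => h.perm.length_eq.ge) fun h => h.length_lt.le).trans ih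

theorem subset (h : Rewrites G v w) : w ⊆ v := by
  induction h with
  | refl => exact List.Subset.refl _
  | tail _ h ih => exact fun x hx => ih (h.elim (fun h => h.perm.symm.subset) Contract.subset hx)

theorem commEquiv_of_length_eq (h : Rewrites G v w) (hl : w.length = v.length) :
    CommEquiv G v w := by
  induction h with
  | refl => exact .refl
  | tail hvu h ih =>
    obtain h | h := h
    · exact (ih (h.perm.length_eq.trans hl)).tail h
    · exact absurd hl (h.length_lt.trans_le (length_le hvu)).ne

theorem exists_fcWord (w : List α) : ∃ v, FCWord G v ∧ Rewrites G w v := by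
  induction h : w.length using Nat.strong_induction_on generalizing w with
  | _ m ih =>
  subst h
  by_cases hw : FCWord G w
  · exact ⟨w, hw, .refl⟩
  obtain ⟨v, u, hwv, hvu⟩ := FCWord.exists_contract hw
  obtain ⟨v', hv', huv'⟩ := ih _ (hvu.length_lt.trans_eq hwv.length_eq.symm) u rfl
  exact ⟨v', hv', ((of_commEquiv hwv).tail (Or.inr hvu)).trans huv'⟩

end Rewrites

theorem exists_isInitial (hw : w ≠ []) : ∃ s ∈ w, IsInitial G s w := by
  obtain ⟨s, v, rfl⟩ := List.exists_cons_of_ne_nil hw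
  exact ⟨s, List.mem_cons_self, v, .refl⟩

variable {H : SimpleGraph β} {f : α → β}

theorem compl_comap_adj (hf : Function.Injective f) :
    (H.comap f)ᶜ.Adj s t ↔ Hᶜ.Adj (f s) (f t) := by
  simp [SimpleGraph.compl_adj, hf.eq_iff]

theorem CommSwap.map (hf : Function.Injective f) :
    CommSwap (H.comap f) v w → CommSwap H (v.map f) (w.map f)
  | ⟨l, r, s, t, h⟩ => by
    simpa using mk (l.map f) (r.map f) (f s) (f t) ((compl_comap_adj hf).1 h)

theorem CommSwap.exists_of_map (hf : Function.Injective f) {w : List β}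
    (h : CommSwap H (v.map f) w) : ∃ w', w = w'.map f ∧ CommSwap (H.comap f) v w' := by
  generalize hx : v.map f = x at h
  obtain ⟨l, r, s, t, h⟩ := h
  simp only [List.map_eq_append_iff, List.map_eq_cons_iff] at hx
  obtain ⟨l, _, rfl, rfl, s, _, rfl, rfl, t, r, rfl, rfl, rfl⟩ := hx
  exact ⟨l ++ t :: s :: r, by simp, mk _ _ _ _ ((compl_comap_adj hf).2 h)⟩

theorem CommEquiv.exists_of_map (hf : Function.Injective f) {w : List β}
    (h : CommEquiv H (v.map f) w) : ∃ w', w = w'.map f ∧ CommEquiv (H.comap f) v w' := by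
  induction h with
  | refl => exact ⟨v, rfl, .refl⟩
  | tail _ h ih =>
    obtain ⟨u, rfl, hu⟩ := ih
    obtain ⟨w', rfl, hw'⟩ := h.exists_of_map hf
    exact ⟨w', rfl, hu.tail hw'⟩

theorem commEquiv_map_iff (hf : Function.Injective f) :
    CommEquiv H (v.map f) (w.map f) ↔ CommEquiv (H.comap f) v w := by
  refine ⟨fun h => ?_, Relation.ReflTransGen.lift (List.map f) (fun _ _ => CommSwap.map hf) _ _⟩
  obtain ⟨w', hw, h⟩ := h.exists_of_map hf
  rwa [List.map_injective_iff.2 hf hw]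

theorem Contract.map : Contract (H.comap f) v w → Contract H (v.map f) (w.map f)
  | .sq l r s => by simpa using sq (l.map f) (r.map f) (f s)
  | .braid l r s t h => by simpa using braid (l.map f) (r.map f) (f s) (f t) h

theorem Contract.exists_of_map (hf : Function.Injective f) {w : List β}
    (h : Contract H (v.map f) w) : ∃ w', Contract (H.comap f) v w' := by
  generalize hx : v.map f = x at h
  obtain ⟨l, r, s⟩ | ⟨l, r, s, t, h⟩ := h
  all_goals simp only [List.map_eq_append_iff, List.map_eq_cons_iff] at hx
  · obtain ⟨l, _, rfl, rfl, s, _, rfl, rfl, s', r, rfl, hs, rfl⟩ := hx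
    obtain rfl := hf hs
    exact ⟨_, sq _ _ _⟩
  · obtain ⟨l, _, rfl, rfl, s, _, rfl, rfl, t, _, rfl, rfl, s', r, rfl, hs, rfl⟩ := hx
    obtain rfl := hf hs
    exact ⟨_, braid _ _ _ _ h⟩

theorem fcWord_map_iff (hf : Function.Injective f) :
    FCWord H (w.map f) ↔ FCWord (H.comap f) w := by
  constructor
  · exact fun h v hv u hu => h _ ((commEquiv_map_iff hf).2 hv) _ hu.map
  · intro h v hv u hu
    obtain ⟨v, rfl, hv'⟩ := hv.exists_of_map hf
    obtain ⟨u, hu'⟩ := hu.exists_of_map hf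
    exact h v hv' u hu'

end Words

/-! ## Monomial actions of the Temperley–Lieb algebra -/

/-- The combinatorial form of a representation of the Temperley–Lieb algebra of the graph `G` in
which every generator `e_s` maps a basis vector `x` to the multiple `δ ^ exponent s x` of another
basis vector `op s x`. -/
structure TLAction {α : Type*} (G : SimpleGraph α) (X : Type*) where
  op : α → X → X
  exponent : α → X → ℕ
  op_op_self : ∀ s x, op s (op s x) = op s x
  exponent_op_self : ∀ s x, exponent s (op s x) = 1
  op_comm : ∀ {s t}, Gᶜ.Adj s t → ∀ x, op s (op t x) = op t (op s x)
  exponent_comm : ∀ {s t}, Gᶜ.Adj s t → ∀ x,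
    exponent s (op t x) + exponent t x = exponent t (op s x) + exponent s x
  op_braid : ∀ {s t}, G.Adj s t → ∀ x, op s (op t (op s x)) = op s x
  exponent_op : ∀ {s t}, G.Adj s t → ∀ x, exponent s (op t x) = 0

namespace TLAction

section Action

variable {α X : Type*} {G : SimpleGraph α} (A : TLAction G X) {s : α} {v w : List α}

/-- The basis vector to which the product of generators along a word maps `x`. -/
def act (w : List α) (x : X) : X := w.foldr A.op x

/-- The exponent of `δ` in the action of the product of generators along a word. -/
def wordExponent : List α → X → ℕ
  | [], _ => 0
  | s :: w, x => A.exponent s (A.act w x) + wordExponent w x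

theorem act_nil (x : X) : A.act [] x = x := rfl

theorem act_cons (s : α) (w : List α) (x : X) : A.act (s :: w) x = A.op s (A.act w x) := rfl

theorem act_append (v w : List α) (x : X) : A.act (v ++ w) x = A.act v (A.act w x) :=
  List.foldr_append

theorem wordExponent_append (v w : List α) (x : X) :
    A.wordExponent (v ++ w) x = A.wordExponent v (A.act w x) + A.wordExponent w x := by
  induction v with
  | nil => simp [wordExponent]
  | cons s v ih => simp [wordExponent, ih, act_append, add_assoc]

theorem act_eq_of_rewrites (h : Rewrites G v w) (x : X) : A.act v x = A.act w x := by
  induction h with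
  | refl => rfl
  | tail _ h ih =>
    rw [ih]
    obtain ⟨l, r, s, t, h⟩ | ⟨l, r, s⟩ | ⟨l, r, s, t, h⟩ := h
    · simp only [act_append, act_cons, A.op_comm h]
    · simp only [act_append, act_cons, A.op_op_self]
    · simp only [act_append, act_cons, A.op_braid h]

theorem act_eq_of_commEquiv (h : CommEquiv G v w) (x : X) : A.act v x = A.act w x :=
  A.act_eq_of_rewrites (Rewrites.of_commEquiv h) x

theorem wordExponent_eq_of_commEquiv (h : CommEquiv G v w) (x : X) :
    A.wordExponent v x = A.wordExponent w x := by
  induction h with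
  | refl => rfl
  | tail _ h ih =>
    rw [ih]
    obtain ⟨l, r, s, t, h⟩ := h
    have := A.exponent_comm h (A.act r x)
    simp only [wordExponent_append, wordExponent, act_cons, A.op_comm h]
    omega

theorem op_act_of_isInitial (h : IsInitial G s w) (x : X) : A.op s (A.act w x) = A.act w x := by
  obtain ⟨v, hv⟩ := h
  rw [A.act_eq_of_commEquiv hv, act_cons, A.op_op_self]

theorem op_act_comm (h : ∀ t ∈ w, Gᶜ.Adj s t) (x : X) :
    A.op s (A.act w x) = A.act w (A.op s x) := by
  have := A.act_eq_of_commEquiv (CommEquiv.cons_append [] h) x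
  simpa only [List.append_nil, act_cons, act_append, act_nil] using this

theorem not_op_eq_self_of_adj {t : α} (h : G.Adj s t) {x : X} (hs : A.op s x = x)
    (ht : A.op t x = x) : False := by
  have h1 := A.exponent_op_self s x
  have h0 := A.exponent_op h x
  rw [hs] at h1
  rw [ht] at h0
  omega

/-- The orbit of the basis vector `x₀` distinguishes the commutation classes of `FCWord`s. -/
def FaithfulAt (x₀ : X) : Prop :=
  ∀ v w, FCWord G v → FCWord G w → A.act v x₀ = A.act w x₀ → CommEquiv G v w

/-- The restriction of an action to a subset of the letters. -/
def comap {β : Type*} {f : β → α} (hf : Function.Injective f) : TLAction (G.comap f) X where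
  op s := A.op (f s)
  exponent s := A.exponent (f s)
  op_op_self _ := A.op_op_self _
  exponent_op_self _ := A.exponent_op_self _
  op_comm h := A.op_comm ((compl_comap_adj hf).1 h)
  exponent_comm h := A.exponent_comm ((compl_comap_adj hf).1 h)
  op_braid h := A.op_braid h
  exponent_op h := A.exponent_op h

theorem act_comap {β : Type*} {f : β → α} (hf : Function.Injective f) (w : List β) (x : X) :
    (A.comap hf).act w x = A.act (w.map f) x := by
  simp [act, comap, List.foldr_map]

variable {A}

theorem FaithfulAt.comap {β : Type*} {f : β → α} (hf : Function.Injective f) {x₀ : X}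
    (h : A.FaithfulAt x₀) : (A.comap hf).FaithfulAt x₀ := fun v w hv hw he => by
  rw [act_comap, act_comap] at he
  exact (commEquiv_map_iff hf).1
    (h _ _ ((fcWord_map_iff hf).2 hv) ((fcWord_map_iff hf).2 hw) he)

end Action

end TLAction

/-! ## The Coxeter group acting at `δ = 2` -/

namespace TLAction

variable {α X : Type*} {G : SimpleGraph α} (A : TLAction G X) {s t : α} {v w : List α} {x₀ : X}

/-- The linear operator of a generator of the Temperley–Lieb algebra with `δ = 2`. -/
noncomputable def opLin (s : α) : Module.End ℤ (X →₀ ℤ) :=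
  Finsupp.linearCombination ℤ fun x => Finsupp.single (A.op s x) (2 ^ A.exponent s x)

theorem opLin_single (s : α) (x : X) (c : ℤ) :
    A.opLin s (Finsupp.single x c) = Finsupp.single (A.op s x) (c * 2 ^ A.exponent s x) := by
  simp [opLin, Finsupp.linearCombination_single]

theorem opLin_mul_self (s : α) : A.opLin s * A.opLin s = 2 * A.opLin s := by
  rw [two_mul]
  refine Finsupp.lhom_ext fun x c => ?_
  simp only [Module.End.mul_apply, LinearMap.add_apply, opLin_single, A.op_op_self,
    A.exponent_op_self, ← Finsupp.single_add]
  congr 1; ring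

theorem opLin_comm (h : Gᶜ.Adj s t) : A.opLin s * A.opLin t = A.opLin t * A.opLin s := by
  refine Finsupp.lhom_ext fun x c => ?_
  simp only [Module.End.mul_apply, opLin_single, A.op_comm h, mul_assoc, ← pow_add]
  rw [add_comm, A.exponent_comm h, add_comm]

theorem opLin_braid (h : G.Adj s t) : A.opLin s * A.opLin t * A.opLin s = A.opLin s := by
  refine Finsupp.lhom_ext fun x c => ?_
  simp only [Module.End.mul_apply, opLin_single, A.op_braid h, A.exponent_op h,
    A.exponent_op h.symm, pow_zero, mul_one]

/-- The operator of a generator of the Coxeter group with graph `G`, which acts through the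
quotient map from its group algebra to the Temperley–Lieb algebra with `δ = 2`. -/
noncomputable def reflection (s : α) : Module.End ℤ (X →₀ ℤ) := 1 - A.opLin s

theorem reflection_mul_self (s : α) : A.reflection s * A.reflection s = 1 := by
  have := A.opLin_mul_self s
  simp only [reflection, mul_sub, sub_mul, one_mul, mul_one, this]
  noncomm_ring

theorem reflection_comm (h : Gᶜ.Adj s t) :
    A.reflection s * A.reflection t = A.reflection t * A.reflection s := by
  have := A.opLin_comm h
  simp only [reflection, mul_sub, sub_mul, one_mul, mul_one, this]
  noncomm_ring

theorem reflection_braid (h : G.Adj s t) :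
    A.reflection s * A.reflection t * A.reflection s =
      A.reflection t * A.reflection s * A.reflection t := by
  have h1 := A.opLin_braid h
  have h2 := A.opLin_braid h.symm
  have h3 := A.opLin_mul_self s
  have h4 := A.opLin_mul_self t
  simp only [reflection, mul_sub, sub_mul, one_mul, mul_one, h1, h2, h3, h4]
  noncomm_ring

variable (x₀) in
/-- The span of the basis vectors obtained from `x₀` by words of length less than `m`. -/
noncomputable def shortSpan (m : ℕ) : Submodule ℤ (X →₀ ℤ) :=
  Finsupp.supported ℤ ℤ {x | ∃ v : List α, v.length < m ∧ A.act v x₀ = x}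

theorem shortSpan_mono {m m' : ℕ} (h : m ≤ m') : A.shortSpan x₀ m ≤ A.shortSpan x₀ m' :=
  Finsupp.supported_mono fun _ ⟨v, hv, hx⟩ => ⟨v, hv.trans_le h, hx⟩

theorem single_mem_shortSpan {m : ℕ} (h : v.length < m) (c : ℤ) :
    Finsupp.single (A.act v x₀) c ∈ A.shortSpan x₀ m :=
  Finsupp.single_mem_supported _ _ ⟨v, h, rfl⟩

theorem opLin_mem_shortSpan {m : ℕ} {y : X →₀ ℤ} (hy : y ∈ A.shortSpan x₀ m) (s : α) :
    A.opLin s y ∈ A.shortSpan x₀ (m + 1) := by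
  rw [opLin, Finsupp.linearCombination_apply]
  refine Submodule.sum_mem _ fun x hx => Submodule.smul_mem _ _ ?_
  obtain ⟨v, hv, rfl⟩ := (Finsupp.mem_supported _ _).1 hy hx
  exact A.single_mem_shortSpan (v := s :: v) (by simpa using hv) _

theorem reflection_prod_single (w : List α) (x₀ : X) : ∃ y ∈ A.shortSpan x₀ w.length,
    (w.map A.reflection).prod (Finsupp.single x₀ 1) =
      Finsupp.single (A.act w x₀) ((-1) ^ w.length * 2 ^ A.wordExponent w x₀) + y := by
  induction w with
  | nil => exact ⟨0, Submodule.zero_mem _, by simp [wordExponent, act_nil]⟩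
  | cons s w ih =>
    obtain ⟨y, hy, he⟩ := ih
    set c : ℤ := (-1) ^ w.length * 2 ^ A.wordExponent w x₀ with hc
    refine ⟨Finsupp.single (A.act w x₀) c + y - A.opLin s y, ?_, ?_⟩
    · refine Submodule.sub_mem _ (Submodule.add_mem _ (A.single_mem_shortSpan (by simp) _) ?_)
        (A.opLin_mem_shortSpan hy s)
      exact A.shortSpan_mono (by simp) hy
    · have hlead : A.opLin s (Finsupp.single (A.act w x₀) c) = -Finsupp.single (A.act (s :: w) x₀)
          ((-1 : ℤ) ^ (s :: w).length * 2 ^ A.wordExponent (s :: w) x₀) := by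
        rw [opLin_single, ← Finsupp.single_neg, act_cons, hc]
        congr 1
        simp only [wordExponent, List.length_cons, pow_succ, pow_add]
        ring
      rw [List.map_cons, List.prod_cons, Module.End.mul_apply, he, reflection,
        LinearMap.sub_apply, Module.End.one_apply, map_add, hlead]
      abel

namespace FaithfulAt

variable {A}

theorem rewrites (hA : A.FaithfulAt x₀) (hw : FCWord G w) (h : A.act v x₀ = A.act w x₀) :
    Rewrites G v w := by
  obtain ⟨v', hv', hvv'⟩ := Rewrites.exists_fcWord (G := G) v
  exact hvv'.trans (Rewrites.of_commEquiv
    (hA v' w hv' hw ((A.act_eq_of_rewrites hvv' x₀).symm.trans h)))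

theorem shortSpan_apply_eq_zero (hA : A.FaithfulAt x₀) (hw : FCWord G w) {m : ℕ}
    (hm : m ≤ w.length) {y : X →₀ ℤ} (hy : y ∈ A.shortSpan x₀ m) : y (A.act w x₀) = 0 := by
  by_contra hne
  obtain ⟨v, hv, hvw⟩ := (Finsupp.mem_supported _ _).1 hy (Finsupp.mem_support_iff.2 hne)
  exact absurd (hA.rewrites hw hvw).length_le (hv.trans_le hm).not_ge

theorem commEquiv_of_reflection_prod_eq (hA : A.FaithfulAt x₀) (hw : FCWord G w)
    (hl : v.length ≤ w.length) (he : (v.map A.reflection).prod = (w.map A.reflection).prod) :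
    CommEquiv G v w := by
  obtain ⟨y, hy, hy'⟩ := A.reflection_prod_single v x₀
  obtain ⟨z, hz, hz'⟩ := A.reflection_prod_single w x₀
  rw [he, hz'] at hy'
  have hcoeff := DFunLike.congr_fun hy' (A.act w x₀)
  rw [Finsupp.add_apply, Finsupp.add_apply, hA.shortSpan_apply_eq_zero hw hl hy,
    hA.shortSpan_apply_eq_zero hw le_rfl hz, Finsupp.single_eq_same, add_zero, add_zero] at hcoeff
  have hact : A.act v x₀ = A.act w x₀ := by
    by_contra hne
    rw [Finsupp.single_eq_of_ne (Ne.symm hne)] at hcoeff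
    simp at hcoeff
  have hr := hA.rewrites hw hact
  exact hr.commEquiv_of_length_eq (hr.length_le.antisymm hl)

end FaithfulAt

end TLAction

/-! ## Reduced words in simply laced Coxeter groups -/

theorem mul_pow_two_eq_one {N : Type*} [Monoid N] {a b : N} (ha : a * a = 1) (hb : b * b = 1)
    (h : a * b = b * a) : (a * b) ^ 2 = 1 := by
  rw [pow_two, mul_assoc, ← mul_assoc b, ← h, mul_assoc a b b, hb, mul_one, ha]

theorem mul_pow_three_eq_one {N : Type*} [Monoid N] {a b : N} (ha : a * a = 1) (hb : b * b = 1)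
    (h : a * b * a = b * a * b) : (a * b) ^ 3 = 1 := by
  calc (a * b) ^ 3 = (a * b * a) * (b * a * b) := by
        simp only [pow_succ, pow_zero, one_mul, mul_assoc]
    _ = (a * b * a) * (a * b * a) := by rw [h]
    _ = a * b * (a * a) * b * a := by simp only [mul_assoc]
    _ = a * (b * b) * a := by rw [ha]; simp only [mul_assoc, mul_one]
    _ = 1 := by rw [hb, mul_one, ha]

/-- The Coxeter matrix `M` is the simply laced one with Coxeter graph `G`. -/
structure IsCoxeterGraph {B : Type*} (M : CoxeterMatrix B) (G : SimpleGraph B) : Prop where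
  eq_two : ∀ {s t}, Gᶜ.Adj s t → M s t = 2
  eq_three : ∀ {s t}, G.Adj s t → M s t = 3

namespace IsCoxeterGraph

variable {B W : Type*} [Group W] {M : CoxeterMatrix B} {G : SimpleGraph B}
  {cs : CoxeterSystem M W} {s t : B} {v w : List B}

theorem simple_comm (hM : IsCoxeterGraph M G) (h : Gᶜ.Adj s t) :
    cs.simple s * cs.simple t = cs.simple t * cs.simple s := by
  have := cs.wordProd_braidWord_eq s t
  simpa [CoxeterSystem.braidWord, hM.eq_two h, hM.eq_two h.symm, CoxeterSystem.alternatingWord,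
    CoxeterSystem.wordProd] using this

theorem simple_braid (hM : IsCoxeterGraph M G) (h : G.Adj s t) :
    cs.simple s * (cs.simple t * cs.simple s) = cs.simple t * (cs.simple s * cs.simple t) := by
  have := cs.wordProd_braidWord_eq t s
  simpa [CoxeterSystem.braidWord, hM.eq_three h, hM.eq_three h.symm,
    CoxeterSystem.alternatingWord, CoxeterSystem.wordProd] using this

theorem wordProd_eq_of_commEquiv (hM : IsCoxeterGraph M G) (h : CommEquiv G v w) :
    cs.wordProd v = cs.wordProd w := by
  induction h with
  | refl => rfl
  | tail _ h ih =>
    obtain ⟨l, r, s, t, h⟩ := h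
    simp only [ih, CoxeterSystem.wordProd_append, CoxeterSystem.wordProd_cons]
    rw [← mul_assoc (cs.simple s), hM.simple_comm h, mul_assoc]

theorem isReduced_of_length_le (hw : cs.IsReduced w) (hl : v.length ≤ w.length)
    (he : cs.wordProd v = cs.wordProd w) : cs.IsReduced v := by
  have h := cs.length_wordProd_le v
  rw [CoxeterSystem.IsReduced, he] at *
  omega

theorem not_isReduced_of_contract_sq (p q : List B) (s : B) :
    ¬ cs.IsReduced (p ++ s :: s :: q) := by
  intro h
  have hle := cs.length_wordProd_le (p ++ q)
  rw [CoxeterSystem.IsReduced] at h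
  simp only [CoxeterSystem.wordProd_append, CoxeterSystem.wordProd_cons,
    CoxeterSystem.simple_mul_simple_cancel_left] at h hle
  rw [h] at hle
  simp at hle

/-- A braid relation changes the number of occurrences of a letter, so it cannot be applied if all
reduced words are related by commutations. -/
theorem fcWord_of_isReduced (hM : IsCoxeterGraph M G) (hw : cs.IsReduced w)
    (h : ∀ v, cs.IsReduced v → cs.wordProd v = cs.wordProd w → CommEquiv G w v) :
    FCWord G w := by
  intro v hwv u hvu
  have hprod := (hM.wordProd_eq_of_commEquiv (cs := cs) hwv).symm
  have hv := isReduced_of_length_le hw hwv.length_eq.ge hprod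
  obtain ⟨p, q, s⟩ | ⟨p, q, s, t, hst⟩ := hvu
  · exact not_isReduced_of_contract_sq p q s hv
  · have hprod' : cs.wordProd (p ++ t :: s :: t :: q) = cs.wordProd (p ++ s :: t :: s :: q) := by
      have := hM.simple_braid (cs := cs) hst
      simp only [CoxeterSystem.wordProd_append, CoxeterSystem.wordProd_cons]
      simp only [← mul_assoc] at this ⊢
      simp only [mul_assoc (cs.wordProd p), this]
    have hv' := isReduced_of_length_le hv (by simp) hprod'
    classical
    have hcount := (CommEquiv.perm (hwv.symm.trans (h _ hv' (hprod'.trans hprod)))).count_eq s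
    simp [hst.ne.symm] at hcount

section Faithful

variable {X : Type*} {A : TLAction G X} {x₀ : X}

theorem isLiftable_reflection (hM : IsCoxeterGraph M G) (A : TLAction G X) :
    M.IsLiftable A.reflection := by
  intro s t
  obtain rfl | hst := eq_or_ne s t
  · simp [A.reflection_mul_self]
  by_cases h : G.Adj s t
  · rw [hM.eq_three h]
    exact mul_pow_three_eq_one (A.reflection_mul_self s) (A.reflection_mul_self t)
      (A.reflection_braid h)
  · have hc := (SimpleGraph.compl_adj G s t).2 ⟨hst, h⟩
    rw [hM.eq_two hc]
    exact mul_pow_two_eq_one (A.reflection_mul_self s) (A.reflection_mul_self t)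
      (A.reflection_comm hc)

theorem lift_reflection_wordProd (hM : IsCoxeterGraph M G) (w : List B) :
    cs.lift ⟨A.reflection, hM.isLiftable_reflection A⟩ (cs.wordProd w) =
      (w.map A.reflection).prod := by
  simp only [CoxeterSystem.wordProd, map_list_prod, List.map_map]
  congr 2
  exact funext fun s => CoxeterSystem.lift_apply_simple _ (hM.isLiftable_reflection A) s

theorem commEquiv_of_wordProd_eq (hM : IsCoxeterGraph M G) (hA : A.FaithfulAt x₀)
    (hw : FCWord G w) (hl : v.length ≤ w.length) (he : cs.wordProd v = cs.wordProd w) :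
    CommEquiv G v w :=
  hA.commEquiv_of_reflection_prod_eq hw hl <| by
    rw [← hM.lift_reflection_wordProd (cs := cs) v, he, hM.lift_reflection_wordProd]

theorem isReduced_of_fcWord (hM : IsCoxeterGraph M G) (hA : A.FaithfulAt x₀)
    (hw : FCWord G w) : cs.IsReduced w := by
  obtain ⟨v, hv, hvw⟩ := cs.exists_isReduced (cs.wordProd w)
  have hl : v.length ≤ w.length := by
    rw [CoxeterSystem.IsReduced, ← hvw] at hv
    exact hv ▸ cs.length_wordProd_le w
  have hvw' := hM.commEquiv_of_wordProd_eq hA hw hl hvw.symm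
  exact isReduced_of_length_le hv hvw'.length_eq.ge hvw

theorem commEquiv_of_isReduced (hM : IsCoxeterGraph M G) (hA : A.FaithfulAt x₀)
    (hw : FCWord G w) (hv : cs.IsReduced v) (he : cs.wordProd v = cs.wordProd w) :
    CommEquiv G v w :=
  hM.commEquiv_of_wordProd_eq hA hw
    (hv.symm.trans_le (he ▸ cs.length_wordProd_le w)) he

end Faithful

end IsCoxeterGraph

/-! ## Words of type `D` -/

/-- The infinite Coxeter graph of type `D`, with the indices of `Linked`: the letters `0` and `1`
are the two ends of the fork at `2`. -/
def typeD : SimpleGraph ℕ where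
  Adj i j := (1 ≤ i ∧ j = i + 1) ∨ (1 ≤ j ∧ i = j + 1) ∨ (i = 0 ∧ j = 2) ∨ (j = 0 ∧ i = 2)
  symm := ⟨fun i j h => by tauto⟩
  loopless := ⟨fun i h => by omega⟩

theorem typeD_adj {i j : ℕ} : typeD.Adj i j ↔
    (1 ≤ i ∧ j = i + 1) ∨ (1 ≤ j ∧ i = j + 1) ∨ (i = 0 ∧ j = 2) ∨ (j = 0 ∧ i = 2) :=
  Iff.rfl

theorem typeD_compl_adj {i j : ℕ} : typeDᶜ.Adj i j ↔
    i ≠ j ∧ ¬((1 ≤ i ∧ j = i + 1) ∨ (1 ≤ j ∧ i = j + 1) ∨ (i = 0 ∧ j = 2) ∨ (j = 0 ∧ i = 2)) :=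
  Iff.rfl

theorem typeD_adj_succ {i : ℕ} (hi : 1 ≤ i) : typeD.Adj i (i + 1) := Or.inl ⟨hi, rfl⟩

/-! ### Coset representatives -/

/-- The words `i, i + 1, …, g` for `i ≥ 1`, and `0, 2, 3, …, g`. -/
def path (i g : ℕ) : List ℕ := if i = 0 then 0 :: List.Ico 2 (g + 1) else List.Ico i (g + 1)

/-- The word `j, …, 2, 0, 1, 2, …, g`. -/
def hook (j g : ℕ) : List ℕ := (List.Ico 2 (j + 1)).reverse ++ 0 :: 1 :: List.Ico 2 (g + 1)

/-- The minimal representatives of the cosets of the parabolic subgroup of the letters `< g` in the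
Coxeter group of the letters `≤ g`, as far as they are fully commutative. -/
inductive IsCosetWord (g : ℕ) : List ℕ → Prop
  | nil : IsCosetWord g []
  | path (i : ℕ) (hi : i ≤ g) : IsCosetWord g (path i g)
  | hook (j : ℕ) (h1 : 1 ≤ j) (hj : j ≤ g) : IsCosetWord g (hook j g)

section CosetWords

variable {g i j k s : ℕ} {u w : List ℕ}

theorem path_zero (g : ℕ) : path 0 g = 0 :: List.Ico 2 (g + 1) := rfl

theorem path_of_pos (hi : 1 ≤ i) (g : ℕ) : path i g = List.Ico i (g + 1) := if_neg (by omega)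

theorem path_self (hg : 1 ≤ g) : path g g = [g] := by
  rw [path_of_pos hg, List.Ico.succ_singleton]

theorem path_eq_cons_path_succ (hi : 1 ≤ i) (hg : i ≤ g) : path i g = i :: path (i + 1) g := by
  rw [path_of_pos hi, path_of_pos (by omega), List.Ico.eq_cons (by omega)]

theorem path_eq_cons_path (his : typeD.Adj s i) (hsi : s < i) (hi : i ≤ g) :
    path s g = s :: path i g := by
  rw [typeD_adj] at his
  rcases Nat.eq_zero_or_pos s with rfl | hs
  · obtain rfl : i = 2 := by omega
    rfl
  · obtain rfl : i = s + 1 := by omega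
    exact path_eq_cons_path_succ hs (by omega)

theorem exists_path_eq_cons (hi : i ≤ g) : ∃ l, path i g = i :: l := by
  rcases Nat.eq_zero_or_pos i with rfl | h
  · exact ⟨_, rfl⟩
  · exact ⟨_, path_eq_cons_path_succ h hi⟩

theorem mem_path : s ∈ path i g ↔
    (s = i ∧ i = 0) ∨ (i ≤ s ∧ s ≤ g ∧ 1 ≤ i) ∨ (i = 0 ∧ 2 ≤ s ∧ s ≤ g) := by
  rcases Nat.eq_zero_or_pos i with rfl | h
  · simp [path_zero]
  · rw [path_of_pos h, List.Ico.mem]; omega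

theorem hook_succ (hj : 1 ≤ j) : hook (j + 1) g = (j + 1) :: hook j g := by
  simp [hook, List.Ico.succ_top (by omega : 2 ≤ j + 1)]

theorem hook_one (g : ℕ) : hook 1 g = 0 :: 1 :: path 2 g := by
  simp [hook, path]

theorem hook_eq_append_path (hg : 1 ≤ g) (j : ℕ) :
    hook j g = (List.Ico 2 (j + 1)).reverse ++ 0 :: path 1 g := by
  rw [path_eq_cons_path_succ le_rfl hg]
  rfl

theorem ico_eq_append_cons (h1 : i ≤ s) (h2 : s ≤ g) :
    List.Ico i (g + 1) = List.Ico i s ++ s :: List.Ico (s + 1) (g + 1) := by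
  rw [← List.Ico.append_consecutive h1 (by omega : s ≤ g + 1),
    List.Ico.eq_cons (by omega : s < g + 1)]

theorem ico_eq_append_cons_cons (h1 : i ≤ s) (h2 : s + 1 ≤ g) :
    List.Ico i (g + 1) = List.Ico i s ++ s :: (s + 1) :: List.Ico (s + 2) (g + 1) := by
  rw [ico_eq_append_cons h1 (by omega), List.Ico.eq_cons (by omega : s + 1 < g + 1)]

theorem compl_adj_of_mem_ico (hs : s + 2 ≤ i) (hi : 3 ≤ i) :
    ∀ x ∈ List.Ico i j, typeDᶜ.Adj s x := by
  intro x hx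
  rw [List.Ico.mem] at hx
  rw [typeD_compl_adj]; omega

theorem not_fcWord_cons_self (s : ℕ) (u : List ℕ) : ¬ FCWord typeD (s :: s :: u) := fun h =>
  FCWord.not_sq (u := []) (p := []) h (by simp)

/-- The letter `s ≥ 3` can be moved to its predecessor in an increasing run. -/
theorem not_fcWord_cons_run {p : List ℕ} (hs : 3 ≤ s) (hg : s ≤ g) (hi : i < s)
    (hp : ∀ x ∈ p, typeDᶜ.Adj s x) : ¬ FCWord typeD (s :: (p ++ List.Ico i (g + 1) ++ u)) := by
  intro h
  obtain ⟨s, rfl⟩ := Nat.exists_eq_add_of_le' (by omega : 1 ≤ s)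
  rw [ico_eq_append_cons_cons (by omega) hg] at h
  refine FCWord.not_braid (u := []) (p := p ++ List.Ico i s) (t := s) (q := [])
    (r := List.Ico (s + 2) (g + 1) ++ u) (by simpa using h) (typeD_adj_succ (by omega)).symm
    (fun x hx => ?_) (by simp)
  obtain hx | hx := List.mem_append.1 hx
  · exact hp x hx
  · rw [List.Ico.mem] at hx
    rw [typeD_compl_adj]; omega

theorem not_fcWord_cons_path (his : i < s) (hi : s = 1 → i ≠ 0) (hs : s ≤ g) :
    ¬ FCWord typeD (s :: (path i g ++ u)) := by
  intro h
  rcases Nat.lt_or_ge s 3 with h3 | h3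
  · obtain rfl : s = 2 := by omega
    rcases Nat.eq_zero_or_pos i with rfl | hi'
    · rw [path_zero, ico_eq_append_cons le_rfl hs] at h
      exact FCWord.not_braid (u := []) (p := []) (t := 0) (q := []) (by simpa using h)
        (by simp [typeD_adj]) (by simp) (by simp)
    · obtain rfl : i = 1 := by omega
      rw [path_eq_cons_path_succ le_rfl (by omega), path_eq_cons_path_succ (by omega) hs] at h
      exact FCWord.not_braid (u := []) (p := []) (t := 1) (q := []) h
        (by simp [typeD_adj]) (by simp) (by simp)
  · rcases Nat.eq_zero_or_pos i with rfl | hi'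
    · exact not_fcWord_cons_run (p := [0]) (i := 2) h3 hs (by omega)
        (by simp only [List.mem_singleton, forall_eq, typeD_compl_adj]; omega) h
    · rw [path_of_pos hi'] at h
      exact not_fcWord_cons_run (p := []) h3 hs his (by simp) h

/-- The letters `0` and `1` can be moved to the fork inside a hook. -/
theorem not_fcWord_cons_hook_of_lt_two (hj : 1 ≤ j) (hs : s < 2) :
    ¬ FCWord typeD (s :: (hook j g ++ u)) := by
  intro h
  rcases hj.eq_or_lt with rfl | hj
  · rw [hook_one] at h
    interval_cases s
    · exact not_fcWord_cons_self _ _ h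
    · exact FCWord.not_sq (u := []) (p := [0]) h (by simp [typeD_adj])
  · rw [hook, ico_eq_append_cons le_rfl hj] at h
    have hc : ∀ x ∈ (List.Ico 3 (j + 1)).reverse, typeDᶜ.Adj s x := fun x hx =>
      compl_adj_of_mem_ico (by omega) le_rfl x (List.mem_reverse.1 hx)
    interval_cases s
    · exact FCWord.not_braid (u := []) (p := (List.Ico 3 (j + 1)).reverse) (t := 2) (q := [])
        (r := 1 :: List.Ico 2 (g + 1) ++ u) (by simpa using h) (by simp [typeD_adj]) hc (by simp)
    · exact FCWord.not_braid (u := []) (p := (List.Ico 3 (j + 1)).reverse) (t := 2) (q := [0])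
        (r := List.Ico 2 (g + 1) ++ u) (by simpa using h) (by simp [typeD_adj]) hc
        (by simp [typeD_adj])

/-- A letter between `2` and `j` can be moved to its occurrence in the decreasing part of a hook. -/
theorem not_fcWord_cons_hook_of_le (hs : 2 ≤ s) (hsj : s ≤ j) :
    ¬ FCWord typeD (s :: (hook j g ++ u)) := by
  intro h
  rcases hsj.eq_or_lt with rfl | hsj
  · obtain ⟨s, rfl⟩ := Nat.exists_eq_add_of_le' (by omega : 1 ≤ s)
    rw [hook_succ (by omega)] at h
    exact not_fcWord_cons_self _ _ h
  · rw [hook, ico_eq_append_cons_cons hs hsj] at h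
    exact FCWord.not_braid (u := []) (p := (List.Ico (s + 2) (j + 1)).reverse) (t := s + 1)
      (q := []) (r := (List.Ico 2 s).reverse ++ 0 :: 1 :: List.Ico 2 (g + 1) ++ u)
      (by simpa using h) (typeD_adj_succ (by omega))
      (fun x hx => compl_adj_of_mem_ico le_rfl (by omega) x (List.mem_reverse.1 hx)) (by simp)

theorem not_fcWord_cons_hook (hj : 1 ≤ j) (hsj : s ≠ j + 1) (hs : s ≤ g) :
    ¬ FCWord typeD (s :: (hook j g ++ u)) := by
  rcases Nat.lt_or_ge s 2 with h2 | h2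
  · exact not_fcWord_cons_hook_of_lt_two hj h2
  rcases Nat.lt_or_ge j s with h3 | h3
  · intro h
    refine not_fcWord_cons_run (p := (List.Ico 2 (j + 1)).reverse ++ [0, 1]) (i := 2)
      (g := g) (u := u) (by omega : 3 ≤ s) hs (by omega) (fun x hx => ?_) (by simpa [hook] using h)
    simp only [List.mem_append, List.mem_reverse, List.Ico.mem, List.mem_cons,
      List.not_mem_nil, or_false] at hx
    rw [typeD_compl_adj]; omega
  · exact not_fcWord_cons_hook_of_le h2 h3

/-! ### Coset factorization -/

/-- The word `w` factors, up to commutations, into a coset representative and a word in smaller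
letters. -/
def Factors (g : ℕ) (w : List ℕ) : Prop :=
  ∃ c u, CommEquiv typeD w (c ++ u) ∧ (∀ x ∈ u, x < g) ∧ IsCosetWord g c

theorem factors_cons_path (hs : s ≤ g) (hi : i ≤ g) (hu : ∀ x ∈ u, x < g)
    (h : FCWord typeD (s :: (path i g ++ u))) : Factors g (s :: (path i g ++ u)) := by
  rcases lt_trichotomy s i with hsi | rfl | hsi
  · by_cases hadj : typeD.Adj s i
    · exact ⟨path s g, u, by rw [path_eq_cons_path hadj hsi hi]; exact .refl, hu, .path s hs⟩
    by_cases hi1 : i = 1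
    · obtain rfl : s = 0 := by omega
      subst hi1
      refine ⟨hook 1 g, u, ?_, hu, .hook 1 le_rfl hi⟩
      rw [hook_one, path_eq_cons_path_succ le_rfl hi]
      exact .refl
    · refine ⟨path i g, s :: u, CommEquiv.cons_append u fun x hx => ?_, ?_, .path i hi⟩
      · rw [mem_path] at hx
        rw [typeD_adj] at hadj
        rw [typeD_compl_adj]; omega
      · simpa using ⟨by omega, hu⟩
  · obtain ⟨l, hl⟩ := exists_path_eq_cons hi
    rw [hl] at h
    exact absurd h (not_fcWord_cons_self _ _)
  · by_cases hfork : s = 1 ∧ i = 0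
    · obtain ⟨rfl, rfl⟩ := hfork
      refine ⟨hook 1 g, u, ?_, hu, .hook 1 le_rfl (by omega)⟩
      rw [hook_one]
      exact .single (.mk [] (path 2 g ++ u) 1 0 (by simp [typeD_adj]))
    · exact absurd h (not_fcWord_cons_path hsi (by omega) hs)

theorem factors_cons_hook (hj : 1 ≤ j) (hs : s ≤ g) (hu : ∀ x ∈ u, x < g)
    (h : FCWord typeD (s :: (hook j g ++ u))) : Factors g (s :: (hook j g ++ u)) := by
  obtain rfl | hsj := eq_or_ne s (j + 1)
  · exact ⟨hook (j + 1) g, u, by rw [hook_succ hj]; exact .refl, hu, .hook _ (by omega) hs⟩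
  · exact absurd h (not_fcWord_cons_hook hj hsj hs)

theorem FCWord.factors (hg : 2 ≤ g) (h : FCWord typeD w) (hw : ∀ x ∈ w, x ≤ g) :
    Factors g w := by
  induction w with
  | nil => exact ⟨[], [], .refl, by simp, .nil⟩
  | cons s w ih =>
    obtain ⟨c, u, hcu, hu, hc⟩ := ih h.tail fun x hx => hw x (by simp [hx])
    have h' := h.commEquiv (hcu.cons s)
    have hs : s ≤ g := hw s (by simp)
    suffices hf : Factors g (s :: (c ++ u)) by
      obtain ⟨c', u', hcu', hf⟩ := hf
      exact ⟨c', u', (hcu.cons s).trans hcu', hf⟩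
    obtain _ | ⟨i, hi⟩ | ⟨j, hj, -⟩ := hc
    · rcases hs.lt_or_eq with hs | rfl
      · exact ⟨[], s :: u, .refl, by simpa using ⟨hs, hu⟩, .nil⟩
      · exact ⟨path s s, u, by rw [path_self (by omega)]; exact .refl, hu, .path s le_rfl⟩
    · exact factors_cons_path hs hi hu h'
    · exact factors_cons_hook hj hs hu h'

/-- Otherwise `k, k + 1, …, g, k` would occur, in which `k` can be moved to `k + 1`. -/
theorem FCWord.not_isInitial_of_mem_path (h : FCWord typeD (path i g ++ u))
    (hk : k ∈ path i g) (hkg : k < g) : ¬ IsInitial typeD k u := by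
  rintro ⟨v, hv⟩
  replace h := h.commEquiv (hv.append_left _)
  rw [mem_path] at hk
  rcases Nat.eq_zero_or_pos k with rfl | hk0
  · obtain rfl : i = 0 := by omega
    rw [path_zero] at h
    rcases Nat.lt_or_ge g 2 with hg | hg
    · rw [List.Ico.eq_nil_of_le (by omega)] at h
      exact not_fcWord_cons_self _ _ h
    · rw [ico_eq_append_cons le_rfl hg] at h
      exact FCWord.not_braid (u := []) (p := []) (t := 2) (q := List.Ico 3 (g + 1)) (r := v)
        (by simpa using h) (by simp [typeD_adj]) (by simp) (compl_adj_of_mem_ico (by omega) le_rfl)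
  · have hq : ∀ x ∈ List.Ico (k + 2) (g + 1), typeDᶜ.Adj k x :=
      compl_adj_of_mem_ico le_rfl (by omega)
    rcases Nat.eq_zero_or_pos i with rfl | hi
    · rw [path_zero, ico_eq_append_cons_cons (by omega : 2 ≤ k) hkg] at h
      exact FCWord.not_braid (u := 0 :: List.Ico 2 k) (p := []) (q := List.Ico (k + 2) (g + 1))
        (r := v) (by simpa using h) (typeD_adj_succ hk0) (by simp) hq
    · rw [path_of_pos hi, ico_eq_append_cons_cons (by omega : i ≤ k) hkg] at h
      exact FCWord.not_braid (u := List.Ico i k) (p := []) (q := List.Ico (k + 2) (g + 1))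
        (r := v) (by simpa using h) (typeD_adj_succ hk0) (by simp) hq

/-- Every letter below `g` can be moved leftwards into a hook, so nothing follows a hook. -/
theorem FCWord.eq_nil_of_hook (hg : 2 ≤ g) (h : FCWord typeD (hook j g ++ u))
    (hu : ∀ x ∈ u, x < g) : u = [] := by
  obtain _ | ⟨k, u⟩ := u
  · rfl
  exfalso
  have hk : k < g := hu k (by simp)
  rcases Nat.eq_zero_or_pos k with rfl | hk0
  · rw [hook, ico_eq_append_cons le_rfl hg] at h
    exact FCWord.not_braid (u := (List.Ico 2 (j + 1)).reverse) (p := [1]) (t := 2)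
      (q := List.Ico 3 (g + 1)) (r := u) (by simpa using h) (by simp [typeD_adj])
      (by simp [typeD_adj]) (compl_adj_of_mem_ico (by omega) le_rfl)
  · rw [hook_eq_append_path (by omega)] at h
    refine FCWord.not_isInitial_of_mem_path (i := 1) (u := k :: u)
      (.of_append (p := (List.Ico 2 (j + 1)).reverse ++ [0]) ?_) (mem_path.2 (by omega)) hk
      ⟨u, .refl⟩
    simpa using h

end CosetWords

/-! ## The action of words on matchings -/

/-- The nodes of a box of infinite width; `Sum.inl` is the north face. -/
abbrev BoxNode : Type := ℕ ⊕ ℕ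

/-- The left one of the two adjacent nodes joined by the simple diagram of the letter `k`. The
letters `0` and `1` join the same nodes. -/
def leftEnd (k : ℕ) : BoxNode := .inl (k - 1)

/-- The right one of the two adjacent nodes joined by the simple diagram of the letter `k`. -/
def rightEnd (k : ℕ) : BoxNode := .inl (k - 1 + 1)

/-- The number of decorations on either horizontal edge of the simple diagram of the letter `k`. -/
def letterParity (k : ℕ) : ZMod 2 := if k = 0 then 1 else 0

section Nodes

variable {g s t k : ℕ}

theorem leftEnd_ne_rightEnd (k : ℕ) : leftEnd k ≠ rightEnd k := by
  simp [leftEnd, rightEnd]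

theorem rightEnd_of_pos (hg : 1 ≤ g) : rightEnd g = .inl g := by
  simp [rightEnd]; omega

theorem leftEnd_eq_of_lt_two (hs : s < 2) (ht : t < 2) : leftEnd s = leftEnd t := by
  simp only [leftEnd, Sum.inl.injEq]; omega

theorem rightEnd_eq_of_lt_two (hs : s < 2) (ht : t < 2) : rightEnd s = rightEnd t := by
  simp only [rightEnd, Sum.inl.injEq]; omega

theorem eq_of_letterParity_eq (hs : s < 2) (ht : t < 2)
    (h : letterParity s = letterParity t) : s = t := by
  interval_cases s <;> interval_cases t <;> first | rfl | exact absurd h (by decide)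

theorem rightEnd_eq_leftEnd_or (h : typeD.Adj s t) :
    (rightEnd s = leftEnd t ∧ leftEnd s ≠ rightEnd t) ∨
      (leftEnd s = rightEnd t ∧ rightEnd s ≠ leftEnd t) := by
  simp only [leftEnd, rightEnd, ne_eq, Sum.inl.injEq]
  rw [typeD_adj] at h
  omega

theorem lt_two_or_nodes_ne (h : typeDᶜ.Adj s t) : (s < 2 ∧ t < 2) ∨
    leftEnd s ≠ leftEnd t ∧ leftEnd s ≠ rightEnd t ∧ rightEnd s ≠ leftEnd t ∧
      rightEnd s ≠ rightEnd t := by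
  simp only [leftEnd, rightEnd, ne_eq, Sum.inl.injEq]
  rw [typeD_compl_adj] at h
  omega

end Nodes

/-- The action of the letters by stacking their simple diagrams on top of a matching. -/
noncomputable def stacking : TLAction typeD (Matching BoxNode) where
  op k x := x.join (leftEnd k) (rightEnd k) (letterParity k) (leftEnd_ne_rightEnd k)
  exponent k x := x.loopCount (leftEnd k) (rightEnd k) (letterParity k)
  op_op_self _ _ := Matching.join_idem _ _
  exponent_op_self _ _ := Matching.loopCount_of_join_eq_self (Matching.join_idem _ _)
  op_comm {s t} h x := by
    rcases lt_two_or_nodes_ne h with ⟨hs, ht⟩ | ⟨h1, h2, h3, h4⟩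
    · simp only [leftEnd_eq_of_lt_two hs ht, rightEnd_eq_of_lt_two hs ht]
      exact Matching.join_comm_same _ _
    · exact x.join_comm _ _ h1 h2 h3 h4
  exponent_comm {s t} h x := by
    rcases lt_two_or_nodes_ne h with ⟨hs, ht⟩ | ⟨h1, h2, h3, h4⟩
    · simp only [leftEnd_eq_of_lt_two hs ht, rightEnd_eq_of_lt_two hs ht]
      exact Matching.loopCount_join_comm_same _ _
    · exact x.loopCount_join_comm _ _ h1 h2 h3 h4
  op_braid {s t} h x := by
    have hs := leftEnd_ne_rightEnd s
    have ht := leftEnd_ne_rightEnd t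
    rcases rightEnd_eq_leftEnd_or h with ⟨h1, h2⟩ | ⟨h1, h2⟩
    · simp only [← h1] at ht ⊢
      exact Matching.join_join_of_join_eq_self hs ht h2 (Matching.join_idem _ _)
    · simp only [← h1] at ht ⊢
      rw [Matching.join_symm hs x, Matching.join_symm ht, Matching.join_symm hs]
      exact Matching.join_join_of_join_eq_self hs.symm ht.symm h2 (Matching.join_idem _ _)
  exponent_op {s t} h x := by
    refine Matching.loopCount_of_partner_ne ?_
    have ht := leftEnd_ne_rightEnd t
    rcases rightEnd_eq_leftEnd_or h with ⟨h1, h2⟩ | ⟨h1, h2⟩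
    · simp only [h1]
      exact Matching.partner_join_ne ht h2 x
    · simp only [Matching.join_symm ht, h1, ne_eq, Matching.partner_eq_comm _ (u := rightEnd t)]
      exact Matching.partner_join_ne ht.symm h2 x

section Stacking

variable {g k s t : ℕ} {x y : Matching BoxNode} {w : List ℕ}

theorem stacking_op_eq_self_iff : stacking.op k x = x ↔
    x.partner (leftEnd k) = rightEnd k ∧ (x.hasLoop ∨ x.parity (leftEnd k) = letterParity k) :=
  Matching.join_eq_self_iff (leftEnd_ne_rightEnd k)

theorem stacking_exponent_of_partner_ne (h : x.partner (leftEnd k) ≠ rightEnd k) :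
    stacking.exponent k x = 0 :=
  Matching.loopCount_of_partner_ne h

theorem hasLoop_stacking_op_iff (h : x.partner (leftEnd k) ≠ rightEnd k) :
    (stacking.op k x).hasLoop ↔ x.hasLoop :=
  or_iff_left fun h' => h h'.1

theorem partner_ne_of_op_eq_self (h : typeD.Adj s t) (hx : stacking.op t x = x) :
    x.partner (leftEnd s) ≠ rightEnd s := by
  have ht := (stacking_op_eq_self_iff.1 hx).1
  rcases rightEnd_eq_leftEnd_or h with ⟨h1, h2⟩ | ⟨h1, h2⟩
  · rw [ne_eq, x.partner_eq_comm, h1, ht]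
    exact h2.symm
  · rw [h1, ← ht, x.involutive]
    exact h2.symm

theorem partner_act_congr (h : x.partner = y.partner) (w : List ℕ) :
    (stacking.act w x).partner = (stacking.act w y).partner := by
  induction w with
  | nil => exact h
  | cons s w ih => exact congrArg (Matching.joinPartner _ _) ih

theorem hasLoop_act (h : x.hasLoop) (w : List ℕ) : (stacking.act w x).hasLoop := by
  induction w with
  | nil => exact h
  | cons s w ih => exact Or.inl ih

theorem hasLoop_op_zero_op_one (x : Matching BoxNode) :
    (stacking.op 0 (stacking.op 1 x)).hasLoop :=
  Matching.hasLoop_join_join (e := 1) (e' := 0) (by decide) (by simp [leftEnd, rightEnd]) x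

theorem partner_op_zero_op_one (x : Matching BoxNode) :
    (stacking.op 0 (stacking.op 1 x)).partner = (stacking.op 1 x).partner :=
  show (stacking.op 1 (stacking.op 1 x)).partner = _ by rw [stacking.op_op_self]

/-- Join the north node `g` to the south node `g`. The fixed points of this operation play the role
of the diagrams with the vertical edge `g`. -/
noncomputable def vertical (g : ℕ) (x : Matching BoxNode) : Matching BoxNode :=
  x.join (.inl g) (.inr g) 0 (by simp)

/-- The diagram all of whose edges are vertical and undecorated, together with a decorated loop if
`l` holds. -/
def identity (l : Prop) : Matching BoxNode where
  partner := Sum.swap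
  parity _ := 0
  hasLoop := l
  involutive := Sum.swap_swap
  partner_ne := by rintro (i | i) <;> simp
  parity_partner _ := rfl
  parity_of_hasLoop _ _ := rfl

theorem vertical_eq_self_iff : vertical g x = x ↔
    x.partner (.inl g) = .inr g ∧ (x.hasLoop ∨ x.parity (.inl g) = 0) :=
  Matching.join_eq_self_iff _

theorem vertical_op_comm (hk : k < g) (hg : 2 ≤ g) (x : Matching BoxNode) :
    vertical g (stacking.op k x) = stacking.op k (vertical g x) := by
  apply Matching.join_comm <;> simp [leftEnd, rightEnd] <;> omega

theorem vertical_act_comm (hg : 2 ≤ g) (hw : ∀ x ∈ w, x < g) (x : Matching BoxNode) :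
    vertical g (stacking.act w x) = stacking.act w (vertical g x) := by
  induction w with
  | nil => rfl
  | cons s w ih =>
    simp only [TLAction.act_cons, vertical_op_comm (hw s (by simp)) hg,
      ih fun y hy => hw y (by simp [hy])]

theorem vertical_op_of_vertical_eq_self (hg : 1 ≤ g) (hx : vertical g x = x) :
    vertical g (stacking.op g x) = x := by
  have h : Sum.inl g ≠ leftEnd g := by simp [leftEnd]; omega
  have h' : Sum.inr g ≠ leftEnd g := by simp [leftEnd]
  simp only [vertical] at hx ⊢
  rw [Matching.join_symm] at hx ⊢
  simp only [stacking, rightEnd_of_pos hg]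
  rw [Matching.join_symm h.symm x]
  exact Matching.join_join_of_join_eq_self _ h h' hx

theorem partner_ne_of_vertical_eq_self (hg : 1 ≤ g) (h : vertical g x = x) :
    x.partner (leftEnd g) ≠ rightEnd g := by
  have hp := (vertical_eq_self_iff.1 h).1
  rw [rightEnd_of_pos hg, ne_eq, x.partner_eq_comm, hp]
  simp [leftEnd]

theorem partner_identity_ne (l : Prop) (k : ℕ) :
    (identity l).partner (leftEnd k) ≠ rightEnd k := by
  simp [identity, leftEnd, rightEnd]

theorem op_identity_ne (l : Prop) (k : ℕ) : stacking.op k (identity l) ≠ identity l := fun h =>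
  partner_identity_ne l k (stacking_op_eq_self_iff.1 h).1

theorem vertical_identity (l : Prop) (g : ℕ) : vertical g (identity l) = identity l := by
  simp [vertical_eq_self_iff, identity]

theorem vertical_act_identity (hg : 2 ≤ g) (hw : ∀ x ∈ w, x < g) (l : Prop) :
    vertical g (stacking.act w (identity l)) = stacking.act w (identity l) := by
  rw [vertical_act_comm hg hw, vertical_identity]

theorem lt_of_op_act_identity (hg : 2 ≤ g) (hw : ∀ x ∈ w, x < g) {l : Prop}
    (h : stacking.op k (stacking.act w (identity l)) = stacking.act w (identity l)) : k < g := by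
  by_contra hk
  exact partner_ne_of_vertical_eq_self (by omega)
    (vertical_act_identity (by omega) (fun x hx => (hw x hx).trans_le (not_lt.1 hk)) l)
    (stacking_op_eq_self_iff.1 h).1

end Stacking

section Path

variable {g i k s : ℕ} {x y : Matching BoxNode}

theorem op_act_path_self (hi : i ≤ g) (x : Matching BoxNode) :
    stacking.op i (stacking.act (path i g) x) = stacking.act (path i g) x := by
  obtain ⟨l, hl⟩ := exists_path_eq_cons hi
  rw [hl, TLAction.act_cons, TLAction.op_op_self]

theorem op_act_path (hadj : typeD.Adj s i) (hsi : s < i) (hi : i ≤ g) (x : Matching BoxNode) :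
    stacking.op i (stacking.act (path s g) x) = stacking.act (path i g) x := by
  obtain ⟨l, hl⟩ := exists_path_eq_cons hi
  rw [path_eq_cons_path hadj hsi hi, hl, TLAction.act_cons, TLAction.act_cons,
    stacking.op_braid hadj.symm]

/-- Induction along the branch of the graph from `i` to `g`, starting at `g`. -/
theorem path_induction {P : ∀ i, i ≤ g → Prop} (hg : 2 ≤ g) (base : P g le_rfl)
    (step : ∀ s i, typeD.Adj s i → ∀ (hsi : s < i) (hi : i ≤ g), P i hi → P s (hsi.le.trans hi))
    (i : ℕ) (hi : i ≤ g) : P i hi := by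
  have hpos : ∀ i (hi : i ≤ g), 1 ≤ i → P i hi := fun i hi =>
    Nat.decreasingInduction (motive := fun i hi => 1 ≤ i → P i hi)
      (fun i hi ih h1 => step i (i + 1) (typeD_adj_succ h1) (by omega) hi (ih (by omega)))
      (fun _ => base) hi
  rcases Nat.eq_zero_or_pos i with rfl | h
  · exact step 0 2 (by simp [typeD_adj]) (by omega) hg (hpos 2 hg (by omega))
  · exact hpos i hi h

theorem act_path_injective (hg : 2 ≤ g) (hi : i ≤ g) (hx : vertical g x = x)
    (hy : vertical g y = y) (h : stacking.act (path i g) x = stacking.act (path i g) y) :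
    x = y := by
  induction i, hi using path_induction (hg := hg) with
  | base =>
    rw [path_self (by omega)] at h
    rw [← vertical_op_of_vertical_eq_self (by omega) hx,
      ← vertical_op_of_vertical_eq_self (by omega) hy]
    exact congrArg (vertical g) h
  | step s i hadj hsi hi ih =>
    exact ih (by rw [← op_act_path hadj hsi hi, h, op_act_path hadj hsi hi])

theorem wordExponent_path (hg : 2 ≤ g) (hi : i ≤ g) (hx : vertical g x = x) :
    stacking.wordExponent (path i g) x = 0 := by
  induction i, hi using path_induction (hg := hg) with
  | base =>
    rw [path_self (by omega)]
    exact stacking_exponent_of_partner_ne (partner_ne_of_vertical_eq_self (by omega) hx)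
  | step s i hadj hsi hi ih =>
    rw [path_eq_cons_path hadj hsi hi, TLAction.wordExponent, ih, stacking_exponent_of_partner_ne
      (partner_ne_of_op_eq_self hadj (op_act_path_self hi x))]

theorem hasLoop_act_path_iff (hg : 2 ≤ g) (hi : i ≤ g) (hx : vertical g x = x) :
    (stacking.act (path i g) x).hasLoop ↔ x.hasLoop := by
  induction i, hi using path_induction (hg := hg) with
  | base =>
    rw [path_self (by omega)]
    exact hasLoop_stacking_op_iff (partner_ne_of_vertical_eq_self (by omega) hx)
  | step s i hadj hsi hi ih =>
    rw [← ih, path_eq_cons_path hadj hsi hi]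
    exact hasLoop_stacking_op_iff (partner_ne_of_op_eq_self hadj (op_act_path_self hi x))

/-- If `A`, `B`, `C` satisfy the relations of three consecutive generators, then `C` fixes
`A (B y)` for a fixed point `y` of `C` only if `A` fixes `y`. -/
theorem eq_self_of_braid {X : Type*} {A B C : X → X} (hAC : ∀ x, A (C x) = C (A x))
    (hB : ∀ x, B (A (B x)) = B x) (hC : ∀ x, C x = x → C (B x) = x) {y : X} (hy : C y = y)
    (h : C (A (B y)) = A (B y)) : A y = y := by
  have hAB : A y = A (B y) := by
    conv_lhs => rw [← hC y hy]
    rw [hAC, h]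
  rw [← hC (A y) (by rw [← hAC, hy]), hAB, hB, hC y hy]

theorem op_op_eq_self_of_adj (hadj : typeD.Adj k s) (h : stacking.op k x = x) :
    stacking.op k (stacking.op s x) = x := by
  conv_lhs => rw [← h]
  rw [stacking.op_braid hadj, h]

theorem exists_op_path_eq_self (hg : 2 ≤ g) (hi : i ≤ g) (hik : i < k) (hk : k ≤ g)
    (hadj : ¬ typeD.Adj i k) (hfork : ¬ (i = 0 ∧ k = 1))
    (h : stacking.op k (stacking.act (path i g) x) = stacking.act (path i g) x) :
    ∃ j ∈ path i g, j < k ∧ (∀ y ∈ path k g, typeDᶜ.Adj j y) ∧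
      stacking.op j (stacking.act (path k g) x) = stacking.act (path k g) x := by
  induction i, hi using path_induction (hg := hg) with
  | base => omega
  | step s i hsi hlt hi ih =>
    rw [typeD_adj] at hadj
    have hsi' := hsi
    rw [typeD_adj] at hsi'
    by_cases hik' : typeD.Adj i k
    · have hik'' := hik'
      rw [typeD_adj] at hik''
      refine ⟨s, by rw [mem_path]; omega, hik, fun y hy => ?_, ?_⟩
      · rw [mem_path] at hy
        rw [typeD_compl_adj]; omega
      · rw [path_eq_cons_path hsi hlt hi, path_eq_cons_path hik' (by omega) hk] at h
        refine eq_self_of_braid (stacking.op_comm ?_) (stacking.op_braid hsi.symm)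
          (fun x => op_op_eq_self_of_adj hik'.symm) (op_act_path_self hk x) h
        rw [typeD_compl_adj]; omega
    · have hki : typeDᶜ.Adj i k := by
        rw [typeD_adj] at hik'
        rw [typeD_compl_adj]; omega
      obtain ⟨j, hj, hjk⟩ := ih (by omega) hik' (by omega) (by
        rw [← op_act_path hsi hlt hi, ← stacking.op_comm hki, h])
      exact ⟨j, by rw [mem_path] at hj ⊢; omega, hjk⟩

theorem exists_op_eq_self_of_vertical (hg : 2 ≤ g) (hi : i < g) (hx : vertical g x = x)
    (h : vertical g (stacking.act (path i g) x) = stacking.act (path i g) x) :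
    ∃ j ∈ path i g, j < g ∧ stacking.op j x = x := by
  have hi' := hi.le
  induction i, hi' using path_induction (hg := hg) with
  | base => omega
  | step s i hsi hlt hig ih =>
    have hsi' := hsi
    rw [typeD_adj] at hsi'
    rcases hig.eq_or_lt with rfl | hig'
    · rw [path_eq_cons_path hsi hlt le_rfl, path_self (by omega)] at h
      exact ⟨s, by rw [mem_path]; omega, hlt, eq_self_of_braid
        (fun x => (vertical_op_comm hlt hg x).symm) (stacking.op_braid hsi.symm)
        (fun x => vertical_op_of_vertical_eq_self (by omega)) hx h⟩
    · obtain ⟨j, hj, hjg⟩ := ih hig' (by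
        rw [← op_act_path hsi hlt hig, vertical_op_comm hig' hg, h])
      exact ⟨j, by rw [mem_path] at hj ⊢; omega, hjg⟩

theorem op_eq_self_of_op_act_path (hg : 2 ≤ g) (hi : i ≤ g) (hk : k < g)
    (hc : ∀ y ∈ path i g, typeDᶜ.Adj k y) (hx : vertical g x = x)
    (h : stacking.op k (stacking.act (path i g) x) = stacking.act (path i g) x) :
    stacking.op k x = x :=
  act_path_injective hg hi (by rw [vertical_op_comm hk hg, hx]) hx
    (by rw [← stacking.op_act_comm hc, h])

/-- No letter of the path from `i` to `g`, except possibly `g`, fixes `x`. If `x` is the diagram of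
a word in smaller letters, this says that the path followed by the word is reduced. -/
def Avoids (i g : ℕ) (x : Matching BoxNode) : Prop :=
  ∀ k ∈ path i g, k < g → stacking.op k x ≠ x

theorem Avoids.eq_or_of_op_act_path (ha : Avoids i g x) (hg : 2 ≤ g) (hi : i ≤ g) (hk : k ≤ g)
    (hx : vertical g x = x)
    (h : stacking.op k (stacking.act (path i g) x) = stacking.act (path i g) x) :
    k = i ∨ (k < i ∧ (∀ y ∈ path i g, typeDᶜ.Adj k y) ∧ stacking.op k x = x) ∨
      (i = 0 ∧ k = 1) ∨ (i = 1 ∧ k = 0) := by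
  by_cases hfork : k = i ∨ (i = 0 ∧ k = 1) ∨ (i = 1 ∧ k = 0)
  · tauto
  have hadj : ¬ typeD.Adj k i := fun hl =>
    stacking.not_op_eq_self_of_adj hl h (op_act_path_self hi x)
  rcases lt_or_gt_of_ne (show k ≠ i by omega) with hki | hik
  · have hc : ∀ y ∈ path i g, typeDᶜ.Adj k y := fun y hy => by
      rw [mem_path] at hy
      rw [typeD_adj] at hadj
      rw [typeD_compl_adj]; omega
    exact .inr (.inl ⟨hki, hc, op_eq_self_of_op_act_path hg hi (by omega) hc hx h⟩)
  · obtain ⟨j, hj, hjk, hc, hfix⟩ :=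
      exists_op_path_eq_self hg hi hik hk (fun h => hadj h.symm) (by omega) h
    exact absurd (op_eq_self_of_op_act_path hg hk (by omega) hc hx hfix) (ha j hj (by omega))

theorem Avoids.vertical_act_path_ne (ha : Avoids i g x) (hg : 2 ≤ g) (hi : i ≤ g)
    (hx : vertical g x = x) :
    vertical g (stacking.act (path i g) x) ≠ stacking.act (path i g) x := by
  intro h
  rcases hi.eq_or_lt with rfl | hi
  · exact partner_ne_of_vertical_eq_self (by omega) h
      (stacking_op_eq_self_iff.1 (op_act_path_self le_rfl x)).1
  · obtain ⟨j, hj, hjg, hfix⟩ := exists_op_eq_self_of_vertical hg hi hx h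
    exact ha j hj hjg hfix

end Path

section Hook

variable {g j : ℕ}

theorem act_hook (h1 : 1 ≤ j) (hj : j ≤ g) :
    stacking.act (hook j g) (identity False) = stacking.act (path j g) (identity True) := by
  induction j, h1 using Nat.le_induction with
  | base =>
    rw [hook_one]
    refine Matching.ext_of_hasLoop (hasLoop_op_zero_op_one _) (hasLoop_act trivial _) ?_
    rw [path_eq_cons_path_succ le_rfl hj]
    exact (partner_op_zero_op_one _).trans
      (partner_act_congr (x := identity False) (y := identity True) rfl (1 :: path 2 g))
  | succ j h1 ih =>
    rw [hook_succ h1, TLAction.act_cons, ih (by omega),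
      op_act_path (typeD_adj_succ h1) (by omega) hj]

theorem wordExponent_hook (hg : 2 ≤ g) (h1 : 1 ≤ j) (hj : j ≤ g) :
    stacking.wordExponent (hook j g) (identity False) = 0 := by
  induction j, h1 using Nat.le_induction with
  | base =>
    rw [hook_one, ← path_eq_cons_path_succ le_rfl hj, TLAction.wordExponent,
      wordExponent_path hg hj (vertical_identity _ g), add_zero]
    have hl : ¬ (stacking.act (path 1 g) (identity False)).hasLoop :=
      mt (hasLoop_act_path_iff hg hj (vertical_identity _ g)).1 id
    have hp := (stacking_op_eq_self_iff.1 (op_act_path_self hj (identity False))).2.resolve_left hl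
    refine if_neg fun h => ?_
    exact absurd (hp.symm.trans (h.2.resolve_left hl)) (by decide)
  | succ j h1 ih =>
    rw [hook_succ h1, TLAction.wordExponent, ih (by omega), act_hook h1 (by omega),
      stacking_exponent_of_partner_ne
        (partner_ne_of_op_eq_self (typeD_adj_succ h1).symm (op_act_path_self (by omega) _))]

end Hook

/-! ## Words are determined by their diagrams -/

/-- Fully commutative words in the letters `< g`. -/
def IsFCBelow (g : ℕ) (w : List ℕ) : Prop := FCWord typeD w ∧ ∀ x ∈ w, x < g

/-- The faithfulness of the action on the fully commutative words in the letters `< g`, together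
with the three statements that are proved along with it by induction on `g`. -/
structure FaithfulBelow (g : ℕ) : Prop where
  wordExponent_eq_zero {w : List ℕ} (hw : IsFCBelow g w) :
    stacking.wordExponent w (identity False) = 0
  exists_fork {w : List ℕ} (hw : IsFCBelow g w)
    (hl : (stacking.act w (identity False)).hasLoop) : ∃ l r, CommEquiv typeD w (l ++ 0 :: 1 :: r)
  isInitial {w : List ℕ} (hw : IsFCBelow g w) {k : ℕ}
    (hk : stacking.op k (stacking.act w (identity False)) = stacking.act w (identity False)) :
    IsInitial typeD k w
  commEquiv {v w : List ℕ} (hv : IsFCBelow g v) (hw : IsFCBelow g w)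
    (h : stacking.act v (identity False) = stacking.act w (identity False)) : CommEquiv typeD v w

section Base

variable {k : ℕ} {v w : List ℕ}

theorem commEquiv_one_zero : CommEquiv typeD [1, 0] [0, 1] :=
  .single (.mk [] [] 1 0 (by simp [typeD_adj]))

theorem IsFCBelow.commEquiv_of_two (hw : IsFCBelow 2 w) :
    CommEquiv typeD w [] ∨ (∃ k < 2, CommEquiv typeD w [k]) ∨ CommEquiv typeD w [0, 1] := by
  obtain ⟨h, hw⟩ := hw
  induction w with
  | nil => exact .inl .refl
  | cons s w ih =>
    have hs : s < 2 := hw s (by simp)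
    obtain h1 | ⟨k, hk, h1⟩ | h1 := ih h.tail fun x hx => hw x (by simp [hx])
    · exact .inr (.inl ⟨s, hs, h1.cons s⟩)
    · have h2 := h.commEquiv (h1.cons s)
      interval_cases s <;> interval_cases k
      · exact absurd h2 (not_fcWord_cons_self _ _)
      · exact .inr (.inr (h1.cons 0))
      · exact .inr (.inr ((h1.cons 1).trans commEquiv_one_zero))
      · exact absurd h2 (not_fcWord_cons_self _ _)
    · have h2 := h.commEquiv (h1.cons s)
      interval_cases s
      · exact absurd h2 (not_fcWord_cons_self _ _)
      · exact (FCWord.not_sq (u := []) (p := [0]) h2 (by simp [typeD_adj])).elim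

theorem parity_op_identity (k : ℕ) :
    (stacking.op k (identity False)).parity (leftEnd k) = letterParity k := by
  have hl : ¬ (stacking.op k (identity False)).hasLoop :=
    mt (hasLoop_stacking_op_iff (partner_identity_ne _ k)).1 id
  exact Matching.parity_join_left (leftEnd_ne_rightEnd k) hl

theorem eq_of_op_op_identity {j : ℕ} (hj : j < 2) (hk : k < 2)
    (h : stacking.op k (stacking.op j (identity False)) = stacking.op j (identity False)) :
    k = j := by
  have hl : ¬ (stacking.op j (identity False)).hasLoop :=
    mt (hasLoop_stacking_op_iff (partner_identity_ne _ j)).1 id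
  refine eq_of_letterParity_eq hk hj ?_
  rw [← (stacking_op_eq_self_iff.1 h).2.resolve_left hl, leftEnd_eq_of_lt_two hk hj,
    parity_op_identity]

theorem IsFCBelow.isInitial_of_two (hw : IsFCBelow 2 w)
    (hk : stacking.op k (stacking.act w (identity False)) = stacking.act w (identity False)) :
    IsInitial typeD k w := by
  have hk2 := lt_of_op_act_identity le_rfl hw.2 hk
  obtain h | ⟨j, hj, h⟩ | h := hw.commEquiv_of_two
  · rw [stacking.act_eq_of_commEquiv h] at hk
    exact absurd hk (op_identity_ne _ k)
  · rw [stacking.act_eq_of_commEquiv h] at hk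
    obtain rfl := eq_of_op_op_identity hj hk2 hk
    exact ⟨[], h⟩
  · interval_cases k
    · exact ⟨_, h⟩
    · exact ⟨_, h.trans commEquiv_one_zero.symm⟩

theorem IsFCBelow.op_act_eq_self_iff_of_two (hw : IsFCBelow 2 w) :
    stacking.op k (stacking.act w (identity False)) = stacking.act w (identity False) ↔ k ∈ w := by
  refine ⟨fun h => ?_, fun h => stacking.op_act_of_isInitial ?_ _⟩
  · obtain ⟨v, hv⟩ := hw.isInitial_of_two h
    exact hv.perm.mem_iff.2 (by simp)
  · obtain hc | ⟨j, -, hc⟩ | hc := hw.commEquiv_of_two <;> rw [hc.perm.mem_iff] at h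
    · simp at h
    · exact ⟨[], List.mem_singleton.1 h ▸ hc⟩
    · obtain rfl | rfl : k = 0 ∨ k = 1 := by simpa using h
      · exact ⟨_, hc⟩
      · exact ⟨_, hc.trans commEquiv_one_zero.symm⟩

theorem IsFCBelow.commEquiv_of_two_of_act_eq (hv : IsFCBelow 2 v) (hw : IsFCBelow 2 w)
    (h : stacking.act v (identity False) = stacking.act w (identity False)) :
    CommEquiv typeD v w := by
  have hmem (k : ℕ) : k ∈ v ↔ k ∈ w := by
    rw [← hv.op_act_eq_self_iff_of_two, ← hw.op_act_eq_self_iff_of_two, h]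
  have h0 := hmem 0
  have h1 := hmem 1
  obtain hv' | ⟨j, hj, hv'⟩ | hv' := hv.commEquiv_of_two <;>
    obtain hw' | ⟨k, hk, hw'⟩ | hw' := hw.commEquiv_of_two <;>
    rw [hv'.perm.mem_iff, hw'.perm.mem_iff] at h0 h1
  case inr.inl.inr.inl =>
    obtain rfl : j = k := by
      simp only [List.mem_singleton] at h0 h1
      omega
    exact hv'.trans hw'.symm
  case inl.inl | inr.inr.inr.inr => exact hv'.trans hw'.symm
  all_goals
    simp only [List.mem_cons, List.not_mem_nil, or_false, false_iff, iff_false, true_or, or_true,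
      iff_true, true_iff, not_true_eq_false] at h0 h1 <;> omega

theorem faithfulBelow_two : FaithfulBelow 2 where
  wordExponent_eq_zero hw := by
    have hop (k : ℕ) : stacking.exponent k (identity False) = 0 :=
      stacking_exponent_of_partner_ne (partner_identity_ne _ k)
    obtain h | ⟨k, -, h⟩ | h := hw.commEquiv_of_two <;>
      rw [stacking.wordExponent_eq_of_commEquiv h]
    · rfl
    · exact hop k
    · have h0 : stacking.exponent 0 (stacking.op 1 (identity False)) = 0 := by
        refine if_neg fun h => ?_
        obtain h' | h' := h.2
        · exact (hasLoop_stacking_op_iff (partner_identity_ne _ 1)).1 h'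
        · exact absurd (h'.symm.trans (parity_op_identity 1)) (by decide)
      simp [TLAction.wordExponent, TLAction.act_cons, TLAction.act_nil, h0, hop]
  exists_fork hw hl := by
    obtain h | ⟨k, -, h⟩ | h := hw.commEquiv_of_two
    · rw [stacking.act_eq_of_commEquiv h] at hl
      exact hl.elim
    · rw [stacking.act_eq_of_commEquiv h] at hl
      exact ((hasLoop_stacking_op_iff (partner_identity_ne _ k)).1 hl).elim
    · exact ⟨[], [], h⟩
  isInitial hw _ hk := hw.isInitial_of_two hk
  commEquiv hv hw h := hv.commEquiv_of_two_of_act_eq hw h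

end Base

/-- The shape of the diagram of a fully commutative word `w` in the letters `≤ g` that involves
`g`: the path from `i` to `g` acts on a diagram `x` with vertical edge `g`. Either `w` factors into
this path and a word with diagram `x`, or `w` is a hook and `x` is the identity with a loop. -/
structure HasPathForm (g : ℕ) (w : List ℕ) (i : ℕ) (x : Matching BoxNode) : Prop where
  le : i ≤ g
  vertical : vertical g x = x
  avoids : Avoids i g x
  act_eq : stacking.act w (identity False) = stacking.act (path i g) x
  wordExponent_eq_zero : stacking.wordExponent w (identity False) = 0
  factors : (∃ u, IsFCBelow g u ∧ CommEquiv typeD w (path i g ++ u) ∧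
    x = stacking.act u (identity False) ∧ (i ≤ 1 → ¬ x.hasLoop)) ∨
    (1 ≤ i ∧ x = identity True ∧ CommEquiv typeD w (hook i g))

section PathForm

variable {g i j k : ℕ} {u v w : List ℕ} {x : Matching BoxNode}

/-- A word with a fork that can follow a path from `0` or `1` would begin with the letter `0` or
`1`, and then, by its loop, the diagram would be fixed by both of them. -/
theorem not_hasLoop_of_path_append (hg : 2 ≤ g) (hi : i ≤ 1) (h : FCWord typeD (path i g ++ u))
    (hu : ∀ x ∈ u, x < g) (ha : Avoids i g (stacking.act u (identity False))) :
    ¬ (stacking.act u (identity False)).hasLoop := by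
  intro hl
  obtain ⟨k, hk, hku⟩ := exists_isInitial (G := typeD) (show u ≠ [] by rintro rfl; exact hl)
  have hk2 : k < 2 := by
    by_contra hk2
    exact h.not_isInitial_of_mem_path (by rw [mem_path]; have := hu k hk; omega) (hu k hk) hku
  have hfix := stacking_op_eq_self_iff.1 (stacking.op_act_of_isInitial hku (identity False))
  refine ha i (by rw [mem_path]; have := hu k hk; omega) (by omega)
    (stacking_op_eq_self_iff.2 ⟨?_, .inl hl⟩)
  rw [leftEnd_eq_of_lt_two (show i < 2 by omega) hk2,
    rightEnd_eq_of_lt_two (show i < 2 by omega) hk2]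
  exact hfix.1

theorem FaithfulBelow.hasPathForm_of_path_append (hg : 2 ≤ g) (hF : FaithfulBelow g) (hi : i ≤ g)
    (h : FCWord typeD (path i g ++ u)) (hu : ∀ x ∈ u, x < g)
    (hwu : CommEquiv typeD w (path i g ++ u)) :
    HasPathForm g w i (stacking.act u (identity False)) := by
  have hu' : IsFCBelow g u := ⟨.of_append (p := path i g) h, hu⟩
  have hv := vertical_act_identity hg hu False
  have ha : Avoids i g (stacking.act u (identity False)) := fun k hk hkg he =>
    h.not_isInitial_of_mem_path hk hkg (hF.isInitial hu' he)
  refine ⟨hi, hv, ha, ?_, ?_, .inl ⟨u, hu', hwu, rfl, fun hi1 =>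
    not_hasLoop_of_path_append hg hi1 h hu ha⟩⟩
  · rw [stacking.act_eq_of_commEquiv hwu, TLAction.act_append]
  · rw [stacking.wordExponent_eq_of_commEquiv hwu, TLAction.wordExponent_append,
      hF.wordExponent_eq_zero hu', wordExponent_path hg hi hv]

theorem hasPathForm_of_hook (hg : 2 ≤ g) (h1 : 1 ≤ j) (hj : j ≤ g)
    (hw : CommEquiv typeD w (hook j g)) : HasPathForm g w j (identity True) where
  le := hj
  vertical := vertical_identity _ g
  avoids k _ _ := op_identity_ne _ k
  act_eq := by rw [stacking.act_eq_of_commEquiv hw, act_hook h1 hj]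
  wordExponent_eq_zero := by
    rw [stacking.wordExponent_eq_of_commEquiv hw, wordExponent_hook hg h1 hj]
  factors := .inr ⟨h1, rfl, hw⟩

theorem FaithfulBelow.exists_hasPathForm (hg : 2 ≤ g) (hF : FaithfulBelow g)
    (hw : IsFCBelow (g + 1) w) :
    (∃ u, IsFCBelow g u ∧ CommEquiv typeD w u) ∨ ∃ i x, HasPathForm g w i x := by
  obtain ⟨c, u, hcu, hu, hc⟩ := hw.1.factors hg fun x hx => Nat.lt_succ_iff.1 (hw.2 x hx)
  have h := hw.1.commEquiv hcu
  obtain _ | ⟨i, hi⟩ | ⟨j, h1, hj⟩ := hc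
  · exact .inl ⟨u, ⟨h, hu⟩, hcu⟩
  · exact .inr ⟨i, _, hF.hasPathForm_of_path_append hg hi h hu hcu⟩
  · obtain rfl := h.eq_nil_of_hook hg hu
    rw [List.append_nil] at hcu
    exact .inr ⟨j, _, hasPathForm_of_hook hg h1 hj hcu⟩

theorem act_identity_ne_identity_true (w : List ℕ) :
    stacking.act w (identity False) ≠ identity True := by
  intro hw
  rcases w with _ | ⟨k, w⟩
  · have : (identity False).hasLoop := (show identity False = identity True from hw) ▸ trivial
    exact this
  · exact op_identity_ne True k (hw ▸ stacking.op_act_of_isInitial ⟨w, .refl⟩ _)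

namespace HasPathForm

theorem op_self (h : HasPathForm g w i x) :
    stacking.op i (stacking.act w (identity False)) = stacking.act w (identity False) := by
  rw [h.act_eq, op_act_path_self h.le]

theorem isInitial_self (h : HasPathForm g w i x) : IsInitial typeD i w := by
  obtain ⟨u, -, hu, -⟩ | ⟨h1, -, hu⟩ := h.factors
  · obtain ⟨l, hl⟩ := exists_path_eq_cons h.le
    exact ⟨l ++ u, by rwa [hl] at hu⟩
  · rcases h1.eq_or_lt with rfl | h2
    · rw [hook_one] at hu
      exact ⟨_, hu.trans (.single (.mk [] _ 0 1 (by simp [typeD_adj])))⟩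
    · obtain ⟨i, rfl⟩ := Nat.exists_eq_add_of_le' h1
      rw [hook_succ (by omega)] at hu
      exact ⟨_, hu⟩

theorem hasLoop_iff (hg : 2 ≤ g) (h : HasPathForm g w i x) :
    (stacking.act w (identity False)).hasLoop ↔ x.hasLoop := by
  rw [h.act_eq, hasLoop_act_path_iff hg h.le h.vertical]

theorem hasLoop_of_op_zero_of_op_one (hg : 2 ≤ g) (h : HasPathForm g w i x)
    (h0 : stacking.op 0 (stacking.act w (identity False)) = stacking.act w (identity False))
    (h1 : stacking.op 1 (stacking.act w (identity False)) = stacking.act w (identity False)) :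
    x.hasLoop := by
  by_contra hx
  rw [← h.hasLoop_iff hg] at hx
  have e0 := (stacking_op_eq_self_iff.1 h0).2.resolve_left hx
  have e1 := (stacking_op_eq_self_iff.1 h1).2.resolve_left hx
  exact absurd (e0.symm.trans e1) (by decide)

theorem eq_one_of_fork (hg : 2 ≤ g) (h : HasPathForm g w i x)
    (h0 : stacking.op 0 (stacking.act w (identity False)) = stacking.act w (identity False))
    (h1 : stacking.op 1 (stacking.act w (identity False)) = stacking.act w (identity False))
    (hi : i ≤ 1) : i = 1 ∧ CommEquiv typeD w (hook 1 g) := by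
  have hl := h.hasLoop_of_op_zero_of_op_one hg h0 h1
  obtain ⟨u, -, -, -, hu⟩ | ⟨h1i, -, hu⟩ := h.factors
  · exact absurd hl (hu hi)
  · obtain rfl : i = 1 := by omega
    exact ⟨rfl, hu⟩

theorem isInitial (hg : 2 ≤ g) (hF : FaithfulBelow g) (h : HasPathForm g w i x) (hk : k ≤ g)
    (hop : stacking.op k (stacking.act w (identity False)) = stacking.act w (identity False)) :
    IsInitial typeD k w := by
  have hfix := h.act_eq ▸ hop
  obtain rfl | ⟨-, hc, hkx⟩ | ⟨rfl, rfl⟩ | ⟨rfl, rfl⟩ :=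
    h.avoids.eq_or_of_op_act_path hg h.le hk h.vertical hfix
  · exact h.isInitial_self
  · obtain ⟨u, hu, hcu, rfl, -⟩ | ⟨-, rfl, -⟩ := h.factors
    · obtain ⟨v, hv⟩ := hF.isInitial hu hkx
      exact ⟨_, hcu.trans ((hv.append_left _).trans (CommEquiv.cons_append v hc).symm)⟩
    · exact absurd hkx (op_identity_ne _ k)
  · exact absurd (h.eq_one_of_fork hg h.op_self hop (by omega)).1 (by omega)
  · have hu := (h.eq_one_of_fork hg hop h.op_self (by omega)).2
    rw [hook_one] at hu
    exact ⟨_, hu⟩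

theorem eq_of_act_eq {i' : ℕ} {x' : Matching BoxNode} (hg : 2 ≤ g) (h : HasPathForm g v i x)
    (h' : HasPathForm g w i' x')
    (he : stacking.act v (identity False) = stacking.act w (identity False)) :
    i = i' ∧ x = x' := by
  have hop := h.op_self
  have hop' := h'.op_self
  obtain rfl : i = i' := by
    have h1 := h.avoids.eq_or_of_op_act_path hg h.le h'.le h.vertical
      (by rw [← h.act_eq, he, hop'])
    have h2 := h'.avoids.eq_or_of_op_act_path hg h'.le h.le h'.vertical
      (by rw [← h'.act_eq, ← he, hop])
    have h3 : ¬ (i = 0 ∧ i' = 1) := by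
      rintro ⟨rfl, rfl⟩
      exact absurd (h.eq_one_of_fork hg hop (he ▸ hop') (by omega)).1 (by omega)
    have h4 : ¬ (i' = 0 ∧ i = 1) := by
      rintro ⟨rfl, rfl⟩
      exact absurd (h'.eq_one_of_fork hg hop' (he ▸ hop) (by omega)).1 (by omega)
    omega
  exact ⟨rfl, act_path_injective hg h.le h.vertical h'.vertical
    (by rw [← h.act_eq, ← h'.act_eq, he])⟩

theorem commEquiv_of_act_eq {i' : ℕ} {x' : Matching BoxNode} (hg : 2 ≤ g) (hF : FaithfulBelow g)
    (h : HasPathForm g v i x) (h' : HasPathForm g w i' x')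
    (he : stacking.act v (identity False) = stacking.act w (identity False)) :
    CommEquiv typeD v w := by
  obtain ⟨rfl, rfl⟩ := h.eq_of_act_eq hg h' he
  obtain ⟨u, hu, hvu, hx, -⟩ | ⟨-, hx, hv⟩ := h.factors <;>
    obtain ⟨u', hu', hwu, hx', -⟩ | ⟨-, hx', hw⟩ := h'.factors
  · exact hvu.trans (((hF.commEquiv hu hu' (hx.symm.trans hx')).append_left _).trans hwu.symm)
  · exact absurd (hx.symm.trans hx') (act_identity_ne_identity_true u)
  · exact absurd (hx'.symm.trans hx) (act_identity_ne_identity_true u')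
  · exact hv.trans hw.symm

theorem act_ne (hg : 2 ≤ g) (h : HasPathForm g w i x) (hu : ∀ x ∈ u, x < g) :
    stacking.act u (identity False) ≠ stacking.act w (identity False) := by
  intro he
  refine h.avoids.vertical_act_path_ne hg h.le h.vertical ?_
  rw [← h.act_eq, ← he, vertical_act_identity hg hu]

end HasPathForm

theorem FaithfulBelow.succ (hg : 2 ≤ g) (hF : FaithfulBelow g) : FaithfulBelow (g + 1) where
  wordExponent_eq_zero hw := by
    obtain ⟨u, hu, hwu⟩ | ⟨i, x, hx⟩ := hF.exists_hasPathForm hg hw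
    · rw [stacking.wordExponent_eq_of_commEquiv hwu, hF.wordExponent_eq_zero hu]
    · exact hx.wordExponent_eq_zero
  exists_fork hw hl := by
    obtain ⟨u, hu, hwu⟩ | ⟨i, x, hx⟩ := hF.exists_hasPathForm hg hw
    · rw [stacking.act_eq_of_commEquiv hwu] at hl
      obtain ⟨l, r, hlr⟩ := hF.exists_fork hu hl
      exact ⟨l, r, hwu.trans hlr⟩
    · rw [hx.hasLoop_iff hg] at hl
      obtain ⟨u, hu, hwu, rfl, -⟩ | ⟨-, -, hwu⟩ := hx.factors
      · obtain ⟨l, r, hlr⟩ := hF.exists_fork hu hl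
        exact ⟨path i g ++ l, r, by simpa using hwu.trans (hlr.append_left _)⟩
      · exact ⟨_, _, hwu⟩
  isInitial hw k hk := by
    obtain ⟨u, hu, hwu⟩ | ⟨i, x, hx⟩ := hF.exists_hasPathForm hg hw
    · rw [stacking.act_eq_of_commEquiv hwu] at hk
      obtain ⟨v, hv⟩ := hF.isInitial hu hk
      exact ⟨v, hwu.trans hv⟩
    · exact hx.isInitial hg hF (Nat.lt_succ_iff.1 (lt_of_op_act_identity (by omega) hw.2 hk)) hk
  commEquiv hv hw he := by
    obtain ⟨u, hu, hvu⟩ | ⟨i, x, hx⟩ := hF.exists_hasPathForm hg hv <;>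
      obtain ⟨u', hu', hwu⟩ | ⟨i', x', hx'⟩ := hF.exists_hasPathForm hg hw
    · have := hF.commEquiv hu hu'
        (by rw [← stacking.act_eq_of_commEquiv hvu, ← stacking.act_eq_of_commEquiv hwu, he])
      exact hvu.trans (this.trans hwu.symm)
    · exact absurd (by rw [← stacking.act_eq_of_commEquiv hvu, he]) (hx'.act_ne hg hu.2)
    · exact absurd (by rw [← stacking.act_eq_of_commEquiv hwu, he]) (hx.act_ne hg hu'.2)
    · exact hx.commEquiv_of_act_eq hg hF hx' he

theorem faithfulBelow (hg : 2 ≤ g) : FaithfulBelow g := by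
  induction g, hg using Nat.le_induction with
  | base => exact faithfulBelow_two
  | succ g hg ih => exact ih.succ hg

theorem exists_forall_mem_lt (w : List ℕ) : ∃ g, 2 ≤ g ∧ ∀ x ∈ w, x < g :=
  ⟨w.sum + 2, by omega, fun _ hx => (List.le_sum_of_mem hx).trans_lt (by omega)⟩

theorem FCWord.wordExponent_eq_zero (h : FCWord typeD w) :
    stacking.wordExponent w (identity False) = 0 := by
  obtain ⟨g, hg, hw⟩ := exists_forall_mem_lt w
  exact (faithfulBelow hg).wordExponent_eq_zero ⟨h, hw⟩

theorem FCWord.exists_fork_of_hasLoop (h : FCWord typeD w)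
    (hl : (stacking.act w (identity False)).hasLoop) :
    ∃ l r, CommEquiv typeD w (l ++ 0 :: 1 :: r) := by
  obtain ⟨g, hg, hw⟩ := exists_forall_mem_lt w
  exact (faithfulBelow hg).exists_fork ⟨h, hw⟩ hl

theorem stacking_faithfulAt : stacking.FaithfulAt (identity False) := by
  intro v w hv hw h
  obtain ⟨g, hg, hvw⟩ := exists_forall_mem_lt (v ++ w)
  exact (faithfulBelow hg).commEquiv ⟨hv, fun x hx => hvw x (by simp [hx])⟩
    ⟨hw, fun x hx => hvw x (by simp [hx])⟩ h

end PathForm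

/-! ## Reduced expressions of fully commutative elements -/

/-- The Coxeter graph of type `D_n`. -/
abbrev coxeterGraph (n : ℕ) : SimpleGraph (Fin n) := typeD.comap Fin.val

section ReducedExpr

variable {n : ℕ} {ω ω' : List (Fin n)} {w : W n}

theorem coxeterGraph_adj {s t : Fin n} : (coxeterGraph n).Adj s t ↔ Linked s t := by
  rw [SimpleGraph.comap_adj, typeD_adj, Linked]

theorem coxeterMatrix_eq_two_iff {s t : Fin n} :
    coxeterMatrix n s t = 2 ↔ (coxeterGraph n)ᶜ.Adj s t := by
  change (if s = t then 1 else if Linked s t then 3 else 2) = 2 ↔ _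
  rw [SimpleGraph.compl_adj, coxeterGraph_adj]
  split_ifs <;> simp_all

theorem isCoxeterGraph_coxeterGraph (n : ℕ) :
    IsCoxeterGraph (coxeterMatrix n) (coxeterGraph n) where
  eq_two := coxeterMatrix_eq_two_iff.2
  eq_three h := (if_neg h.ne).trans (if_pos (coxeterGraph_adj.1 h))

theorem commMove_iff_commSwap : CommMove ω ω' ↔ CommSwap (coxeterGraph n) ω ω' :=
  ⟨fun ⟨l, r, s, t, h⟩ => ⟨l, r, s, t, coxeterMatrix_eq_two_iff.1 h⟩,
    fun ⟨l, r, s, t, h⟩ => ⟨l, r, s, t, coxeterMatrix_eq_two_iff.2 h⟩⟩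

theorem reflTransGen_commMove_iff :
    Relation.ReflTransGen CommMove ω ω' ↔ CommEquiv (coxeterGraph n) ω ω' := by
  rw [show @CommMove n = CommSwap (coxeterGraph n) from
    funext₂ fun _ _ => propext commMove_iff_commSwap]

theorem exists_isReducedExpr (w : W n) : ∃ ω, IsReducedExpr ω w := by
  obtain ⟨ω, h1, h2⟩ := (coxeterMatrix n).toCoxeterSystem.exists_isReduced w
  exact ⟨ω, h1, h2.symm⟩

theorem stacking_comap_faithfulAt (n : ℕ) :
    (stacking.comap (Fin.val_injective (n := n))).FaithfulAt (identity False) :=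
  stacking_faithfulAt.comap _

theorem IsReducedExpr.fcWord (h : IsReducedExpr ω w) (hw : IsFullyCommutative w) :
    FCWord (coxeterGraph n) ω :=
  (isCoxeterGraph_coxeterGraph n).fcWord_of_isReduced h.1 fun _ hv he =>
    reflTransGen_commMove_iff.1 (hw _ _ h ⟨hv, he.trans h.2⟩)

theorem FCWord.isReducedExpr (h : FCWord (coxeterGraph n) ω) :
    IsReducedExpr ω ((coxeterMatrix n).toCoxeterSystem.wordProd ω) :=
  ⟨(isCoxeterGraph_coxeterGraph n).isReduced_of_fcWord (stacking_comap_faithfulAt n) h, rfl⟩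

theorem FCWord.isFullyCommutative (h : FCWord (coxeterGraph n) ω) :
    IsFullyCommutative ((coxeterMatrix n).toCoxeterSystem.wordProd ω) := fun _ _ hv hv' =>
  have hG := isCoxeterGraph_coxeterGraph n
  have hA := stacking_comap_faithfulAt n
  reflTransGen_commMove_iff.2 ((hG.commEquiv_of_isReduced hA h hv.1 hv.2).trans
    (hG.commEquiv_of_isReduced hA h hv'.1 hv'.2).symm)

/-- The matching of a reduced expression of `w`; for fully commutative `w` it does not depend on
the reduced expression chosen. -/
noncomputable def matchingOf (w : W n) : Matching BoxNode :=
  stacking.act ((exists_isReducedExpr w).choose.map Fin.val) (identity False)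

theorem IsReducedExpr.act_eq_matchingOf (h : IsReducedExpr ω w) (hw : IsFullyCommutative w) :
    stacking.act (ω.map Fin.val) (identity False) = matchingOf w :=
  stacking.act_eq_of_commEquiv ((commEquiv_map_iff Fin.val_injective).2
    (reflTransGen_commMove_iff.1 (hw _ _ h (exists_isReducedExpr w).choose_spec))) _

theorem matchingOf_injOn : Set.InjOn (matchingOf (n := n)) {w | IsFullyCommutative w} := by
  intro w hw w' hw' h
  obtain ⟨ω, hω⟩ := exists_isReducedExpr w
  obtain ⟨ω', hω'⟩ := exists_isReducedExpr w'
  rw [← hω.act_eq_matchingOf hw, ← hω'.act_eq_matchingOf hw'] at h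
  have hc := (commEquiv_map_iff Fin.val_injective).1 (stacking_faithfulAt _ _
    ((fcWord_map_iff Fin.val_injective).2 (hω.fcWord hw))
    ((fcWord_map_iff Fin.val_injective).2 (hω'.fcWord hw')) h)
  rw [← hω.2, ← hω'.2, (isCoxeterGraph_coxeterGraph n).wordProd_eq_of_commEquiv hc]

theorem exists_matchingOf_eq {w : List ℕ} (hw : ∀ k ∈ w, k < n) :
    ∃ x : W n, IsFullyCommutative x ∧ matchingOf x = stacking.act w (identity False) := by
  obtain ⟨v, hv, hwv⟩ := Rewrites.exists_fcWord (G := typeD) w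
  obtain ⟨ω, rfl⟩ : v ∈ Set.range (List.map (Fin.val : Fin n → ℕ)) := by
    rw [Set.range_list_map]
    exact fun k hk => ⟨⟨k, hw k (hwv.subset hk)⟩, rfl⟩
  have hω := (fcWord_map_iff Fin.val_injective).1 hv
  exact ⟨_, hω.isFullyCommutative, by
    rw [← hω.isReducedExpr.act_eq_matchingOf hω.isFullyCommutative,
      stacking.act_eq_of_rewrites hwv]⟩

theorem heapTypeI_iff (hw : IsFullyCommutative w) : HeapTypeI w ↔ (matchingOf w).hasLoop := by
  constructor
  · rintro ⟨ω, h, l, r, hlr⟩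
    rw [← h.act_eq_matchingOf hw, ← hlr, List.append_assoc, TLAction.act_append]
    exact hasLoop_act (hasLoop_op_zero_op_one _) _
  · intro hl
    obtain ⟨ω, h⟩ := exists_isReducedExpr w
    rw [← h.act_eq_matchingOf hw] at hl
    obtain ⟨l, r, hlr⟩ :=
      ((fcWord_map_iff Fin.val_injective).2 (h.fcWord hw)).exists_fork_of_hasLoop hl
    obtain ⟨ω', hω', hc⟩ := hlr.exists_of_map Fin.val_injective
    have hprod := (isCoxeterGraph_coxeterGraph n).wordProd_eq_of_commEquiv
      (cs := (coxeterMatrix n).toCoxeterSystem) hc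
    exact ⟨ω', ⟨IsCoxeterGraph.isReduced_of_length_le h.1 hc.length_eq.ge hprod.symm,
      hprod.symm.trans h.2⟩, l, r, by simp [← hω']⟩

end ReducedExpr

/-! ## Planarity -/

section Planar

variable {V P : Type*} [LinearOrder P] {pos : V → P}

/-- The edges given by `f` can be drawn inside a disc without crossings, where `pos` is the position
of the nodes along the boundary of the disc. -/
def Noncrossing (pos : V → P) (f : V → V) : Prop :=
  ∀ u v : V, ¬ (pos u < pos v ∧ pos v < pos (f u) ∧ pos (f u) < pos (f v))

/-- No edge separates the edge at `u` from the left wall, which lies between the last position and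
the first one. -/
def Exposed (pos : V → P) (f : V → V) (u : V) : Prop :=
  ∀ v : V, ¬ (pos v < pos u ∧ pos v < pos (f u) ∧ pos u < pos (f v) ∧ pos (f u) < pos (f v))

/-- The node `v` lies strictly between `a` and `b`. -/
def Between (pos : V → P) (a v b : V) : Prop := pos a < pos v ∧ pos v < pos b

theorem noncrossing_iff {f : V → V} (hp : Function.Injective pos) (hf : Function.Involutive f) :
    Noncrossing pos f ↔ ∀ u v, Between pos u v (f u) → Between pos u (f v) (f u) := by
  constructor
  · intro h u v ⟨hu, hv⟩
    have hl := h (f v) u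
    have hr := h u v
    rw [hf] at hl
    have hvu : pos (f v) ≠ pos u := fun e => hv.ne (by rw [← hp e, hf])
    have hvu' : pos (f v) ≠ pos (f u) := fun e => hu.ne' (by rw [hf.injective (hp e)])
    exact ⟨lt_of_not_ge fun hle => hl ⟨hle.lt_of_ne hvu, hu, hv⟩,
      lt_of_not_ge fun hle => hr ⟨hu, hv, hle.lt_of_ne hvu'.symm⟩⟩
  · rintro h u v ⟨hu, hv, hf⟩
    exact hf.not_gt (h u v ⟨hu, hv⟩).2

namespace Noncrossing

variable {f : V → V} {a b : V}

theorem between_partner_iff (h : Noncrossing pos f) (hp : Function.Injective pos)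
    (hf : Function.Involutive f) (v w : V) : Between pos v w (f v) ↔ Between pos v (f w) (f v) := by
  have key := (noncrossing_iff hp hf).1 h v
  exact ⟨key w, fun hw => by simpa only [hf w] using key _ hw⟩

theorem between_partner_left_iff (h : Noncrossing pos f) (hp : Function.Injective pos)
    (hf : Function.Involutive f) (hc : ∀ v, Between pos a v b → Between pos a (f v) b)
    (hab : pos a < pos b) {v : V} (hva : v ≠ a) (hvb : v ≠ b) (hva' : v ≠ f a) (hvb' : v ≠ f b) :
    Between pos v (f a) (f v) ↔ Between pos v (f b) (f v) := by
  have hv := hc v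
  have hv' := hc (f v)
  rw [hf] at hv'
  have hav : a ≠ f v := fun e => hva' (hf.eq_iff.1 e.symm)
  have hbv : b ≠ f v := fun e => hvb' (hf.eq_iff.1 e.symm)
  rw [← h.between_partner_iff hp hf, ← h.between_partner_iff hp hf]
  have := hp.ne hva; have := hp.ne hvb; have := hp.ne hav; have := hp.ne hbv
  grind [Between]

variable [DecidableEq V]

theorem between_joinPartner (hf : Function.Involutive f) (hab : pos a < pos b)
    (hc : ∀ v, Between pos a v b → Between pos a (f v) b) {v : V} (hv : Between pos a v b) :
    Between pos a (Matching.joinPartner a b f v) b := by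
  have hca := hc (f a)
  have hcb := hc (f b)
  have hcv := hc v hv
  rw [hf] at hca hcb
  grind [Matching.joinPartner, Between]

theorem between_joinPartner_of_eq_partner (h : Noncrossing pos f) (hp : Function.Injective pos)
    (hf : Function.Involutive f) (hn : ∀ v, f v ≠ v) (hab : pos a < pos b)
    (hc : ∀ v, Between pos a v b → Between pos a (f v) b) {u v : V} (hua : u ≠ a) (hub : u ≠ b)
    (hu : u = f a ∨ u = f b)
    (huv : Between pos u v (Matching.joinPartner a b f u)) :
    Between pos u (Matching.joinPartner a b f v) (Matching.joinPartner a b f u) := by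
  have hca := hc (f a)
  have hcb := hc (f b)
  rw [hf] at hca hcb
  have hv := h.between_partner_left_iff hp hf hc hab (v := v)
  have hv' := h.between_partner_left_iff hp hf hc hab (v := f v)
  have hva : f v = a ↔ v = f a := hf.eq_iff
  have hvb : f v = b ↔ v = f b := hf.eq_iff
  have hna := hp.ne (hn a)
  have hnb := hp.ne (hn b)
  have hpa := hp.ne_iff (x := f v) (y := f a)
  have hpb := hp.ne_iff (x := f v) (y := f b)
  simp only [hf v, hf.injective.ne_iff] at hpa hpb hv'
  clear hc hf h hn
  grind [Matching.joinPartner, Between]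

theorem joinPartner (h : Noncrossing pos f) (hp : Function.Injective pos)
    (hf : Function.Involutive f) (hn : ∀ v, f v ≠ v) (hab : pos a < pos b)
    (hc : ∀ v, Between pos a v b → Between pos a (f v) b) :
    Noncrossing pos (Matching.joinPartner a b f) := by
  have hne : a ≠ b := ne_of_apply_ne pos hab.ne
  refine (noncrossing_iff hp (Matching.joinPartner_involutive hf hn)).2 fun u v huv => ?_
  by_cases hua : u = a
  · subst hua
    rw [Matching.joinPartner_left] at huv ⊢
    exact between_joinPartner hf hab hc huv
  by_cases hub : u = b
  · subst hub
    rw [Matching.joinPartner_right hne] at huv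
    exact absurd (huv.1.trans huv.2) hab.not_gt
  by_cases hua' : u = f a ∨ u = f b
  · exact h.between_joinPartner_of_eq_partner hp hf hn hab hc hua hub hua' huv
  · obtain ⟨hua', hub'⟩ := not_or.1 hua'
    rw [Matching.joinPartner_of_ne hua hub hua' hub'] at huv ⊢
    have hv := (h.between_partner_iff hp hf u v).1 huv
    have hu := h.between_partner_left_iff hp hf hc hab hua hub hua' hub'
    rw [← h.between_partner_iff hp hf u a, ← h.between_partner_iff hp hf u b] at hu
    have ha := h.between_partner_iff hp hf u a
    have hb := h.between_partner_iff hp hf u b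
    clear hc hf h hn
    grind [Matching.joinPartner]

end Noncrossing

namespace Exposed

variable {f : V → V} {a b u w : V}

theorem partner_lt (he : Exposed pos f u) (h : Noncrossing pos f) (hp : Function.Injective pos)
    (hf : Function.Involutive f) (hw : pos w < pos u ∧ pos w < pos (f u)) :
    pos (f w) < pos u ∧ pos (f w) < pos (f u) := by
  have hu := h w u
  have hu' := h w (f u)
  have hew := he w
  have hne : pos (f w) ≠ pos u := hp.ne fun e => hw.2.ne (by rw [← e, hf])
  have hne' := hp.ne (hf.injective.ne (ne_of_apply_ne pos hw.1.ne))
  rw [hf] at hu'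
  grind

theorem lt_partner (he : Exposed pos f u) (h : Noncrossing pos f) (hp : Function.Injective pos)
    (hf : Function.Involutive f) (hw : pos u < pos w ∧ pos (f u) < pos w) :
    pos u < pos (f w) ∧ pos (f u) < pos (f w) := by
  have hu := h u (f w)
  have hu' := h (f u) (f w)
  have hew := he (f w)
  have hne : pos (f w) ≠ pos u := hp.ne fun e => hw.2.ne (by rw [← e, hf])
  have hne' := hp.ne (hf.injective.ne (ne_of_apply_ne pos hw.1.ne'))
  simp only [hf _] at hu hu' hew
  grind

variable [DecidableEq V]

theorem joinPartner_of_ne (he : Exposed pos f u) (h : Noncrossing pos f)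
    (hp : Function.Injective pos) (hf : Function.Involutive f) (hab : pos a < pos b)
    (hua : u ≠ a) (hub : u ≠ b) (hua' : u ≠ f a) (hub' : u ≠ f b)
    (hu : ¬ Between pos a u b) : Exposed pos (Matching.joinPartner a b f) u := by
  intro v
  rw [Matching.joinPartner_of_ne hua hub hua' hub']
  rintro ⟨h1, h2, h3, h4⟩
  simp only [Matching.joinPartner] at h3 h4
  split_ifs at h3 h4 with hv hv hv hv <;> try subst hv
  · exact hu ⟨h1, h3⟩
  · exact hab.not_gt (h1.trans h3)
  · have ha := he.partner_lt h hp hf ⟨h1, h2⟩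
    have hb := he.lt_partner h hp hf ⟨h3, h4⟩
    rw [hf] at ha hb
    exact hu ⟨ha.1, hb.1⟩
  · have hb := he.partner_lt h hp hf ⟨h1, h2⟩
    have ha := he.lt_partner h hp hf ⟨h3, h4⟩
    rw [hf] at ha hb
    exact hab.not_gt (hb.1.trans ha.1)
  · exact he v ⟨h1, h2, h3, h4⟩

/-- The new edge between the former partners of `a` and `b` runs along the old edges at `a` and
`b`, so that one of these gives it access to the left wall. -/
theorem joinPartner_partner (h : Noncrossing pos f) (hp : Function.Injective pos)
    (hf : Function.Involutive f) (hn : ∀ v, f v ≠ v) (hab : pos a < pos b) (hne : f a ≠ b)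
    (hc : ∀ v, Between pos a v b → Between pos a (f v) b)
    (he : Exposed pos f a ∨ Exposed pos f b) (hu : u = f a ∨ u = f b) :
    Exposed pos (Matching.joinPartner a b f) u := by
  have main : ∀ v, ¬ (pos v < pos (f a) ∧ pos v < pos (f b) ∧
      pos (f a) < pos (Matching.joinPartner a b f v) ∧
      pos (f b) < pos (Matching.joinPartner a b f v)) := by
    rintro v ⟨h1, h2, h3, h4⟩
    simp only [Matching.joinPartner] at h3 h4
    split_ifs at h3 h4 with hv hv hv hv <;> try subst hv
    · have := hc _ ⟨h1, h3⟩
      rw [hf] at this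
      exact this.1.false
    · exact hab.not_gt (h1.trans h3)
    · exact h1.false
    · exact h2.false
    · have hva := (h.between_partner_iff hp hf v a).2 ⟨h1, h3⟩
      have hvb := (h.between_partner_iff hp hf v b).2 ⟨h2, h4⟩
      rcases he with he | he
      · exact he v ⟨hva.1, h1, hva.2, h3⟩
      · exact he v ⟨hvb.1, h2, hvb.2, h4⟩
  intro v
  have hv := main v
  rcases hu with rfl | rfl
  · rw [Matching.joinPartner_partner_left hn hne]
    tauto
  · rw [Matching.joinPartner_partner_right hf hn hne]
    tauto

end Exposed
end Planar

/-! ## Words of planar matchings -/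

/-- The position of a node on the boundary of the box of infinite width, read clockwise. -/
def boxPos (u : BoxNode) : ℕ ⊕ₗ ℕᵒᵈ := toLex (u.map id OrderDual.toDual)

section BoxPos

variable {i j m : ℕ}

@[simp] theorem boxPos_inl_lt_inl : boxPos (.inl i) < boxPos (.inl j) ↔ i < j := by
  simp [boxPos]

@[simp] theorem boxPos_inr_lt_inr : boxPos (.inr i) < boxPos (.inr j) ↔ j < i := by
  simp [boxPos]

@[simp] theorem boxPos_inl_lt_inr : boxPos (.inl i) < boxPos (.inr j) := by
  simp [boxPos]

@[simp] theorem not_boxPos_inr_lt_inl : ¬ boxPos (.inr i) < boxPos (.inl j) := by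
  simp [boxPos]

theorem boxPos_injective : Function.Injective boxPos := by
  rintro (i | i) (j | j) <;> simp [boxPos]

/-- The nodes of index less than `m`. -/
def nodes (m : ℕ) : Finset BoxNode := (Finset.range m).disjSum (Finset.range m)

@[simp] theorem inl_mem_nodes : Sum.inl i ∈ nodes m ↔ i < m := by simp [nodes]

@[simp] theorem inr_mem_nodes : Sum.inr i ∈ nodes m ↔ i < m := by simp [nodes]

end BoxPos

/-! ### The parity of the number of decorations -/

namespace Matching

variable {V : Type*} [DecidableEq V] {T : Finset V} {x : Matching V} {a b : V}

theorem sum_eq_sum_sdiff_add (hab : a ≠ b) (h : x.partner a ≠ b) (ha : a ∈ T) (hb : b ∈ T)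
    (hfa : x.partner a ∈ T) (hfb : x.partner b ∈ T) (k : V → ℕ) :
    ∑ u ∈ T, k u = ∑ u ∈ T \ {a, b, x.partner a, x.partner b}, k u +
      (k a + (k b + (k (x.partner a) + k (x.partner b)))) := by
  have h' : x.partner b ≠ a := mt x.partner_eq_comm.1 h
  rw [← Finset.sum_sdiff (s₁ := {a, b, x.partner a, x.partner b})
    (by simp [Finset.insert_subset_iff, *]), Finset.sum_insert, Finset.sum_insert,
    Finset.sum_insert, Finset.sum_singleton] <;>
    simp [hab, x.involutive.injective.ne hab, h'.symm, h.symm, (x.partner_ne _).symm]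

/-- Each edge is counted twice in the sums, which is why they are taken modulo four. -/
theorem four_dvd_sum_joinParity_iff (e : ZMod 2) (hab : a ≠ b) (h : x.partner a ≠ b) (ha : a ∈ T)
    (hb : b ∈ T) (hfa : x.partner a ∈ T) (hfb : x.partner b ∈ T) :
    4 ∣ ∑ u ∈ T, (joinParity a b e x.partner x.parity u).val ↔ 4 ∣ ∑ u ∈ T, (x.parity u).val := by
  have h' : x.partner b ≠ a := mt x.partner_eq_comm.1 h
  have hrest : ∀ u ∈ T \ {a, b, x.partner a, x.partner b},
      (joinParity a b e x.partner x.parity u).val = (x.parity u).val := fun u hu => by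
    simp only [Finset.mem_sdiff, Finset.mem_insert, Finset.mem_singleton, not_or] at hu
    simp [joinParity, hu]
  rw [sum_eq_sum_sdiff_add hab h ha hb hfa hfb, sum_eq_sum_sdiff_add hab h ha hb hfa hfb,
    Finset.sum_congr rfl hrest, x.parity_partner, x.parity_partner]
  simp only [joinParity, x.partner_ne, h, h', true_or, or_true, or_self, if_true, if_false]
  have key : ∀ p q e : ZMod 2, 4 ∣ 2 * e.val + 2 * (p + q + e).val + 2 * (2 - p.val) +
    2 * (2 - q.val) ∧ p.val ≤ 1 ∧ q.val ≤ 1 := by decide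
  have := key (x.parity a) (x.parity b) e
  omega

end Matching

theorem partner_mem_nodes {m : ℕ} {x : Matching BoxNode}
    (hx : ∀ i, m ≤ i → x.partner (.inl i) = .inr i) {u : BoxNode} (hu : u ∈ nodes m) :
    x.partner u ∈ nodes m := by
  have hcompl : ∀ v ∉ nodes m, x.partner v ∉ nodes m := by
    rintro (i | i) hi
    · rw [hx i (by simpa using hi)]
      simpa using hi
    · rw [x.partner_eq_comm.1 (hx i (by simpa using hi))]
      simpa using hi
  by_contra hmem
  exact hcompl _ hmem ((x.involutive u).symm ▸ hu)

/-! ### Admissible matchings -/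

/-- The matchings of the admissible diagrams of type II on `2 * m` nodes: planar, exposed where
decorated, without a loop, with an even number of decorated edges, and continued by undecorated
vertical edges. Each decorated edge contributes twice to the sum. -/
structure IsAdmissible (m : ℕ) (x : Matching BoxNode) : Prop where
  noncrossing : Noncrossing boxPos x.partner
  exposed : ∀ u, x.parity u ≠ 0 → Exposed boxPos x.partner u
  not_hasLoop : ¬ x.hasLoop
  partner_inl : ∀ i, m ≤ i → x.partner (.inl i) = .inr i
  parity_inl : ∀ i, m ≤ i → x.parity (.inl i) = 0
  sum : 4 ∣ ∑ u ∈ nodes m, (x.parity u).val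

theorem exists_adjacent {f : BoxNode → BoxNode} (h : Noncrossing boxPos f)
    (hf : Function.Involutive f) (hn : ∀ v, f v ≠ v) {i j : ℕ} (hij : i < j)
    (hfi : f (.inl i) = .inl j) : ∃ k, i ≤ k ∧ k < j ∧ f (.inl k) = .inl (k + 1) := by
  induction hd : j - i using Nat.strong_induction_on generalizing i j with
  | _ d ih =>
  by_cases hj : j = i + 1
  · exact ⟨i, le_rfl, hij, by rw [hfi, hj]⟩
  have hbetween : Between boxPos (.inl i) (f (.inl (i + 1))) (.inl j) := by
    rw [← hfi, ← h.between_partner_iff boxPos_injective hf, hfi]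
    simp only [Between, boxPos_inl_lt_inl]
    omega
  rcases hl : f (.inl (i + 1)) with l | l
  · simp only [hl, Between, boxPos_inl_lt_inl] at hbetween
    have hne : l ≠ i + 1 := fun e => hn _ (hl.trans (by rw [e]))
    obtain ⟨k, hk, hkl, hk'⟩ := ih (l - (i + 1)) (by omega) (by omega) hl rfl
    exact ⟨k, by omega, by omega, hk'⟩
  · simp [hl, Between] at hbetween

namespace IsAdmissible

variable {m : ℕ} {x : Matching BoxNode}

section Join

variable {a b : BoxNode}

theorem exposed_join (h : IsAdmissible m x) (hab : boxPos a < boxPos b) (hne : x.partner a ≠ b)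
    (hc : ∀ v, Between boxPos a v b → Between boxPos a (x.partner v) b)
    (hg : ∀ v, Between boxPos a v b → x.parity v = 0) {u : BoxNode}
    (hu : Matching.joinParity a b 0 x.partner x.parity u ≠ 0) :
    Exposed boxPos (Matching.joinPartner a b x.partner) u := by
  have hp := boxPos_injective
  rw [Matching.joinParity] at hu
  split_ifs at hu with hu' hu''
  · exact absurd rfl hu
  · refine Exposed.joinPartner_partner h.noncrossing hp x.involutive x.partner_ne hab hne hc ?_ hu''
    by_cases ha : x.parity a = 0
    · exact .inr (h.exposed _ fun hb => hu (by rw [ha, hb]; rfl))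
    · exact .inl (h.exposed _ ha)
  · rw [not_or] at hu' hu''
    exact (h.exposed _ hu).joinPartner_of_ne h.noncrossing hp x.involutive hab hu'.1 hu'.2 hu''.1
      hu''.2 fun hb => hu (hg u hb)

theorem join (h : IsAdmissible m x) (hab : boxPos a < boxPos b) (ha : a ∈ nodes m)
    (hb : b ∈ nodes m) (hne : x.partner a ≠ b)
    (hc : ∀ v, Between boxPos a v b → Between boxPos a (x.partner v) b)
    (hg : ∀ v, Between boxPos a v b → x.parity v = 0) :
    IsAdmissible m (x.join a b 0 (ne_of_apply_ne boxPos hab.ne)) := by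
  have hloop : ¬ (x.join a b 0 (ne_of_apply_ne boxPos hab.ne)).hasLoop := by
    simp [Matching.hasLoop_join, hne, h.not_hasLoop]
  have hfa := partner_mem_nodes h.partner_inl ha
  have hfb := partner_mem_nodes h.partner_inl hb
  have hout : ∀ i, m ≤ i → ∀ u ∈ nodes m, Sum.inl i ≠ u := by
    rintro i hi u hu rfl
    exact hi.not_gt (inl_mem_nodes.1 hu)
  have hpar := Matching.parity_join _ hloop
  refine ⟨h.noncrossing.joinPartner boxPos_injective x.involutive x.partner_ne hab hc,
    fun u hu => h.exposed_join hab hne hc hg (by rwa [← hpar]), hloop, fun i hi => ?_,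
    fun i hi => ?_, ?_⟩
  · rw [← h.partner_inl i hi]
    exact Matching.joinPartner_of_ne (hout i hi a ha) (hout i hi b hb) (hout i hi _ hfa)
      (hout i hi _ hfb)
  · rw [hpar, Matching.joinParity, if_neg (not_or.2 ⟨hout i hi a ha, hout i hi b hb⟩),
      if_neg (not_or.2 ⟨hout i hi _ hfa, hout i hi _ hfb⟩), h.parity_inl i hi]
  · rw [hpar, Matching.four_dvd_sum_joinParity_iff 0 (ne_of_apply_ne boxPos hab.ne) hne ha hb hfa
      hfb]
    exact h.sum

end Join

theorem of_succ (h : IsAdmissible (m + 1) x) (hp : x.partner (.inl m) = .inr m)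
    (hg : x.parity (.inl m) = 0) : IsAdmissible m x := by
  refine ⟨h.noncrossing, h.exposed, h.not_hasLoop, fun i hi => ?_, fun i hi => ?_, ?_⟩
  · rcases hi.eq_or_lt with rfl | hi
    · exact hp
    · exact h.partner_inl i hi
  · rcases hi.eq_or_lt with rfl | hi
    · exact hg
    · exact h.parity_inl i hi
  · have hg' : x.parity (.inr m) = 0 := by rw [← hp, x.parity_partner, hg]
    simpa [nodes, Finset.sum_disjSum, Finset.sum_range_succ, hg, hg'] using h.sum

theorem partner_eq_swap (h : IsAdmissible m x) (hf : ∀ i j, x.partner (.inl i) ≠ .inl j) :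
    x.partner = Sum.swap := by
  have hex : ∀ i, ∃ j, x.partner (.inl i) = .inr j := fun i => by
    rcases hi : x.partner (.inl i) with j | j
    · exact absurd hi (hf i j)
    · exact ⟨j, rfl⟩
  choose p hp using hex
  have hmono : StrictMono p := fun i j hij => by
    have hcross := h.noncrossing (.inl i) (.inl j)
    have hinj : p i ≠ p j := fun e => hij.ne (Sum.inl_injective
      (x.involutive.injective (by rw [hp, hp, e])))
    simp only [hp, boxPos_inl_lt_inl, boxPos_inl_lt_inr, boxPos_inr_lt_inr,
      true_and] at hcross
    omega
  have hpi : ∀ i, p i = i := fun i => by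
    have hle : m + p i ≤ p (m + i) := hmono.add_le_nat m i
    have hge : i ≤ p i := hmono.id_le i
    have heq : p (m + i) = m + i :=
      Sum.inr_injective ((hp _).symm.trans (h.partner_inl (m + i) (by omega)))
    omega
  have hpartner : ∀ i, x.partner (.inl i) = .inr i := fun i => by rw [hp, hpi]
  ext1 (i | i)
  · exact hpartner i
  · exact x.partner_eq_comm.1 (hpartner i)

theorem parity_eq_zero (h : IsAdmissible m x) (hx : x.partner = Sum.swap) (u : BoxNode) :
    x.parity u = 0 := by
  have hpos : ∀ i, i ≠ 0 → x.parity (.inl i) = 0 := fun i hi => by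
    by_contra hg
    have := h.exposed _ hg (.inl 0)
    simp [hx, Nat.pos_of_ne_zero hi] at this
  have hinr : ∀ i, x.parity (.inr i) = x.parity (.inl i) := fun i => by
    rw [← x.parity_partner, hx, Sum.swap_inr]
  have hzero : x.parity (.inl 0) = 0 := by
    rcases Nat.eq_zero_or_pos m with rfl | hm
    · exact h.parity_inl 0 le_rfl
    have hsum : ∑ i ∈ Finset.range m, (x.parity (.inl i)).val = (x.parity (.inl 0)).val :=
      Finset.sum_eq_single_of_mem 0 (Finset.mem_range.2 hm) fun i _ hi => by rw [hpos i hi]; rfl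
    have hdvd := h.sum
    simp only [nodes, Finset.sum_disjSum, hinr, hsum] at hdvd
    generalize x.parity (.inl 0) = q at hdvd
    revert hdvd q
    decide
  have hinl : ∀ i, x.parity (.inl i) = 0 := fun i =>
    (eq_or_ne i 0).elim (fun e => e ▸ hzero) (hpos i)
  rcases u with i | i
  · exact hinl i
  · rw [hinr, hinl]

theorem eq_identity (h : IsAdmissible m x) (hf : ∀ i j, x.partner (.inl i) ≠ .inl j) :
    x = identity False :=
  Matching.ext_of_parity (h.partner_eq_swap hf) (iff_of_false h.not_hasLoop id) fun _ _ =>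
    h.parity_eq_zero (h.partner_eq_swap hf)

theorem parity_eq_zero_of_forall_lt (h : IsAdmissible m x) {k : ℕ} (hk : 0 < k)
    (hcup : x.partner (.inl k) = .inl (k + 1))
    (hmin : ∀ l < k, x.partner (.inl l) ≠ .inl (l + 1)) : x.parity (.inl k) = 0 := by
  by_contra hg
  have hcover := h.exposed _ hg (.inl 0)
  simp only [hcup, boxPos_inl_lt_inl, hk, Nat.succ_pos, true_and] at hcover
  rcases hl : x.partner (.inl 0) with l | l
  · simp only [hl, boxPos_inl_lt_inl] at hcover
    have hl0 : l ≠ 0 := fun e => x.partner_ne _ (hl.trans (by rw [e]))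
    have hlk : l ≠ k := by
      rintro rfl
      rw [x.partner_eq_comm, hcup] at hl
      simp at hl
    have hlk' : l ≠ k + 1 := by
      rintro rfl
      exact hk.ne (Sum.inl_injective (x.involutive.injective (hl.trans hcup.symm)))
    obtain ⟨p, -, hpl, hp⟩ :=
      exists_adjacent h.noncrossing x.involutive x.partner_ne (by omega) hl
    exact hmin p (by omega) hp
  · simp [hl] at hcover

theorem exists_op_eq_self (h : IsAdmissible m x) {i j : ℕ} (hf : x.partner (.inl i) = .inl j) :
    ∃ s, s - 1 + 1 < m ∧ stacking.op s x = x := by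
  classical
  have hex : ∃ k, x.partner (.inl k) = .inl (k + 1) := by
    have hne : i ≠ j := fun e => x.partner_ne (.inl i) (by rw [hf, e])
    rcases hne.lt_or_gt with hij | hij
    · exact (exists_adjacent h.noncrossing x.involutive x.partner_ne hij hf).imp fun _ hk => hk.2.2
    · exact (exists_adjacent h.noncrossing x.involutive x.partner_ne hij
        (x.partner_eq_comm.1 hf)).imp fun _ hk => hk.2.2
  obtain ⟨k, hk, hmin⟩ : ∃ k, x.partner (.inl k) = .inl (k + 1) ∧
      ∀ l < k, x.partner (.inl l) ≠ .inl (l + 1) :=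
    ⟨Nat.find hex, Nat.find_spec hex, fun l => Nat.find_min hex⟩
  have hkm : k + 1 < m := by
    by_contra hlt
    have := h.partner_inl (k + 1) (not_lt.1 hlt)
    rw [x.partner_eq_comm.1 hk] at this
    cases this
  rcases Nat.eq_zero_or_pos k with rfl | hk0
  · have hor : x.parity (.inl 0) = 0 ∨ x.parity (.inl 0) = 1 := by
      generalize x.parity (.inl 0) = q
      revert q; decide
    rcases hor with hg | hg
    · exact ⟨1, hkm, stacking_op_eq_self_iff.2 ⟨hk, .inr hg⟩⟩
    · exact ⟨0, hkm, stacking_op_eq_self_iff.2 ⟨hk, .inr hg⟩⟩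
  · have hg : letterParity (k + 1) = 0 := if_neg k.succ_ne_zero
    exact ⟨k + 1, hkm, stacking_op_eq_self_iff.2
      ⟨hk, .inr ((h.parity_eq_zero_of_forall_lt hk0 hk hmin).trans hg.symm)⟩⟩

theorem vertical (h : IsAdmissible (m + 1) x) {j : ℕ} (hj : x.partner (.inl m) = .inl j) :
    IsAdmissible m (TLD.vertical m x) := by
  have hinr : ∀ i, m + 1 ≤ i → x.partner (.inr i) = .inl i := fun i hi =>
    x.partner_eq_comm.1 (h.partner_inl i hi)
  have hadm : IsAdmissible (m + 1) (TLD.vertical m x) := by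
    refine h.join (by simp) (by simp) (by simp) (by simp [hj]) ?_ ?_
    · rintro (i | i) ⟨hl, hr⟩
      · rw [boxPos_inl_lt_inl] at hl
        simp [Between, h.partner_inl i hl, hl]
      · rw [boxPos_inr_lt_inr] at hr
        simp [Between, hinr i hr, hr]
    · rintro (i | i) ⟨hl, hr⟩
      · exact h.parity_inl i (boxPos_inl_lt_inl.1 hl)
      · rw [boxPos_inr_lt_inr] at hr
        rw [← x.parity_partner, hinr i hr, h.parity_inl i hr]
  obtain ⟨hpartner, hparity⟩ :=
    vertical_eq_self_iff.1 (show TLD.vertical m (TLD.vertical m x) = TLD.vertical m x from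
      Matching.join_idem _ _)
  exact hadm.of_succ hpartner (hparity.resolve_left hadm.not_hasLoop)

theorem op (h : IsAdmissible m x) {k : ℕ} (hk : 0 < k) (hkm : k < m)
    (hne : x.partner (leftEnd k) ≠ rightEnd k) : IsAdmissible m (stacking.op k x) := by
  have hnot : ∀ v, ¬ Between boxPos (leftEnd k) v (rightEnd k) := by
    rintro (i | i) ⟨hl, hr⟩
    · simp only [leftEnd, rightEnd, boxPos_inl_lt_inl] at hl hr
      omega
    · exact not_boxPos_inr_lt_inl hr
  have hadm := h.join (a := leftEnd k) (b := rightEnd k) (by simp [leftEnd, rightEnd])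
    (by rw [leftEnd, inl_mem_nodes]; omega) (by rw [rightEnd, inl_mem_nodes]; omega) hne
    (fun v hv => absurd hv (hnot v)) (fun v hv => absurd hv (hnot v))
  rwa [← show letterParity k = 0 from if_neg hk.ne'] at hadm

theorem op_vertical_of_op_eq_self {s : ℕ} (hs : rightEnd s = .inl m) (hx : stacking.op s x = x) :
    stacking.op s (TLD.vertical m x) = x := by
  simp only [stacking, TLD.vertical, hs] at hx ⊢
  exact Matching.join_join_of_join_eq_self _ _ (by simp [leftEnd]) hx

theorem exists_word_cons {y : Matching BoxNode} {s : ℕ} (hs : s < m) (hy : stacking.op s y = x)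
    (h : ∃ w : List ℕ, (∀ k ∈ w, k < m) ∧ stacking.act w (identity False) = y) :
    ∃ w : List ℕ, (∀ k ∈ w, k < m) ∧ stacking.act w (identity False) = x := by
  obtain ⟨w, hw, rfl⟩ := h
  exact ⟨s :: w, List.forall_mem_cons.2 ⟨hs, hw⟩, hy⟩

/-- A letter that fixes `x` is factored out, at the cost of moving it one step to the right. -/
theorem exists_word_of_op_eq_self (ih : ∀ y, IsAdmissible m y →
      ∃ w : List ℕ, (∀ k ∈ w, k < m) ∧ stacking.act w (identity False) = y)
    (d : ℕ) {s : ℕ} (h : IsAdmissible (m + 1) x) (hs : stacking.op s x = x)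
    (hd : s - 1 + 1 + d = m) :
    ∃ w : List ℕ, (∀ k ∈ w, k < m + 1) ∧ stacking.act w (identity False) = x := by
  induction d generalizing s x with
  | zero =>
    have hr : rightEnd s = .inl m := congrArg Sum.inl hd
    have hj : x.partner (.inl m) = .inl (s - 1) := by
      rw [← hr, ← (stacking_op_eq_self_iff.1 hs).1, x.involutive, leftEnd]
    obtain ⟨w, hw, hwx⟩ := ih _ (h.vertical hj)
    have hsm : s < m + 1 := by omega
    exact exists_word_cons hsm (op_vertical_of_op_eq_self hr hs)
      ⟨w, fun k hk => (hw k hk).trans m.lt_succ_self, hwx⟩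
  | succ d ihd =>
    obtain ⟨t, ht⟩ : ∃ t, t = s - 1 + 1 + 1 := ⟨_, rfl⟩
    have hst : typeD.Adj s t := by rw [typeD_adj]; omega
    have hsm : s < m + 1 := by omega
    refine exists_word_cons hsm ?_ (ihd (h.op (k := t) (by omega) (by omega)
      (partner_ne_of_op_eq_self hst.symm hs)) (stacking.op_op_self t x) (by omega))
    conv_lhs => rw [← hs]
    rw [stacking.op_braid hst, hs]

theorem exists_word (h : IsAdmissible m x) :
    ∃ w : List ℕ, (∀ k ∈ w, k < m) ∧ stacking.act w (identity False) = x := by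
  induction m generalizing x with
  | zero =>
    exact ⟨[], by simp, (h.eq_identity fun i j => by simp [h.partner_inl i i.zero_le]).symm⟩
  | succ m ih =>
    by_cases hf : ∃ i j, x.partner (.inl i) = .inl j
    · obtain ⟨i, j, hij⟩ := hf
      obtain ⟨s, hsm, hs⟩ := h.exists_op_eq_self hij
      exact exists_word_of_op_eq_self (fun y => ih) (m - (s - 1 + 1)) h hs (by omega)
    · push Not at hf
      exact ⟨[], by simp, (h.eq_identity hf).symm⟩

end IsAdmissible

theorem exists_word_hasLoop_partner_eq {s : ℕ} (hs : 1 ≤ s) (x : Matching BoxNode) :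
    ∃ w : List ℕ, (∀ k ∈ w, k ≤ s) ∧ (stacking.act w x).hasLoop ∧
      (stacking.act w x).partner = (stacking.op s x).partner := by
  induction s, hs using Nat.le_induction generalizing x with
  | base => exact ⟨[0, 1], by simp, hasLoop_op_zero_op_one x, partner_op_zero_op_one x⟩
  | succ s hs ih =>
    obtain ⟨w, hw, hloop, hp⟩ := ih (stacking.op (s + 1) x)
    have hadj : typeD.Adj (s + 1) s := by rw [typeD_adj]; omega
    refine ⟨(s + 1) :: (w ++ [s + 1]), ?_, ?_, ?_⟩
    · simp only [List.mem_cons, List.mem_append, List.not_mem_nil, or_false]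
      rintro k (rfl | hk | rfl)
      · rfl
      · exact (hw k hk).trans s.le_succ
      · rfl
    · rw [TLAction.act_cons, TLAction.act_append]
      exact Or.inl hloop
    · rw [TLAction.act_cons, TLAction.act_append, ← stacking.op_braid hadj x]
      exact partner_act_congr hp [s + 1]

/-- The matching without its decorations is the diagram of a nonempty word; its first letter can be
replaced by a word that closes a decorated loop. -/
theorem exists_word_of_hasLoop {m : ℕ} (hm : 2 ≤ m) {x : Matching BoxNode} (hx : x.hasLoop)
    (hn : Noncrossing boxPos x.partner) (hv : ∀ i, m ≤ i → x.partner (.inl i) = .inr i)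
    (hne : x.partner ≠ Sum.swap) :
    ∃ w : List ℕ, (∀ k ∈ w, k < m) ∧ stacking.act w (identity False) = x := by
  have hadm : IsAdmissible m { x with
      parity := fun _ => 0
      hasLoop := False
      parity_partner := fun _ => rfl
      parity_of_hasLoop := fun h => h.elim } :=
    ⟨hn, fun u hu => absurd rfl hu, id, hv, fun i _ => rfl, by simp⟩
  obtain ⟨w, hw, hwx⟩ := hadm.exists_word
  have hp : (stacking.act w (identity False)).partner = x.partner := by rw [hwx]
  rcases w with _ | ⟨s, w⟩
  · exact absurd hp.symm hne
  obtain ⟨t, ht, htm, hts⟩ : ∃ t, 1 ≤ t ∧ t < m ∧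
      (stacking.op t (stacking.act w (identity False))).partner = x.partner := by
    rcases Nat.eq_zero_or_pos s with rfl | hs
    · exact ⟨1, le_rfl, by omega, hp⟩
    · exact ⟨s, hs, hw s List.mem_cons_self, hp⟩
  obtain ⟨v, hv, hloop, hvp⟩ := exists_word_hasLoop_partner_eq ht (stacking.act w (identity False))
  refine ⟨v ++ w, ?_, ?_⟩
  · simp only [List.mem_append]
    rintro k (hk | hk)
    · exact (hv k hk).trans_lt htm
    · exact hw k (List.mem_cons_of_mem _ hk)
  · rw [TLAction.act_append]
    exact Matching.ext_of_hasLoop hloop hx (hvp.trans hts)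

/-! ## Multiplication by a simple diagram -/

namespace Diagram

variable {k : ℕ} {D E : Diagram k} {C : Finset (Stacked k)} {x y : Stacked k}

/-- Sets of nodes of the stacked boxes that are unions of glued edges and loops. -/
structure IsSaturated (D E : Diagram k) (C : Finset (Stacked k)) : Prop where
  glue_mem : ∀ x ∈ C, glue x ∈ C
  cross_mem : ∀ x ∈ C, cross D E x ∈ C

theorem mem_component_self : x ∈ component D E x := by
  simp [component, Equiv.Perm.SameCycle.refl]

theorem isSaturated_component : IsSaturated D E (component D E x) where
  glue_mem y hy := by
    simp only [component, Finset.mem_filter, Finset.mem_univ, true_and] at hy ⊢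
    rw [glue_invol]
    exact hy.symm
  cross_mem y hy := by
    have hstep : ∀ z, (step D E).SameCycle z (cross D E (glue z)) :=
      fun z => ⟨1, by simp [step_apply]⟩
    simp only [component, Finset.mem_filter, Finset.mem_univ, true_and] at hy ⊢
    rcases hy with hy | hy
    · right
      refine hy.trans (Equiv.Perm.SameCycle.symm ?_)
      simpa [glue_invol _, cross_invol D E _] using hstep (glue (cross D E y))
    · left
      refine hy.trans ?_
      simpa [glue_invol _] using hstep (glue y)

namespace IsSaturated

theorem component_subset (hC : IsSaturated D E C) (hx : x ∈ C) : component D E x ⊆ C := by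
  have mem_of_sameCycle : ∀ y, (step D E).SameCycle x y → y ∈ C := by
    intro y hy
    obtain ⟨i, -, rfl⟩ := hy.exists_pow_eq'
    clear hy
    induction i with
    | zero => simpa using hx
    | succ i ih =>
      rw [pow_succ', Equiv.Perm.mul_apply, step_apply]
      exact hC.cross_mem _ (hC.glue_mem _ ih)
  intro y hy
  simp only [component, Finset.mem_filter, Finset.mem_univ, true_and] at hy
  rcases hy with hy | hy
  · exact mem_of_sameCycle y hy
  · rw [← glue_invol y]
    exact hC.glue_mem _ (mem_of_sameCycle _ hy)

theorem walkEnd_eq (hC : IsSaturated D E C) {u v : Node k} (hu : outer u ∈ C)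
    (h : ∀ w, outer w ∈ C → w = u ∨ w = v) : walkEnd D E u = v := by
  have hmem : outer (walkEnd D E u) ∈ component D E (outer u) := by
    rw [← component_walkEnd]
    exact mem_component_self
  exact (h _ (hC.component_subset hu hmem)).resolve_left (walkEnd_ne D E u)

end IsSaturated
end Diagram

section SimpleDiagram

open Diagram

variable {n : ℕ} {hn : 4 ≤ n} {s : Fin n}

/-- The left one of the two nodes in the north face that a simple diagram joins. -/
abbrev northLeft (s : Fin n) : Node n := Sum.inl (leftNode s)

/-- The right one of the two nodes in the north face that a simple diagram joins. -/
abbrev northRight (hn : 4 ≤ n) (s : Fin n) : Node n := Sum.inl (rightNode hn s)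

/-- The number of decorations on either of the two non-propagating edges of a simple diagram. -/
def simpleDeco (s : Fin n) : ℕ := if (s : ℕ) = 0 then 1 else 0

theorem northLeft_ne_northRight : northLeft s ≠ northRight hn s := by
  simpa using leftNode_ne_rightNode hn s

theorem simpleDiagram_partner_northLeft :
    (simpleDiagram hn s).partner (northLeft s) = northRight hn s := by
  simp [simpleDiagram, simplePartner]

theorem simpleDiagram_partner_northRight :
    (simpleDiagram hn s).partner (northRight hn s) = northLeft s := by
  simp [simpleDiagram, simplePartner]

theorem simpleDiagram_partner_southLeft :
    (simpleDiagram hn s).partner (.inr (leftNode s)) = .inr (rightNode hn s) := by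
  simp [simpleDiagram, simplePartner]

theorem simpleDiagram_partner_southRight :
    (simpleDiagram hn s).partner (.inr (rightNode hn s)) = .inr (leftNode s) := by
  simp [simpleDiagram, simplePartner]

theorem simpleDiagram_partner_inl {i : Fin n} (hl : i ≠ leftNode s) (hr : i ≠ rightNode hn s) :
    (simpleDiagram hn s).partner (.inl i) = .inr i := by
  simp [simpleDiagram, simplePartner, hl, hr]

theorem simpleDiagram_partner_inr {i : Fin n} (hl : i ≠ leftNode s) (hr : i ≠ rightNode hn s) :
    (simpleDiagram hn s).partner (.inr i) = .inl i := by
  simp [simpleDiagram, simplePartner, hl, hr]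

theorem simpleDiagram_deco_inl {i : Fin n} (hl : i ≠ leftNode s) (hr : i ≠ rightNode hn s) :
    (simpleDiagram hn s).deco (.inl i) = 0 := by
  simp [simpleDiagram, hl, hr]

theorem simpleDiagram_deco_inr (i : Fin n) :
    (simpleDiagram hn s).deco (.inr i) =
      (if i = leftNode s then simpleDeco s else 0) +
        if i = rightNode hn s then simpleDeco s else 0 := by
  have hne := leftNode_ne_rightNode hn s
  by_cases hl : i = leftNode s
  · subst hl
    simp [hne, simpleDiagram, simpleDeco]
  by_cases hr : i = rightNode hn s
  · subst hr
    simp [hne.symm, simpleDiagram, simpleDeco]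
  simp [hl, hr, simpleDiagram]

variable {E : Diagram n} {C : Finset (Stacked n)} {V : Finset (Node n)}

namespace Diagram.IsSaturated

theorem inr_partner_mem (hC : IsSaturated (simpleDiagram hn s) E C) {v : Node n}
    (hv : Sum.inr v ∈ C) : Sum.inr (E.partner v) ∈ C := hC.cross_mem _ hv

theorem inr_northLeft_mem_iff (hC : IsSaturated (simpleDiagram hn s) E C) :
    Sum.inr (northLeft s) ∈ C ↔ Sum.inr (northRight hn s) ∈ C := by
  constructor <;> intro h
  · have hcross := hC.cross_mem _ (hC.glue_mem _ h)
    simp only [glue, cross, Sum.map_inl, simpleDiagram_partner_southLeft] at hcross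
    exact hC.glue_mem _ hcross
  · have hcross := hC.cross_mem _ (hC.glue_mem _ h)
    simp only [glue, cross, Sum.map_inl, simpleDiagram_partner_southRight] at hcross
    exact hC.glue_mem _ hcross

theorem inr_mem_iff (hC : IsSaturated (simpleDiagram hn s) E C) {u : Node n}
    (hl : u ≠ northLeft s) (hr : u ≠ northRight hn s) : Sum.inr u ∈ C ↔ outer u ∈ C := by
  rcases u with i | i
  · have hl' : i ≠ leftNode s := fun e => hl (congrArg _ e)
    have hr' : i ≠ rightNode hn s := fun e => hr (congrArg _ e)
    constructor <;> intro h
    · have hcross := hC.cross_mem _ (hC.glue_mem _ h)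
      simpa only [outer, glue, cross, Sum.map_inl, simpleDiagram_partner_inr hl' hr'] using hcross
    · have hglue := hC.glue_mem _ (hC.cross_mem _ h)
      simpa only [outer, glue, cross, Sum.map_inl, simpleDiagram_partner_inl hl' hr'] using hglue
  · rfl

end Diagram.IsSaturated

/-- The nodes of the stacked boxes that lie on the edges at the nodes `V` of the lower box, on the
vertical edges of the simple diagram that continue them, or on its south edge if `V` contains the
nodes glued to its ends. -/
def attached (hn : 4 ≤ n) (s : Fin n) (V : Finset (Node n)) : Finset (Stacked n) :=
  ((Finset.univ.filter fun i => Sum.inl i ∈ V ∧ i ≠ leftNode s ∧ i ≠ rightNode hn s).disjSum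
    (Finset.univ.filter fun i => Sum.inl i ∈ V)).disjSum V

@[simp] theorem inr_mem_attached {v : Node n} : Sum.inr v ∈ attached hn s V ↔ v ∈ V := by
  simp [attached]

@[simp] theorem inl_inr_mem_attached {i : Fin n} :
    Sum.inl (Sum.inr i) ∈ attached hn s V ↔ Sum.inl i ∈ V := by simp [attached]

@[simp] theorem inl_inl_mem_attached {i : Fin n} :
    Sum.inl (Sum.inl i) ∈ attached hn s V ↔
      Sum.inl i ∈ V ∧ i ≠ leftNode s ∧ i ≠ rightNode hn s := by simp [attached]

theorem outer_mem_attached {u : Node n} :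
    outer u ∈ attached hn s V ↔ u ∈ V ∧ u ≠ northLeft s ∧ u ≠ northRight hn s := by
  rcases u with i | i <;> simp [outer]

/-- The sets of nodes of the lower box that are unions of its edges and contain both or none of the
nodes glued to the south edge of the simple diagram. -/
structure IsAttachable (hn : 4 ≤ n) (s : Fin n) (E : Diagram n) (V : Finset (Node n)) : Prop where
  partner_mem : ∀ v ∈ V, E.partner v ∈ V
  north_mem_iff : northLeft s ∈ V ↔ northRight hn s ∈ V

theorem IsAttachable.isSaturated (hV : IsAttachable hn s E V) :
    IsSaturated (simpleDiagram hn s) E (attached hn s V) where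
  glue_mem := by
    rintro ((i | i) | (i | i)) hx <;> simpa [glue] using hx
  cross_mem := by
    rintro ((i | i) | v) hx
    · simp only [inl_inl_mem_attached] at hx
      simp [cross, hx, simpleDiagram_partner_inl hx.2.1 hx.2.2]
    · simp only [inl_inr_mem_attached] at hx
      by_cases hl : i = leftNode s
      · subst hl
        simpa [cross, simpleDiagram_partner_southLeft] using hV.north_mem_iff.1 hx
      by_cases hr : i = rightNode hn s
      · subst hr
        simpa [cross, simpleDiagram_partner_southRight] using hV.north_mem_iff.2 hx
      simp [cross, simpleDiagram_partner_inr hl hr, hx, hl, hr]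
    · simp only [inr_mem_attached] at hx
      simp [cross, hV.partner_mem _ hx]

theorem IsAttachable.component_eq (hV : IsAttachable hn s E V) {x : Stacked n}
    (hx : x ∈ attached hn s V)
    (h : ∀ v ∈ V, Sum.inr v ∈ component (simpleDiagram hn s) E x) :
    component (simpleDiagram hn s) E x = attached hn s V := by
  refine (hV.isSaturated.component_subset hx).antisymm ?_
  have hC := isSaturated_component (D := simpleDiagram hn s) (E := E) (x := x)
  rintro ((i | i) | v) hy
  · simp only [inl_inl_mem_attached] at hy
    exact (hC.inr_mem_iff (u := Sum.inl i) (by simpa using hy.2.1) (by simpa using hy.2.2)).1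
      (h _ hy.1)
  · exact hC.glue_mem _ (h (Sum.inl i) (by simpa using hy))
  · exact h v (by simpa using hy)

theorem IsAttachable.decoOn_eq (hV : IsAttachable hn s E V) :
    decoOn (simpleDiagram hn s) E (attached hn s V) =
      (∑ v ∈ V, E.deco v + if northLeft s ∈ V then 2 * simpleDeco s else 0) / 2 := by
  have hvertical : ∑ i with Sum.inl i ∈ V ∧ i ≠ leftNode s ∧ i ≠ rightNode hn s,
      (simpleDiagram hn s).deco (.inl i) = 0 :=
    Finset.sum_eq_zero fun i hi =>
      have hi := (Finset.mem_filter.1 hi).2.2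
      simpleDiagram_deco_inl hi.1 hi.2
  have hsouth : ∑ i with Sum.inl i ∈ V, (simpleDiagram hn s).deco (.inr i) =
      if northLeft s ∈ V then 2 * simpleDeco s else 0 := by
    simp only [simpleDiagram_deco_inr, Finset.sum_add_distrib, Finset.sum_ite_eq',
      Finset.mem_filter, Finset.mem_univ, true_and, ← hV.north_mem_iff]
    split_ifs <;> ring
  rw [decoOn, attached, Finset.sum_disjSum, Finset.sum_disjSum]
  simp only [Sum.elim_inl, Sum.elim_inr]
  rw [hvertical, hsouth, zero_add, add_comm]

section Edges

variable {u : Node n}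

theorem component_outer_north (hu : u = northLeft s ∨ u = northRight hn s) :
    component (simpleDiagram hn s) E (outer u) =
      {outer (northLeft s), outer (northRight hn s)} := by
  have hC := isSaturated_component (D := simpleDiagram hn s) (E := E) (x := outer u)
  have hmem := mem_component_self (D := simpleDiagram hn s) (E := E) (x := outer u)
  have hcross := hC.cross_mem _ hmem
  refine (IsSaturated.component_subset ⟨?_, ?_⟩ ?_).antisymm ?_
  · simp [outer, glue]
  · simp [outer, cross, simpleDiagram_partner_northLeft, simpleDiagram_partner_northRight]
  · rcases hu with rfl | rfl <;> simp
  · rcases hu with rfl | rfl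
    · simp only [outer, cross, Sum.map_inl, simpleDiagram_partner_northLeft] at hmem hcross
      simp [Finset.insert_subset_iff, outer, hmem, hcross]
    · simp only [outer, cross, Sum.map_inl, simpleDiagram_partner_northRight] at hmem hcross
      simp [Finset.insert_subset_iff, outer, hmem, hcross]

theorem walkEnd_north :
    walkEnd (simpleDiagram hn s) E (northLeft s) = northRight hn s := by
  have hc := component_outer_north (hn := hn) (E := E) (u := northLeft s) (.inl rfl)
  refine isSaturated_component.walkEnd_eq mem_component_self fun w hw => ?_
  rw [hc, Finset.mem_insert, Finset.mem_singleton] at hw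
  exact hw.imp (fun h => by simpa [boundary_outer] using congrArg boundary h)
    fun h => by simpa [boundary_outer] using congrArg boundary h

theorem decoOn_north (hu : u = northLeft s ∨ u = northRight hn s) :
    decoOn (simpleDiagram hn s) E (component (simpleDiagram hn s) E (outer u)) =
      simpleDeco s := by
  rw [component_outer_north hu, decoOn,
    Finset.sum_pair (by simpa [outer] using leftNode_ne_rightNode hn s)]
  simp only [outer, simpleDiagram, simpleDeco, Sum.elim_inl, id_eq, true_or, or_true, and_true]
  split_ifs <;> rfl

/-- An edge of the product that is not the north edge of the simple diagram contains an edge of the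
lower diagram. -/
theorem IsAttachable.walkEnd_eq_and_decoOn_eq (hV : IsAttachable hn s E V) (hu : u ∈ V)
    (hl : u ≠ northLeft s) (hr : u ≠ northRight hn s) {v : Node n}
    (hv : ∀ w ∈ V, w ≠ northLeft s → w ≠ northRight hn s → w = u ∨ w = v)
    (hmem : ∀ C, IsSaturated (simpleDiagram hn s) E C → Sum.inr u ∈ C → ∀ w ∈ V, Sum.inr w ∈ C) :
    walkEnd (simpleDiagram hn s) E u = v ∧
      decoOn (simpleDiagram hn s) E (component (simpleDiagram hn s) E (outer u)) =
        (∑ v ∈ V, E.deco v + if northLeft s ∈ V then 2 * simpleDeco s else 0) / 2 := by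
  have huV : outer u ∈ attached hn s V := outer_mem_attached.2 ⟨hu, hl, hr⟩
  constructor
  · refine hV.isSaturated.walkEnd_eq huV fun w hw => ?_
    obtain ⟨hwV, hwl, hwr⟩ := outer_mem_attached.1 hw
    exact hv w hwV hwl hwr
  · rw [hV.component_eq huV (hmem _ isSaturated_component
      ((isSaturated_component.inr_mem_iff hl hr).2 mem_component_self)), hV.decoOn_eq]

theorem walkEnd_and_decoOn_partner_north (hne : E.partner (northLeft s) ≠ northRight hn s)
    {v : Node n} (huv : u = E.partner (northLeft s) ∧ v = E.partner (northRight hn s) ∨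
      u = E.partner (northRight hn s) ∧ v = E.partner (northLeft s)) :
    walkEnd (simpleDiagram hn s) E u = v ∧
      decoOn (simpleDiagram hn s) E (component (simpleDiagram hn s) E (outer u)) =
        E.deco (northLeft s) + E.deco (northRight hn s) + simpleDeco s := by
  have hi := E.partner_invol
  have hnf := E.partner_ne
  have hLR := northLeft_ne_northRight (hn := hn) (s := s)
  have hne' : E.partner (northRight hn s) ≠ northLeft s := fun e => hne (by rw [← e, hi])
  have hV : IsAttachable hn s E {northLeft s, northRight hn s, E.partner (northLeft s),
      E.partner (northRight hn s)} :=
    ⟨by simp [hi _], by simp⟩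
  have hsum : ∑ v ∈ {northLeft s, northRight hn s, E.partner (northLeft s),
      E.partner (northRight hn s)}, E.deco v =
        2 * (E.deco (northLeft s) + E.deco (northRight hn s)) := by
    rw [Finset.sum_insert (by simp [hne'.symm, (hnf _).symm, hLR]),
      Finset.sum_insert (by simp [hne.symm, (hnf _).symm]), Finset.sum_pair (hi.injective.ne hLR),
      E.deco_partner, E.deco_partner]
    ring
  have hu : u ≠ northLeft s ∧ u ≠ northRight hn s := by
    rcases huv with ⟨rfl, -⟩ | ⟨rfl, -⟩
    · exact ⟨hnf _, hne⟩
    · exact ⟨hne', hnf _⟩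
  obtain ⟨hwalk, hdeco⟩ := hV.walkEnd_eq_and_decoOn_eq (u := u) (v := v)
    (by simp only [Finset.mem_insert, Finset.mem_singleton]; tauto) hu.1 hu.2
    (by simp only [Finset.mem_insert, Finset.mem_singleton]; grind) fun C hC huC => by
      have hL : Sum.inr (northLeft s) ∈ C := by
        have := hC.inr_partner_mem huC
        rcases huv with ⟨rfl, -⟩ | ⟨rfl, -⟩
        · rwa [hi] at this
        · rw [hi] at this
          exact hC.inr_northLeft_mem_iff.2 this
      have hR := hC.inr_northLeft_mem_iff.1 hL
      simp [hL, hR, hC.inr_partner_mem hL, hC.inr_partner_mem hR]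
  refine ⟨hwalk, hdeco.trans ?_⟩
  rw [hsum, if_pos (by simp)]
  omega

theorem walkEnd_and_decoOn_of_ne (hl : u ≠ northLeft s) (hr : u ≠ northRight hn s)
    (hl' : u ≠ E.partner (northLeft s)) (hr' : u ≠ E.partner (northRight hn s)) :
    walkEnd (simpleDiagram hn s) E u = E.partner u ∧
      decoOn (simpleDiagram hn s) E (component (simpleDiagram hn s) E (outer u)) =
        E.deco u := by
  have hi := E.partner_invol
  have hL : northLeft s ∉ ({u, E.partner u} : Finset (Node n)) := by
    simp only [Finset.mem_insert, Finset.mem_singleton, not_or]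
    exact ⟨hl.symm, fun e => hl' (by rw [e, hi])⟩
  have hR : northRight hn s ∉ ({u, E.partner u} : Finset (Node n)) := by
    simp only [Finset.mem_insert, Finset.mem_singleton, not_or]
    exact ⟨hr.symm, fun e => hr' (by rw [e, hi])⟩
  have hV : IsAttachable hn s E {u, E.partner u} :=
    ⟨by simp [hi _], iff_of_false hL hR⟩
  obtain ⟨hwalk, hdeco⟩ := hV.walkEnd_eq_and_decoOn_eq (v := E.partner u) (by simp) hl hr
    (fun w hw _ _ => by simpa using hw) fun C hC huC => by simp [huC, hC.inr_partner_mem huC]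
  refine ⟨hwalk, hdeco.trans ?_⟩
  rw [if_neg hL, Finset.sum_pair (E.partner_ne u).symm, E.deco_partner]
  omega

theorem simpleDiagram_mul_partner (hn : 4 ≤ n) (s : Fin n) (E : Diagram n) :
    (simpleDiagram hn s * E).partner =
      Matching.joinPartner (northLeft s) (northRight hn s) E.partner := by
  funext u
  change walkEnd (simpleDiagram hn s) E u = _
  unfold Matching.joinPartner
  have hi := E.partner_invol
  split_ifs with hl hr hl' hr'
  · rw [hl, walkEnd_north]
  · rw [hr, ← walkEnd_north (hn := hn) (E := E), walkEnd_invol]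
  · exact (walkEnd_and_decoOn_partner_north (fun e => hr (hl'.trans e)) (.inl ⟨hl', rfl⟩)).1
  · exact (walkEnd_and_decoOn_partner_north
      (fun e => hl (by rw [hr', ← e, hi])) (.inr ⟨hr', rfl⟩)).1
  · exact (walkEnd_and_decoOn_of_ne hl hr hl' hr').1

theorem simpleDiagram_mul_deco (hn : 4 ≤ n) (s : Fin n) (E : Diagram n) (u : Node n) :
    (simpleDiagram hn s * E).deco u =
      if u = northLeft s ∨ u = northRight hn s then simpleDeco s
      else if u = E.partner (northLeft s) ∨ u = E.partner (northRight hn s) then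
        E.deco (northLeft s) + E.deco (northRight hn s) + simpleDeco s
      else E.deco u := by
  change decoOn (simpleDiagram hn s) E (component (simpleDiagram hn s) E (outer u)) = _
  have hi := E.partner_invol
  split_ifs with hu hu'
  · exact decoOn_north hu
  · have hne : E.partner (northLeft s) ≠ northRight hn s := by
      intro e
      rcases hu' with h | h
      · exact hu (.inr (h.trans e))
      · exact hu (.inl (by rw [h, ← e, hi]))
    rcases hu' with h | h
    · exact (walkEnd_and_decoOn_partner_north hne (.inl ⟨h, rfl⟩)).2
    · exact (walkEnd_and_decoOn_partner_north hne (.inr ⟨h, rfl⟩)).2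
  · rw [not_or] at hu hu'
    exact (walkEnd_and_decoOn_of_ne hu.1 hu.2 hu'.1 hu'.2).2

end Edges

theorem isAttachable_north (h : E.partner (northLeft s) = northRight hn s) :
    IsAttachable hn s E {northLeft s, northRight hn s} where
  partner_mem := by
    have h' : E.partner (northRight hn s) = northLeft s := by rw [← h, E.partner_invol]
    simp [h, h']
  north_mem_iff := by simp

theorem inr_northLeft_mem_component {x : Stacked n}
    (hx : ∀ y ∈ component (simpleDiagram hn s) E x, boundary y = none) :
    Sum.inr (northLeft s) ∈ component (simpleDiagram hn s) E x ∧
      E.partner (northLeft s) = northRight hn s ∧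
      x ∈ attached hn s {northLeft s, northRight hn s} := by
  have hC := isSaturated_component (D := simpleDiagram hn s) (E := E) (x := x)
  have hself := mem_component_self (D := simpleDiagram hn s) (E := E) (x := x)
  have north_of_mem : ∀ v, Sum.inr v ∈ component (simpleDiagram hn s) E x →
      v = northLeft s ∨ v = northRight hn s := by
    intro v hv
    by_contra! hne
    simpa [boundary_outer] using hx _ ((hC.inr_mem_iff hne.1 hne.2).1 hv)
  have hL : ∀ v, Sum.inr v ∈ component (simpleDiagram hn s) E x →
      Sum.inr (northLeft s) ∈ component (simpleDiagram hn s) E x := fun v hv =>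
    (north_of_mem v hv).elim (fun h => h ▸ hv) fun h => hC.inr_northLeft_mem_iff.2 (h ▸ hv)
  obtain ⟨hmem, hx'⟩ : Sum.inr (northLeft s) ∈ component (simpleDiagram hn s) E x ∧
      x ∈ attached hn s {northLeft s, northRight hn s} := by
    rcases x with (i | i) | v
    · exact absurd (hx _ hself) (by simp [boundary])
    · have hglue := hC.glue_mem _ hself
      exact ⟨hL _ hglue, by simpa using north_of_mem _ hglue⟩
    · exact ⟨hL _ hself, by simpa using north_of_mem _ hself⟩
  exact ⟨hmem, (north_of_mem _ (hC.inr_partner_mem hmem)).resolve_left (E.partner_ne _), hx'⟩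

theorem newLoops_simpleDiagram_of_partner_eq (h : E.partner (northLeft s) = northRight hn s) :
    newLoops (simpleDiagram hn s) E = {attached hn s {northLeft s, northRight hn s}} := by
  have component_eq : ∀ x ∈ attached hn s {northLeft s, northRight hn s},
      Sum.inr (northLeft s) ∈ component (simpleDiagram hn s) E x →
        component (simpleDiagram hn s) E x = attached hn s {northLeft s, northRight hn s} :=
    fun x hx hL => (isAttachable_north h).component_eq hx
      (by simp [hL, isSaturated_component.inr_northLeft_mem_iff.1 hL])
  ext C
  simp only [newLoops, Finset.mem_filter, Finset.mem_image, Finset.mem_univ, true_and,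
    Finset.mem_singleton]
  constructor
  · rintro ⟨⟨x, rfl⟩, hx⟩
    obtain ⟨hL, -, hx'⟩ := inr_northLeft_mem_component hx
    exact component_eq x hx' hL
  · rintro rfl
    refine ⟨⟨Sum.inr (northLeft s), component_eq _ (by simp) mem_component_self⟩, ?_⟩
    rintro ((i | i) | (i | i)) hx <;> simp [boundary] at hx ⊢
    tauto

theorem newLoops_simpleDiagram_of_partner_ne (h : E.partner (northLeft s) ≠ northRight hn s) :
    newLoops (simpleDiagram hn s) E = ∅ := by
  rw [newLoops, Finset.filter_eq_empty_iff]
  intro C hC hx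
  obtain ⟨x, -, rfl⟩ := Finset.mem_image.1 hC
  exact h (inr_northLeft_mem_component hx).2.1

theorem simpleDiagram_mul_loops (hn : 4 ≤ n) (s : Fin n) (E : Diagram n) :
    (simpleDiagram hn s * E).loops = E.loops +
      if E.partner (northLeft s) = northRight hn s then {E.deco (northLeft s) + simpleDeco s}
      else 0 := by
  change 0 + E.loops + (newLoops (simpleDiagram hn s) E).val.map _ = _
  rw [zero_add]
  congr 1
  split_ifs with h
  · rw [newLoops_simpleDiagram_of_partner_eq h, Finset.singleton_val, Multiset.map_singleton,
      (isAttachable_north h).decoOn_eq, if_pos (by simp),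
      Finset.sum_pair northLeft_ne_northRight, ← h, E.deco_partner]
    congr 1
    omega
  · rw [newLoops_simpleDiagram_of_partner_ne h]
    rfl

end SimpleDiagram

/-! ## Diagrams of words -/

theorem Node.pos_injective {n : ℕ} : Function.Injective (Node.pos (k := n)) := by
  rintro (i | i) (j | j) h <;> simp only [Node.pos] at h
  · exact congrArg _ (Fin.ext h)
  · omega
  · omega
  · exact congrArg _ (Fin.ext (by omega))

theorem isLDecorated_one {n : ℕ} : (1 : Diagram n).IsLDecorated where
  planar := by
    have partner_one : ∀ u : Node n, (1 : Diagram n).partner u = u.swap := fun _ => rfl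
    rintro (i | i) (j | j) ⟨h1, h2, h3⟩ <;>
      simp only [partner_one, Sum.swap_inl, Sum.swap_inr, Node.pos] at h1 h2 h3 <;> omega
  undecorated _ := ⟨fun _ => rfl, fun m hm => absurd hm (Multiset.notMem_zero m)⟩
  exposed u hu := absurd rfl hu

section SimpleDiagram

variable {n : ℕ} {hn : 4 ≤ n} {s : Fin n} {E : Diagram n}

theorem pos_northRight : (northRight hn s).pos = (northLeft s).pos + 1 := rfl

theorem not_between_north (v : Node n) : ¬ Between Node.pos (northLeft s) v (northRight hn s) := by
  rintro ⟨hl, hr⟩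
  rw [pos_northRight] at hr
  omega

theorem pos_northLeft_of_simpleDeco (h : simpleDeco s ≠ 0) : (northLeft s).pos = 0 := by
  have hs : (s : ℕ) = 0 := by simpa [simpleDeco] using h
  simp [Node.pos, leftNode, hs]

theorem exposed_of_pos_eq_zero {f : Node n → Node n} {u : Node n} (h : u.pos = 0) :
    Exposed Node.pos f u := by
  rintro v ⟨hv, -⟩
  omega

theorem Diagram.IsLDecorated.exposed_simpleDiagram_mul (hE : E.IsLDecorated) (u : Node n)
    (hu : (simpleDiagram hn s * E).deco u ≠ 0) :
    Exposed Node.pos (simpleDiagram hn s * E).partner u := by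
  have hplanar : Noncrossing Node.pos E.partner := hE.planar
  have hab : (northLeft s).pos < (northRight hn s).pos := by simp [pos_northRight]
  rw [simpleDiagram_mul_deco] at hu
  rw [simpleDiagram_mul_partner]
  split_ifs at hu with hnorth hnorth'
  · have hpos := pos_northLeft_of_simpleDeco hu
    rcases hnorth with rfl | rfl
    · exact exposed_of_pos_eq_zero hpos
    · rintro v ⟨-, hv, -⟩
      rw [Matching.joinPartner_right northLeft_ne_northRight] at hv
      omega
  · have hne : E.partner (northLeft s) ≠ northRight hn s := by
      intro e
      rw [← e, E.partner_invol, e] at hnorth'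
      tauto
    refine Exposed.joinPartner_partner hplanar Node.pos_injective E.partner_invol E.partner_ne hab
      hne (fun v hv => absurd hv (not_between_north v)) ?_ hnorth'
    by_cases hl : E.deco (northLeft s) = 0
    · by_cases hr : E.deco (northRight hn s) = 0
      · exact .inl (exposed_of_pos_eq_zero (pos_northLeft_of_simpleDeco (by omega)))
      · exact .inr (hE.exposed _ hr)
    · exact .inl (hE.exposed _ hl)
  · rw [not_or] at hnorth hnorth'
    exact Exposed.joinPartner_of_ne (hE.exposed u hu) hplanar Node.pos_injective E.partner_invol hab
      hnorth.1 hnorth.2 hnorth'.1 hnorth'.2 (not_between_north u)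

theorem Diagram.IsLDecorated.simpleDiagram_mul (hE : E.IsLDecorated) :
    (simpleDiagram hn s * E).IsLDecorated where
  planar := by
    change Noncrossing Node.pos (simpleDiagram hn s * E).partner
    rw [simpleDiagram_mul_partner]
    exact Noncrossing.joinPartner hE.planar Node.pos_injective E.partner_invol E.partner_ne
      (by simp [pos_northRight]) fun v hv => absurd hv (not_between_north v)
  undecorated h := by
    obtain ⟨j, hj⟩ := h (leftNode s)
    rw [simpleDiagram_mul_partner, Matching.joinPartner_left] at hj
    exact absurd hj Sum.inl_ne_inr
  exposed := hE.exposed_simpleDiagram_mul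

end SimpleDiagram

theorem isLDecorated_wordDiagram {n : ℕ} (hn : 4 ≤ n) (ω : List (Fin n)) :
    (wordDiagram hn ω).IsLDecorated := by
  induction ω with
  | nil => exact isLDecorated_one
  | cons s ω ih => exact ih.simpleDiagram_mul

/-! ## The matching of a diagram -/

namespace Matching

variable {V V' : Type*} [DecidableEq V] [DecidableEq V'] {i : V → V'} {f : V → V} {f' : V' → V'}

theorem joinPartner_map (hi : Function.Injective i) (hf : ∀ v, f' (i v) = i (f v)) (a b v : V) :
    joinPartner (i a) (i b) f' (i v) = i (joinPartner a b f v) := by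
  simp only [joinPartner, hf, hi.eq_iff]
  split_ifs <;> rfl

theorem joinParity_map (hi : Function.Injective i) (hf : ∀ v, f' (i v) = i (f v))
    {g : V → ZMod 2} {g' : V' → ZMod 2} (hg : ∀ v, g' (i v) = g v) (a b : V) (e : ZMod 2) (v : V) :
    joinParity (i a) (i b) e f' g' (i v) = joinParity a b e f g v := by
  simp only [joinParity, hf, hg, hi.eq_iff]

end Matching

section Box

variable {n i : ℕ}

/-- The nodes of the box of width `n` as nodes of the box of infinite width. -/
def toBoxNode : Node n → BoxNode := Sum.map Fin.val Fin.val

theorem toBoxNode_injective : Function.Injective (toBoxNode (n := n)) :=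
  Sum.map_injective.2 ⟨Fin.val_injective, Fin.val_injective⟩

theorem toBoxNode_ne_inl (hi : n ≤ i) (v : Node n) : toBoxNode v ≠ .inl i := by
  rcases v with j | j <;> simp [toBoxNode]
  omega

theorem toBoxNode_ne_inr (hi : n ≤ i) (v : Node n) : toBoxNode v ≠ .inr i := by
  rcases v with j | j <;> simp [toBoxNode]
  omega

theorem eq_toBoxNode_or (n : ℕ) (u : BoxNode) :
    (∃ v : Node n, u = toBoxNode v) ∨ ∃ i, n ≤ i ∧ (u = .inl i ∨ u = .inr i) := by
  rcases u with i | i <;> rcases lt_or_ge i n with hi | hi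
  · exact .inl ⟨.inl ⟨i, hi⟩, rfl⟩
  · exact .inr ⟨i, hi, .inl rfl⟩
  · exact .inl ⟨.inr ⟨i, hi⟩, rfl⟩
  · exact .inr ⟨i, hi, .inr rfl⟩

namespace Diagram

/-- The edges of a diagram, continued to the right by vertical edges. -/
noncomputable def boxPartner (D : Diagram n) : BoxNode → BoxNode :=
  Function.extend toBoxNode (toBoxNode ∘ D.partner) Sum.swap

/-- The numbers of decorations modulo two, continued by zero. -/
noncomputable def boxParity (D : Diagram n) : BoxNode → ZMod 2 :=
  Function.extend toBoxNode (fun v => (D.deco v : ZMod 2)) 0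

/-- There is a loop with an odd number of decorations. -/
def HasOddLoop (D : Diagram n) : Prop := ∃ m ∈ D.loops, Odd m

section Matching

variable (D : Diagram n)

theorem boxPartner_toBoxNode (v : Node n) : D.boxPartner (toBoxNode v) = toBoxNode (D.partner v) :=
  toBoxNode_injective.extend_apply _ _ _

theorem boxPartner_inl (hi : n ≤ i) : D.boxPartner (.inl i) = .inr i :=
  Function.extend_apply' _ _ _ fun ⟨v, hv⟩ => toBoxNode_ne_inl hi v hv

theorem boxPartner_inr (hi : n ≤ i) : D.boxPartner (.inr i) = .inl i :=
  Function.extend_apply' _ _ _ fun ⟨v, hv⟩ => toBoxNode_ne_inr hi v hv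

theorem boxParity_toBoxNode (v : Node n) : D.boxParity (toBoxNode v) = D.deco v :=
  toBoxNode_injective.extend_apply _ _ _

theorem boxParity_inl (hi : n ≤ i) : D.boxParity (.inl i) = 0 :=
  Function.extend_apply' _ _ _ fun ⟨v, hv⟩ => toBoxNode_ne_inl hi v hv

theorem boxParity_inr (hi : n ≤ i) : D.boxParity (.inr i) = 0 :=
  Function.extend_apply' _ _ _ fun ⟨v, hv⟩ => toBoxNode_ne_inr hi v hv

open Classical in
/-- The class of a diagram modulo the relations, up to powers of `δ`. -/
noncomputable def toMatching : Matching BoxNode where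
  partner := D.boxPartner
  parity u := if D.HasOddLoop then 0 else D.boxParity u
  hasLoop := D.HasOddLoop
  involutive u := by
    rcases eq_toBoxNode_or n u with ⟨v, rfl⟩ | ⟨i, hi, rfl | rfl⟩
    · simp only [boxPartner_toBoxNode, D.partner_invol v]
    · rw [D.boxPartner_inl hi, D.boxPartner_inr hi]
    · rw [D.boxPartner_inr hi, D.boxPartner_inl hi]
  partner_ne u := by
    rcases eq_toBoxNode_or n u with ⟨v, rfl⟩ | ⟨i, hi, rfl | rfl⟩
    · rw [boxPartner_toBoxNode]
      exact toBoxNode_injective.ne (D.partner_ne v)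
    · simp [D.boxPartner_inl hi]
    · simp [D.boxPartner_inr hi]
  parity_partner u := by
    rcases eq_toBoxNode_or n u with ⟨v, rfl⟩ | ⟨i, hi, rfl | rfl⟩
    · simp only [boxPartner_toBoxNode, boxParity_toBoxNode, D.deco_partner]
    · rw [D.boxPartner_inl hi, D.boxParity_inl hi, D.boxParity_inr hi]
    · rw [D.boxPartner_inr hi, D.boxParity_inl hi, D.boxParity_inr hi]
  parity_of_hasLoop h u := if_pos h

variable {D}

theorem parity_toMatching (h : ¬ D.HasOddLoop) : D.toMatching.parity = D.boxParity :=
  funext fun _ => if_neg h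

end Matching

theorem not_hasOddLoop_one : ¬ HasOddLoop (1 : Diagram n) := by
  rintro ⟨m, hm, -⟩
  exact absurd hm (Multiset.notMem_zero m)

theorem toMatching_one : toMatching (1 : Diagram n) = identity False := by
  refine Matching.ext_of_parity (funext fun u => ?_) (iff_of_false not_hasOddLoop_one id)
    fun h _ u => ?_
  · change boxPartner 1 u = u.swap
    rcases eq_toBoxNode_or n u with ⟨v, rfl⟩ | ⟨i, hi, rfl | rfl⟩
    · rw [boxPartner_toBoxNode]
      rcases v with v | v <;> rfl
    · rw [boxPartner_inl _ hi, Sum.swap_inl]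
    · rw [boxPartner_inr _ hi, Sum.swap_inr]
  · rw [parity_toMatching h]
    rcases eq_toBoxNode_or n u with ⟨v, rfl⟩ | ⟨i, hi, rfl | rfl⟩
    · rw [boxParity_toBoxNode]
      exact Nat.cast_zero
    · exact boxParity_inl _ hi
    · exact boxParity_inr _ hi

variable (hn : 4 ≤ n) (s : Fin n) (E : Diagram n)

theorem cast_simpleDeco : (simpleDeco s : ZMod 2) = letterParity s := by
  simp [simpleDeco, letterParity]

theorem boxPartner_leftEnd_eq_iff :
    E.boxPartner (leftEnd s) = rightEnd s ↔ E.partner (northLeft s) = northRight hn s := by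
  rw [← toBoxNode_injective.eq_iff, ← boxPartner_toBoxNode]
  rfl

theorem boxParity_leftEnd_ne_iff : E.boxParity (leftEnd s) ≠ letterParity s ↔
    Odd (E.deco (northLeft s) + simpleDeco s) := by
  have key : ∀ p q : ZMod 2, q ≠ p ↔ q + p ≠ 0 := by decide
  rw [show leftEnd (s : ℕ) = toBoxNode (northLeft s) from rfl, boxParity_toBoxNode, key,
    ← ZMod.natCast_ne_zero_iff_odd, Nat.cast_add, cast_simpleDeco]

theorem hasOddLoop_simpleDiagram_mul : (simpleDiagram hn s * E).HasOddLoop ↔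
    E.HasOddLoop ∨ E.boxPartner (leftEnd s) = rightEnd s ∧
      E.boxParity (leftEnd s) ≠ letterParity s := by
  rw [boxPartner_leftEnd_eq_iff hn, boxParity_leftEnd_ne_iff, HasOddLoop, simpleDiagram_mul_loops]
  simp only [Multiset.mem_add, or_and_right, exists_or]
  refine or_congr Iff.rfl ?_
  split_ifs with h <;> simp [h]

theorem hasLoop_op_toMatching : (stacking.op s E.toMatching).hasLoop ↔
    (simpleDiagram hn s * E).HasOddLoop := by
  rw [hasOddLoop_simpleDiagram_mul]
  by_cases h : E.HasOddLoop
  · exact iff_of_true (.inl h) (.inl h)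
  · rw [← parity_toMatching h]
    rfl

theorem boxPartner_simpleDiagram_mul : (simpleDiagram hn s * E).boxPartner =
    Matching.joinPartner (leftEnd s) (rightEnd s) E.boxPartner := by
  funext u
  have hmap := Matching.joinPartner_map toBoxNode_injective E.boxPartner_toBoxNode (northLeft s)
    (northRight hn s)
  have hne : ∀ u, (∀ v : Node n, toBoxNode v ≠ u) →
      Matching.joinPartner (leftEnd s) (rightEnd s) E.boxPartner u = E.boxPartner u := fun u hu =>
    Matching.joinPartner_of_ne (hu (northLeft s)).symm (hu (northRight hn s)).symm
      (E.boxPartner_toBoxNode (northLeft s) ▸ (hu _).symm)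
      (E.boxPartner_toBoxNode (northRight hn s) ▸ (hu _).symm)
  rcases eq_toBoxNode_or n u with ⟨v, rfl⟩ | ⟨i, hi, rfl | rfl⟩
  · rw [boxPartner_toBoxNode, simpleDiagram_mul_partner]
    exact (hmap v).symm
  · rw [hne _ (toBoxNode_ne_inl hi), boxPartner_inl _ hi, boxPartner_inl _ hi]
  · rw [hne _ (toBoxNode_ne_inr hi), boxPartner_inr _ hi, boxPartner_inr _ hi]

theorem boxParity_simpleDiagram_mul : (simpleDiagram hn s * E).boxParity =
    Matching.joinParity (leftEnd s) (rightEnd s) (letterParity s) E.boxPartner E.boxParity := by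
  funext u
  have hmap := Matching.joinParity_map toBoxNode_injective E.boxPartner_toBoxNode
    E.boxParity_toBoxNode (northLeft s) (northRight hn s) (letterParity s)
  have hne : ∀ u, (∀ v : Node n, toBoxNode v ≠ u) → Matching.joinParity (leftEnd s) (rightEnd s)
      (letterParity s) E.boxPartner E.boxParity u = E.boxParity u := by
    intro u hu
    have hl : u ≠ leftEnd s ∧ u ≠ E.boxPartner (leftEnd s) :=
      ⟨(hu (northLeft s)).symm, E.boxPartner_toBoxNode (northLeft s) ▸ (hu _).symm⟩
    have hr : u ≠ rightEnd s ∧ u ≠ E.boxPartner (rightEnd s) :=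
      ⟨(hu (northRight hn s)).symm, E.boxPartner_toBoxNode (northRight hn s) ▸ (hu _).symm⟩
    simp only [Matching.joinParity, hl, hr, or_self, if_false]
  rcases eq_toBoxNode_or n u with ⟨v, rfl⟩ | ⟨i, hi, rfl | rfl⟩
  · rw [boxParity_toBoxNode, simpleDiagram_mul_deco]
    refine Eq.trans ?_ (hmap v).symm
    rw [Matching.joinParity, ← cast_simpleDeco]
    split_ifs <;> push_cast <;> rfl
  · rw [hne _ (toBoxNode_ne_inl hi), boxParity_inl _ hi, boxParity_inl _ hi]
  · rw [hne _ (toBoxNode_ne_inr hi), boxParity_inr _ hi, boxParity_inr _ hi]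

theorem toMatching_simpleDiagram_mul :
    (simpleDiagram hn s * E).toMatching = stacking.op s E.toMatching := by
  have hloop := hasLoop_op_toMatching hn s E
  refine Matching.ext_of_parity (boxPartner_simpleDiagram_mul hn s E) hloop.symm fun h h' u => ?_
  have hE : ¬ E.HasOddLoop := fun hE => h' (.inl hE)
  rw [parity_toMatching h, boxParity_simpleDiagram_mul, ← parity_toMatching hE]
  exact congrFun (Matching.parity_join (leftEnd_ne_rightEnd s) h').symm u

open Classical in
theorem card_loops_simpleDiagram_mul :
    (simpleDiagram hn s * E).loops.card + (if E.HasOddLoop then 1 else 0) =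
      E.loops.card + stacking.exponent s E.toMatching +
        if (simpleDiagram hn s * E).HasOddLoop then 1 else 0 := by
  have hexponent : stacking.exponent s E.toMatching =
      if E.boxPartner (leftEnd s) = rightEnd s ∧
        (E.HasOddLoop ∨ E.boxParity (leftEnd s) = letterParity s) then 1 else 0 := by
    change ite (_ ∧ (E.HasOddLoop ∨ _)) 1 0 = _
    by_cases h : E.HasOddLoop
    · simp only [h, true_or]
      rfl
    · rw [parity_toMatching h]
      rfl
  rw [hexponent, if_congr (hasOddLoop_simpleDiagram_mul hn s E) rfl rfl, simpleDiagram_mul_loops,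
    Multiset.card_add]
  simp only [boxPartner_leftEnd_eq_iff hn]
  by_cases hp : E.partner (northLeft s) = northRight hn s <;> by_cases hl : E.HasOddLoop <;>
    by_cases hd : E.boxParity (leftEnd s) = letterParity s <;> simp [hp, hl, hd]

theorem toMatching_wordDiagram (ω : List (Fin n)) :
    (wordDiagram hn ω).toMatching = stacking.act (ω.map Fin.val) (identity False) := by
  induction ω with
  | nil => exact toMatching_one
  | cons s ω ih =>
    rw [List.map_cons, TLAction.act_cons, ← ih]
    exact toMatching_simpleDiagram_mul hn s _

open Classical in
theorem card_loops_wordDiagram (ω : List (Fin n)) :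
    (wordDiagram hn ω).loops.card = stacking.wordExponent (ω.map Fin.val) (identity False) +
      if (wordDiagram hn ω).HasOddLoop then 1 else 0 := by
  induction ω with
  | nil =>
    change 0 = 0 + if HasOddLoop (1 : Diagram n) then 1 else 0
    rw [if_neg not_hasOddLoop_one]
  | cons s ω ih =>
    have hcard := card_loops_simpleDiagram_mul hn s (wordDiagram hn ω)
    rw [toMatching_wordDiagram] at hcard
    change (simpleDiagram hn s * wordDiagram hn ω).loops.card =
      stacking.exponent s (stacking.act (ω.map Fin.val) (identity False)) +
        stacking.wordExponent (ω.map Fin.val) (identity False) +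
        if (simpleDiagram hn s * wordDiagram hn ω).HasOddLoop then 1 else 0
    omega

end Diagram

/-! ### Planar diagrams and planar matchings -/

theorem boxPos_toBoxNode_lt_iff {u v : Node n} :
    boxPos (toBoxNode u) < boxPos (toBoxNode v) ↔ u.pos < v.pos := by
  rcases u with i | i <;> rcases v with j | j <;> simp [toBoxNode, Node.pos] <;> omega

theorem not_between_toBoxNode (hi : n ≤ i) (u : Node n) :
    ¬ Between boxPos (.inl i) (toBoxNode u) (.inr i) := by
  rcases u with j | j <;> simp [Between, toBoxNode] <;> omega

theorem Diagram.IsPlanar.noncrossing {D : Diagram n} (h : D.IsPlanar) :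
    Noncrossing boxPos D.boxPartner := by
  intro u v
  rcases eq_toBoxNode_or n u with ⟨u, rfl⟩ | ⟨i, hi, rfl | rfl⟩
  · rcases eq_toBoxNode_or n v with ⟨v, rfl⟩ | ⟨i, hi, rfl | rfl⟩
    · simp only [boxPartner_toBoxNode, boxPos_toBoxNode_lt_iff]
      exact h u v
    · rw [boxPartner_toBoxNode, D.boxPartner_inl hi]
      exact fun hlt => not_between_toBoxNode hi _ hlt.2
    · rw [D.boxPartner_inr hi]
      exact fun hlt => not_boxPos_inr_lt_inl (hlt.2.1.trans hlt.2.2)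
  · rw [D.boxPartner_inl hi]
    rcases eq_toBoxNode_or n v with ⟨v, rfl⟩ | ⟨j, hj, rfl | rfl⟩
    · exact fun hlt => not_between_toBoxNode hi v ⟨hlt.1, hlt.2.1⟩
    · rw [D.boxPartner_inl hj]
      simp only [boxPos_inl_lt_inl, boxPos_inr_lt_inr]
      omega
    · rw [D.boxPartner_inr hj]
      exact fun hlt => not_boxPos_inr_lt_inl hlt.2.2
  · rw [D.boxPartner_inr hi]
    exact fun hlt => not_boxPos_inr_lt_inl (hlt.1.trans hlt.2.1)

theorem Diagram.IsLeftExposed.exposed {D : Diagram n} {u : Node n} (h : D.IsLeftExposed u) :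
    Exposed boxPos D.boxPartner (toBoxNode u) := by
  intro v
  rcases eq_toBoxNode_or n v with ⟨v, rfl⟩ | ⟨i, hi, rfl | rfl⟩
  · simp only [boxPartner_toBoxNode, boxPos_toBoxNode_lt_iff]
    exact h v
  · rw [D.boxPartner_inl hi]
    exact fun hlt => not_between_toBoxNode hi u ⟨hlt.1, hlt.2.2.1⟩
  · rw [D.boxPartner_inr hi]
    exact fun hlt => not_boxPos_inr_lt_inl (hlt.1.trans hlt.2.2.1)

theorem sum_nodes (F : BoxNode → ℕ) : ∑ u ∈ nodes n, F u = ∑ u : Node n, F (toBoxNode u) := by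
  rw [nodes, Finset.sum_disjSum, Fintype.sum_sum_type, Finset.sum_range, Finset.sum_range]
  rfl

end Box

/-! ## Normal forms of diagrams -/

section NormalForms

variable {n : ℕ}

namespace Diagram

/-- The diagrams that serve as normal forms: either there are no loops and at most one decoration
on each edge, or there is one loop, which carries one decoration, and the edges are undecorated. -/
def IsNormal (D : Diagram n) : Prop :=
  (D.loops = 0 ∧ ∀ u, D.deco u ≤ 1) ∨ (D.loops = {1} ∧ ∀ u, D.deco u = 0)

variable {D E : Diagram n} {u : Node n}

theorem not_hasOddLoop_of_loops_eq_zero (h : D.loops = 0) : ¬ D.HasOddLoop := by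
  simp [HasOddLoop, h]

theorem hasOddLoop_of_loops_eq_singleton (h : D.loops = {1}) : D.HasOddLoop := by
  simp [HasOddLoop, h]

theorem IsNormal.hasOddLoop_iff (h : D.IsNormal) :
    D.HasOddLoop ↔ D.loops = {1} ∧ ∀ u, D.deco u = 0 :=
  ⟨fun hl => h.resolve_left fun h' => not_hasOddLoop_of_loops_eq_zero h'.1 hl,
    fun h' => hasOddLoop_of_loops_eq_singleton h'.1⟩

theorem IsNormal.not_hasOddLoop_iff (h : D.IsNormal) :
    ¬ D.HasOddLoop ↔ D.loops = 0 ∧ ∀ u, D.deco u ≤ 1 :=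
  ⟨fun hl => h.resolve_right fun h' => hl (hasOddLoop_of_loops_eq_singleton h'.1),
    fun h' => not_hasOddLoop_of_loops_eq_zero h'.1⟩

theorem partner_eq_of_toMatching_eq (h : D.toMatching = E.toMatching) : D.partner = E.partner := by
  ext1 u
  have hu := congrFun (congrArg Matching.partner h) (toBoxNode u)
  change D.boxPartner _ = E.boxPartner _ at hu
  rwa [boxPartner_toBoxNode, boxPartner_toBoxNode, toBoxNode_injective.eq_iff] at hu

theorem hasOddLoop_iff_of_toMatching_eq (h : D.toMatching = E.toMatching) :
    D.HasOddLoop ↔ E.HasOddLoop :=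
  iff_of_eq (congrArg Matching.hasLoop h)

theorem cast_deco_eq_of_toMatching_eq (h : D.toMatching = E.toMatching) (hD : ¬ D.HasOddLoop)
    (u : Node n) : (D.deco u : ZMod 2) = E.deco u := by
  have hu := congrFun (congrArg Matching.parity h) (toBoxNode u)
  rwa [parity_toMatching hD, parity_toMatching (mt (hasOddLoop_iff_of_toMatching_eq h).2 hD),
    boxParity_toBoxNode, boxParity_toBoxNode] at hu

theorem IsNormal.eq_of_toMatching_eq (hD : D.IsNormal) (hE : E.IsNormal)
    (h : D.toMatching = E.toMatching) : D = E := by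
  have hp := partner_eq_of_toMatching_eq h
  by_cases hl : D.HasOddLoop
  · obtain ⟨hDl, hDd⟩ := hD.hasOddLoop_iff.1 hl
    obtain ⟨hEl, hEd⟩ := hE.hasOddLoop_iff.1 ((hasOddLoop_iff_of_toMatching_eq h).1 hl)
    exact Diagram.ext hp (funext fun u => (hDd u).trans (hEd u).symm) (hDl.trans hEl.symm)
  · obtain ⟨hDl, hDd⟩ := hD.not_hasOddLoop_iff.1 hl
    obtain ⟨hEl, hEd⟩ := hE.not_hasOddLoop_iff.1 (mt (hasOddLoop_iff_of_toMatching_eq h).2 hl)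
    refine Diagram.ext hp (funext fun u => ?_) (hDl.trans hEl.symm)
    have hmod := (ZMod.natCast_eq_natCast_iff' _ _ _).1 (cast_deco_eq_of_toMatching_eq h hl u)
    have := hDd u
    have := hEd u
    omega

theorem toMatching_congr (hp : D.partner = E.partner) (hl : D.HasOddLoop ↔ E.HasOddLoop)
    (hd : ¬ D.HasOddLoop → ∀ u, (D.deco u : ZMod 2) = E.deco u) :
    D.toMatching = E.toMatching := by
  refine Matching.ext_of_parity ?_ hl fun h h' => congrFun ?_
  · change D.boxPartner = E.boxPartner
    rw [boxPartner, hp]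
    rfl
  · rw [parity_toMatching h, parity_toMatching h', boxParity, boxParity, funext (hd h)]

theorem IsLDecorated.of_partner_eq (hD : D.IsLDecorated) (hp : E.partner = D.partner)
    (hd : ∀ u, D.deco u = 0 → E.deco u = 0)
    (hl : (∀ m ∈ D.loops, m = 0) → ∀ m ∈ E.loops, m = 0) : E.IsLDecorated where
  planar u v := by rw [hp]; exact hD.planar u v
  undecorated h := by
    obtain ⟨hdeco, hloops⟩ := hD.undecorated (hp ▸ h)
    exact ⟨fun u => hd u (hdeco u), hl hloops⟩
  exposed u hu v := by rw [hp]; exact hD.exposed u (mt (hd u) hu) v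

/-- The diagram with `c` decorations removed from the edge at `u`. -/
def undecorate (D : Diagram n) (u : Node n) (c : ℕ) : Diagram n where
  partner := D.partner
  partner_invol := D.partner_invol
  partner_ne := D.partner_ne
  deco v := if v = u ∨ v = D.partner u then D.deco v - c else D.deco v
  deco_partner v := by
    have h : (D.partner v = u ∨ D.partner v = D.partner u) ↔ (v = u ∨ v = D.partner u) := by
      rw [D.partner_invol.injective.eq_iff, D.partner_invol.eq_iff, or_comm]
    simp only [h, D.deco_partner]
  loops := D.loops

theorem undecorate_deco_self (c : ℕ) : (D.undecorate u c).deco u = D.deco u - c :=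
  if_pos (.inl rfl)

theorem undecorate_deco_partner (c : ℕ) :
    (D.undecorate u c).deco (D.partner u) = D.deco (D.partner u) - c :=
  if_pos (.inr rfl)

theorem undecorate_deco_of_ne {v : Node n} (c : ℕ) (h : v ≠ u) (h' : v ≠ D.partner u) :
    D.deco v = (D.undecorate u c).deco v :=
  (if_neg (not_or.2 ⟨h, h'⟩)).symm

theorem undecorate_deco_le (c : ℕ) (v : Node n) : (D.undecorate u c).deco v ≤ D.deco v := by
  simp only [undecorate]
  split_ifs <;> omega

theorem IsLDecorated.undecorate (hD : D.IsLDecorated) (u : Node n) (c : ℕ) :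
    (D.undecorate u c).IsLDecorated :=
  hD.of_partner_eq rfl (fun v hv => Nat.eq_zero_of_le_zero (hv ▸ undecorate_deco_le c v)) id

theorem sum_undecorate_lt {c : ℕ} (hc : c ≠ 0) (hu : c ≤ D.deco u) :
    ∑ v, (D.undecorate u c).deco v < ∑ v, D.deco v := by
  refine Finset.sum_lt_sum (fun v _ => undecorate_deco_le c v) ⟨u, Finset.mem_univ u, ?_⟩
  rw [undecorate_deco_self]
  omega

theorem reduces_undecorate_two (hu : 2 ≤ D.deco u) : D.Reduces 1 (D.undecorate u 2) :=
  .cancelEdge _ _ u rfl (by rw [undecorate_deco_self]; omega)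
    (fun _ => undecorate_deco_of_ne 2) rfl

theorem reduces_undecorate_one (hl : 1 ∈ D.loops) (hu : D.deco u ≠ 0) :
    D.Reduces 1 (D.undecorate u 1) :=
  .absorbEdge _ _ u rfl (by rw [undecorate_deco_self]; omega)
    (fun _ => undecorate_deco_of_ne 1) rfl hl

/-- The same edges, with other loops. -/
def withLoops (D : Diagram n) (L : Multiset ℕ) : Diagram n := { D with loops := L }

theorem reduces_withLoops {m : ℕ} (h : D.loops = {m + 2}) : D.Reduces 1 (D.withLoops {m}) :=
  .cancelLoop _ _ m 0 rfl rfl h rfl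

/-- A relation of coefficient `1` that rewrites `D` as `E` with fewer decorations, without removing
a loop or changing the matching. -/
structure Simplifies (D E : Diagram n) : Prop where
  reduces : D.Reduces 1 E
  toMatching_eq : E.toMatching = D.toMatching
  card_loops_eq : E.loops.card = D.loops.card
  lt : ∑ u, E.deco u + E.loops.sum < ∑ u, D.deco u + D.loops.sum

theorem simplifies_undecorate_two (hu : 2 ≤ D.deco u) : D.Simplifies (D.undecorate u 2) where
  reduces := reduces_undecorate_two hu
  toMatching_eq := by
    refine toMatching_congr rfl Iff.rfl fun _ v => (ZMod.natCast_eq_natCast_iff' _ _ _).2 ?_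
    have hpu := D.deco_partner u
    by_cases hv : v = u
    · subst hv
      rw [undecorate_deco_self]
      omega
    by_cases hv' : v = D.partner u
    · subst hv'
      rw [undecorate_deco_partner]
      omega
    · rw [undecorate_deco_of_ne 2 hv hv']
  card_loops_eq := rfl
  lt := Nat.add_lt_add_right (sum_undecorate_lt two_ne_zero hu) _

theorem simplifies_undecorate_one (hl : D.loops = {1}) (hu : D.deco u ≠ 0) :
    D.Simplifies (D.undecorate u 1) where
  reduces := reduces_undecorate_one (hl ▸ Multiset.mem_singleton_self 1) hu
  toMatching_eq :=
    toMatching_congr rfl Iff.rfl fun h => absurd (hasOddLoop_of_loops_eq_singleton hl) h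
  card_loops_eq := rfl
  lt := Nat.add_lt_add_right (sum_undecorate_lt one_ne_zero (Nat.one_le_iff_ne_zero.2 hu)) _

theorem simplifies_withLoops {m : ℕ} (h : D.loops = {m + 2}) (hm : Odd m) :
    D.Simplifies (D.withLoops {m}) where
  reduces := reduces_withLoops h
  toMatching_eq := by
    refine toMatching_congr rfl (iff_of_true ⟨m, Multiset.mem_singleton_self m, hm⟩
      ⟨m + 2, h ▸ Multiset.mem_singleton_self _, hm.add_even even_two⟩) fun _ _ => rfl
  card_loops_eq := by simp [withLoops, h]
  lt := by simp [withLoops, h]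

theorem isNormal_or_exists_simplifies_of_hasOddLoop (hD : D.IsLDecorated) (h : D.HasOddLoop)
    (hc : D.loops.card = 1) : D.IsNormal ∨ ∃ E : LDiagram n, D.Simplifies E.1 := by
  obtain ⟨m, hm⟩ := Multiset.card_eq_one.1 hc
  have hodd : Odd m := by simpa [HasOddLoop, hm] using h
  rcases m with _ | _ | m
  · exact absurd hodd Nat.not_odd_zero
  · by_cases hd : ∀ u, D.deco u = 0
    · exact .inl (.inr ⟨hm, hd⟩)
    · obtain ⟨u, hu⟩ := not_forall.1 hd
      exact .inr ⟨⟨_, hD.undecorate u 1⟩, simplifies_undecorate_one hm hu⟩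
  · have hne : ¬ ∀ k ∈ D.loops, k = 0 := fun h0 => absurd (h0 (m + 2) (by simp [hm])) (by omega)
    have hoddm : Odd m := by simpa [parity_simps] using hodd
    exact .inr ⟨⟨D.withLoops {m}, hD.of_partner_eq rfl (fun _ => id) fun h0 => absurd h0 hne⟩,
      simplifies_withLoops hm hoddm⟩

theorem isNormal_or_exists_simplifies_of_loops_eq_zero (hD : D.IsLDecorated) (hl : D.loops = 0) :
    D.IsNormal ∨ ∃ E : LDiagram n, D.Simplifies E.1 := by
  by_cases hd : ∀ u, D.deco u ≤ 1
  · exact .inl (.inl ⟨hl, hd⟩)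
  · obtain ⟨u, hu⟩ := not_forall.1 hd
    exact .inr ⟨⟨_, hD.undecorate u 2⟩, simplifies_undecorate_two (not_le.1 hu)⟩

theorem two_dvd_sum_deco (D : Diagram n) : 2 ∣ ∑ u, D.deco u := by
  rw [← ZMod.natCast_eq_zero_iff]
  push_cast
  refine Finset.sum_involution (fun u _ => D.partner u) (fun u _ => ?_)
    (fun u _ _ => D.partner_ne u) (fun u _ => Finset.mem_univ _) (fun u _ => D.partner_invol u)
  rw [D.deco_partner]
  exact CharTwo.add_self_eq_zero _

theorem isIrreducible_of_loops_eq_singleton (hl : D.loops = {1}) (hd : ∀ u, D.deco u = 0) :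
    D.IsIrreducible := by
  intro c E hr
  cases hr with
  | loop _ _ _ h => simpa [hl] using congrArg (0 ∈ ·) h
  | cancelEdge _ u _ hu => simp [hd] at hu
  | cancelLoop _ m L _ _ h => simpa [hl] using congrArg (m + 2 ∈ ·) h
  | absorbEdge _ u _ hu => simp [hd] at hu
  | absorbLoop _ m L _ _ h => simpa [hl] using congrArg Multiset.card h

theorem isIrreducible_of_loops_eq_zero (hl : D.loops = 0) (hd : ∀ u, D.deco u ≤ 1) :
    D.IsIrreducible := by
  intro c E hr
  cases hr with
  | loop _ _ _ h => simp [hl] at h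
  | cancelEdge _ u _ hu => exact absurd (hd u) (by omega)
  | cancelLoop _ m L _ _ h => simp [hl] at h
  | absorbEdge _ u _ _ _ _ h => simp [hl] at h
  | absorbLoop _ m L _ _ h => simp [hl] at h

end Diagram

open Diagram

theorem LDiagram.toAlgebra_eq_of_reduces {D E : LDiagram n} (h : D.1.Reduces 1 E.1) :
    D.toAlgebra = E.toAlgebra := by
  unfold toAlgebra
  rw [← sub_eq_zero, ← map_sub, Submodule.mkQ_apply, Submodule.Quotient.mk_eq_zero]
  exact Submodule.subset_span ⟨D, E, 1, h, rfl⟩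

open Classical in
theorem exists_isNormal (D : LDiagram n)
    (hD : D.1.loops.card = if D.1.HasOddLoop then 1 else 0) :
    ∃ E : LDiagram n, E.1.IsNormal ∧ E.1.toMatching = D.1.toMatching ∧
      D.toAlgebra = E.toAlgebra := by
  induction hN : ∑ u, D.1.deco u + D.1.loops.sum using Nat.strong_induction_on generalizing D with
  | _ N ih =>
  subst hN
  have hstep : D.1.IsNormal ∨ ∃ E : LDiagram n, D.1.Simplifies E.1 := by
    by_cases hl : D.1.HasOddLoop
    · exact isNormal_or_exists_simplifies_of_hasOddLoop D.2 hl (hD.trans (if_pos hl))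
    · exact isNormal_or_exists_simplifies_of_loops_eq_zero D.2
        (Multiset.card_eq_zero.1 (hD.trans (if_neg hl)))
  rcases hstep with hnormal | ⟨E, hE⟩
  · exact ⟨D, hnormal, rfl, rfl⟩
  · have hloop := hasOddLoop_iff_of_toMatching_eq hE.toMatching_eq
    obtain ⟨F, hF, hFm, hFa⟩ := ih _ hE.lt E
      (by rw [hE.card_loops_eq, hD, if_congr hloop rfl rfl]) rfl
    exact ⟨F, hF, hFm.trans hE.toMatching_eq,
      (LDiagram.toAlgebra_eq_of_reduces hE.reduces).trans hFa⟩

theorem isTypeI_iff {D : LDiagram n} :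
    D.IsTypeI ↔ D.1.loops = {1} ∧ ∀ u, D.1.deco u = 0 := by
  refine ⟨fun ⟨hi, ⟨m, hm0, hm⟩, hd⟩ => ⟨?_, hd⟩, fun ⟨hl, hd⟩ =>
    ⟨isIrreducible_of_loops_eq_singleton hl hd, ⟨1, one_ne_zero, hl⟩, hd⟩⟩
  rcases m with _ | _ | m
  · exact absurd rfl hm0
  · exact hm
  · exact absurd (reduces_withLoops hm) (hi 1 _)

theorem isTypeII_iff {D : LDiagram n} :
    D.IsTypeII ↔ D.1.loops = 0 ∧ (∀ u, D.1.deco u ≤ 1) ∧ 4 ∣ ∑ u, D.1.deco u := by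
  have hdvd := two_dvd_sum_deco D.1
  have heven (hl : D.1.loops = 0) : Even D.numDecorations ↔ 4 ∣ ∑ u, D.1.deco u := by
    rw [LDiagram.numDecorations, hl, Multiset.sum_zero, add_zero, Nat.even_iff]
    omega
  constructor
  · rintro ⟨hi, hl, he⟩
    exact ⟨hl, fun u => not_lt.1 fun hu => hi 1 _ (reduces_undecorate_two hu), (heven hl).1 he⟩
  · rintro ⟨hl, hd, hs⟩
    exact ⟨isIrreducible_of_loops_eq_zero hl hd, hl, (heven hl).2 hs⟩

theorem LDiagram.IsTypeI.isNormal {D : LDiagram n} (h : D.IsTypeI) : D.1.IsNormal :=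
  .inr (isTypeI_iff.1 h)

theorem LDiagram.IsTypeII.isNormal {D : LDiagram n} (h : D.IsTypeII) : D.1.IsNormal :=
  .inl ⟨(isTypeII_iff.1 h).1, (isTypeII_iff.1 h).2.1⟩

end NormalForms

/-! ## The correspondence -/

theorem four_dvd_sum_op {m s : ℕ} (hm : 2 ≤ m) (hs : s < m) {x : Matching BoxNode}
    (hx : ∀ i, m ≤ i → x.partner (.inl i) = .inr i) (hl : ¬ (stacking.op s x).hasLoop)
    (h : 4 ∣ ∑ u ∈ nodes m, (x.parity u).val) :
    4 ∣ ∑ u ∈ nodes m, ((stacking.op s x).parity u).val := by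
  have hne := leftEnd_ne_rightEnd s
  by_cases hp : x.partner (leftEnd s) = rightEnd s
  · have hpar : x.parity (leftEnd s) = letterParity s :=
      not_not.1 fun hpar => hl ((Matching.hasLoop_join hne).2 (.inr ⟨hp, hpar⟩))
    rwa [stacking_op_eq_self_iff.2 ⟨hp, .inr hpar⟩]
  · have hleft : leftEnd s ∈ nodes m := inl_mem_nodes.2 (by omega)
    have hright : rightEnd s ∈ nodes m := inl_mem_nodes.2 (by omega)
    rw [show (stacking.op s x).parity = _ from Matching.parity_join hne hl]
    exact (Matching.four_dvd_sum_joinParity_iff _ hne hp hleft hright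
      (partner_mem_nodes hx hleft) (partner_mem_nodes hx hright)).2 h

theorem four_dvd_sum_act {m : ℕ} (hm : 2 ≤ m) {w : List ℕ} (hw : ∀ k ∈ w, k < m)
    (hl : ¬ (stacking.act w (identity False)).hasLoop) :
    4 ∣ ∑ u ∈ nodes m, ((stacking.act w (identity False)).parity u).val := by
  induction w with
  | nil => simp [TLAction.act, identity]
  | cons s w ih =>
    obtain ⟨hs, hw⟩ := List.forall_mem_cons.1 hw
    have hvertical (i : ℕ) (hi : m ≤ i) :=
      (vertical_eq_self_iff.1 (vertical_act_identity (hm.trans hi)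
        (fun k hk => (hw k hk).trans_le hi) False)).1
    exact four_dvd_sum_op hm hs hvertical hl (ih hw fun h => hl (.inl h))

section Correspondence

variable {n : ℕ}

namespace Diagram

theorem sum_parity_toMatching {D : Diagram n} (hl : D.loops = 0) (hd : ∀ u, D.deco u ≤ 1) :
    ∑ u ∈ nodes n, (D.toMatching.parity u).val = ∑ u, D.deco u := by
  rw [sum_nodes, parity_toMatching (not_hasOddLoop_of_loops_eq_zero hl)]
  refine Finset.sum_congr rfl fun u _ => ?_
  rw [boxParity_toBoxNode, ZMod.val_natCast]
  exact Nat.mod_eq_of_lt (Nat.lt_succ_of_le (hd u))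

theorem partner_eq_swap_of_boxPartner_eq_swap {D : Diagram n} (h : D.boxPartner = Sum.swap) :
    D.partner = Sum.swap := by
  funext u
  refine toBoxNode_injective ?_
  rw [← boxPartner_toBoxNode, h]
  rcases u with i | i <;> rfl

end Diagram

open Diagram

namespace LDiagram

variable {D : LDiagram n}

theorem IsTypeI.exists_word (hn : 2 ≤ n) (h : D.IsTypeI) :
    ∃ w : List ℕ, (∀ k ∈ w, k < n) ∧ stacking.act w (identity False) = D.1.toMatching := by
  have hl := (isTypeI_iff.1 h).1
  refine exists_word_of_hasLoop hn (hasOddLoop_of_loops_eq_singleton hl) D.2.planar.noncrossing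
    (fun i hi => D.1.boxPartner_inl hi) fun hswap => ?_
  have hpartner := partner_eq_swap_of_boxPartner_eq_swap hswap
  have hloops := (D.2.undecorated fun i => ⟨i, congrFun hpartner (.inl i)⟩).2
  exact one_ne_zero (hloops 1 (hl ▸ Multiset.mem_singleton_self 1))

theorem IsTypeII.isAdmissible (h : D.IsTypeII) : IsAdmissible n D.1.toMatching := by
  obtain ⟨hl, hd, hs⟩ := isTypeII_iff.1 h
  have hloop := not_hasOddLoop_of_loops_eq_zero hl
  have hparity := parity_toMatching hloop
  refine ⟨D.2.planar.noncrossing, fun u hu => ?_, hloop, fun i hi => D.1.boxPartner_inl hi,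
    fun i hi => by rw [hparity, D.1.boxParity_inl hi], by rwa [sum_parity_toMatching hl hd]⟩
  rw [hparity] at hu
  rcases eq_toBoxNode_or n u with ⟨v, rfl⟩ | ⟨i, hi, rfl | rfl⟩
  · rw [boxParity_toBoxNode] at hu
    exact (D.2.exposed v fun h0 => hu (by rw [h0, Nat.cast_zero])).exposed
  · exact absurd (D.1.boxParity_inl hi) hu
  · exact absurd (D.1.boxParity_inr hi) hu

end LDiagram

variable (hn : 4 ≤ n)

theorem exists_isNormal_wordDiagram {ω : List (Fin n)} {w : W n} (h : IsReducedExpr ω w)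
    (hw : IsFullyCommutative w) :
    ∃ E : LDiagram n, E.1.IsNormal ∧ E.1.toMatching = matchingOf w ∧
      LDiagram.toAlgebra ⟨wordDiagram hn ω, isLDecorated_wordDiagram hn ω⟩ = E.toAlgebra := by
  classical
  have hcard := card_loops_wordDiagram hn ω
  rw [((fcWord_map_iff Fin.val_injective).2 (h.fcWord hw)).wordExponent_eq_zero,
    zero_add] at hcard
  rw [← h.act_eq_matchingOf hw, ← toMatching_wordDiagram hn]
  exact exists_isNormal ⟨wordDiagram hn ω, isLDecorated_wordDiagram hn ω⟩ hcard

/-- The irreducible diagram `d_w`, defined through one reduced expression of `w`; by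
`toAlgebra_wordDiagram` all reduced expressions give the same diagram. -/
noncomputable def normalDiagram (w : FC n) : LDiagram n :=
  (exists_isNormal_wordDiagram hn (exists_isReducedExpr w.1).choose_spec w.2).choose

theorem isNormal_normalDiagram (w : FC n) : (normalDiagram hn w).1.IsNormal :=
  (exists_isNormal_wordDiagram hn (exists_isReducedExpr w.1).choose_spec w.2).choose_spec.1

theorem toMatching_normalDiagram (w : FC n) :
    (normalDiagram hn w).1.toMatching = matchingOf w.1 :=
  (exists_isNormal_wordDiagram hn (exists_isReducedExpr w.1).choose_spec w.2).choose_spec.2.1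

theorem normalDiagram_eq {w : FC n} {D : LDiagram n} (hD : D.1.IsNormal)
    (h : matchingOf w.1 = D.1.toMatching) : normalDiagram hn w = D :=
  Subtype.ext ((isNormal_normalDiagram hn w).eq_of_toMatching_eq hD
    ((toMatching_normalDiagram hn w).trans h))

theorem toAlgebra_wordDiagram {ω : List (Fin n)} {w : FC n} (h : IsReducedExpr ω w.1) :
    LDiagram.toAlgebra ⟨wordDiagram hn ω, isLDecorated_wordDiagram hn ω⟩ =
      (normalDiagram hn w).toAlgebra := by
  obtain ⟨E, hE, hEm, hEa⟩ := exists_isNormal_wordDiagram hn h w.2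
  rw [hEa, normalDiagram_eq hn hE hEm.symm]

theorem hasOddLoop_normalDiagram_iff (w : FC n) :
    (normalDiagram hn w).1.HasOddLoop ↔ HeapTypeI w.1 := by
  rw [heapTypeI_iff w.2, ← toMatching_normalDiagram hn w]
  rfl

theorem isTypeI_normalDiagram_iff (w : FC n) :
    (normalDiagram hn w).IsTypeI ↔ HeapTypeI w.1 := by
  rw [isTypeI_iff, ← (isNormal_normalDiagram hn w).hasOddLoop_iff, hasOddLoop_normalDiagram_iff]

theorem four_dvd_sum_normalDiagram {w : FC n} (h : HeapTypeII w.1) :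
    4 ∣ ∑ u ∈ nodes n, ((normalDiagram hn w).1.toMatching.parity u).val := by
  obtain ⟨ω, hω⟩ := exists_isReducedExpr w.1
  rw [HeapTypeII, heapTypeI_iff w.2, ← hω.act_eq_matchingOf w.2] at h
  rw [toMatching_normalDiagram, ← hω.act_eq_matchingOf w.2]
  refine four_dvd_sum_act (by omega) (fun k hk => ?_) h
  obtain ⟨i, -, rfl⟩ := List.mem_map.1 hk
  exact i.2

theorem isTypeII_normalDiagram_iff (w : FC n) :
    (normalDiagram hn w).IsTypeII ↔ HeapTypeII w.1 := by
  have hnormal := (isNormal_normalDiagram hn w).not_hasOddLoop_iff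
  rw [hasOddLoop_normalDiagram_iff] at hnormal
  rw [isTypeII_iff]
  refine ⟨fun h => hnormal.2 ⟨h.1, h.2.1⟩, fun h => ?_⟩
  obtain ⟨hl, hd⟩ := hnormal.1 h
  exact ⟨hl, hd, sum_parity_toMatching hl hd ▸ four_dvd_sum_normalDiagram hn h⟩

theorem normalDiagram_injective : Function.Injective (normalDiagram hn) := fun w w' h =>
  Subtype.ext (matchingOf_injOn w.2 w'.2
    (by rw [← toMatching_normalDiagram hn, h, toMatching_normalDiagram]))

theorem exists_normalDiagram_eq {D : LDiagram n} (hD : D.1.IsNormal)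
    (h : ∃ w : List ℕ, (∀ k ∈ w, k < n) ∧ stacking.act w (identity False) = D.1.toMatching) :
    ∃ w, normalDiagram hn w = D := by
  obtain ⟨v, hv, hvD⟩ := h
  obtain ⟨w, hw, hwv⟩ := exists_matchingOf_eq hv
  exact ⟨⟨w, hw⟩, normalDiagram_eq hn hD (hwv.trans hvD)⟩

theorem bijOn_normalDiagram_typeI :
    Set.BijOn (normalDiagram hn) {w | HeapTypeI w.1} {D | D.IsTypeI} := by
  refine ⟨fun w => (isTypeI_normalDiagram_iff hn w).2, (normalDiagram_injective hn).injOn,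
    fun D hD => ?_⟩
  obtain ⟨w, rfl⟩ := exists_normalDiagram_eq hn hD.isNormal (hD.exists_word (by omega))
  exact ⟨w, (isTypeI_normalDiagram_iff hn w).1 hD, rfl⟩

theorem bijOn_normalDiagram_typeII :
    Set.BijOn (normalDiagram hn) {w | HeapTypeII w.1} {D | D.IsTypeII} := by
  refine ⟨fun w => (isTypeII_normalDiagram_iff hn w).2, (normalDiagram_injective hn).injOn,
    fun D hD => ?_⟩
  obtain ⟨w, rfl⟩ := exists_normalDiagram_eq hn hD.isNormal hD.isAdmissible.exists_word
  exact ⟨w, (isTypeII_normalDiagram_iff hn w).1 hD, rfl⟩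

end Correspondence

end TLD

theorem mainTheorem4 (n : ℕ) (hn : 4 ≤ n) :
    ∃ d : TLD.FC n → TLD.LDiagram n,
      (∀ (w : TLD.FC n) (ω : List (Fin n)), TLD.IsReducedExpr ω w.1 →
        ∃ h : (TLD.wordDiagram hn ω).IsLDecorated,
          TLD.LDiagram.toAlgebra ⟨TLD.wordDiagram hn ω, h⟩ = (d w).toAlgebra) ∧
      (∀ w : TLD.FC n, (d w).IsTypeI ↔ TLD.HeapTypeI w.1) ∧
      (∀ w : TLD.FC n, (d w).IsTypeII ↔ TLD.HeapTypeII w.1) ∧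
      Set.BijOn d {w | TLD.HeapTypeI w.1} {D | D.IsTypeI} ∧
      Set.BijOn d {w | TLD.HeapTypeII w.1} {D | D.IsTypeII} := by
  refine ⟨TLD.normalDiagram hn, fun w ω h => ?_, TLD.isTypeI_normalDiagram_iff hn,
    TLD.isTypeII_normalDiagram_iff hn, TLD.bijOn_normalDiagram_typeI hn,
    TLD.bijOn_normalDiagram_typeII hn⟩
  exact ⟨TLD.isLDecorated_wordDiagram hn ω, TLD.toAlgebra_wordDiagram hn h⟩
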